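/- Identify $\mathbb{R}^2$ with $\mathbb{C}$, and let $\Delta=\{\operatorname{Im} z=0\}$. An isotopy is a family $(\varphi_t)_{t\in[0,1]}$ of homeomorphisms of the plane with $\varphi_0=\mathrm{Id}$, such that $\varphi_t(z)$ and $\varphi_t^{-1}(z)$ are jointly continuous in $(t,z)$. Two sets $H,K$ are isotopic rel $X$ if $K=\varphi_1(H)$ for an isotopy with $\varphi_t(x)=x$ for all $x\in X$, $t\in[0,1]$. For integers $n,p\ge 1$ put $p_1=-\frac n2$, $p_2=\frac{-n+p}2$, $p_3=\frac p2$ and $X_{n,p}=\{p_1,p_2,p_3\}$. For $m\ge1$ let $R_m=\{\lfloor \frac m2\rfloor-\frac m2+\frac12+i : 0\le i\le \lfloor\frac{m-1}2\rfloor\}$. The snail $\mathbb{SN}(n;p)$ is the union of the half-circles $\{\operatorname{Im}z\le0,\ |z-p_1|=r\}$ with $r\in R_n$, $\{\operatorname{Im}z\le0,\ |z-p_3|=r\}$ with $r\in R_p$, and $\{\operatorname{Im}z\ge0,\ |z-p_2|=r\}$ with $r\in R_{n+p}$. For $X\subset\Delta$, the class $\mathbb{SN}_X(n;p)$ consists of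 all sets $\varphi_1(\mathbb{SN}(n;p))$, where $(\varphi_t)$ is an isotopy with $\varphi_t(X_{n,p})\subset\Delta$ for all $t$ and $\varphi_1(X_{n,p})=X$. Given $p_1<p_2<p_3$ on $\Delta$, a homeomorphism $f$ of the plane is of type $A$ (resp. type $B$) if $f$ exchanges $p_1$ and $p_2$ and fixes $p_3$ (resp. fixes $p_1$ and exchanges $p_2$ and $p_3$), and there is an isotopy $(f_t)$ with $f_1=f$ such that for all $t\in(0,1)$: $f_t(p_1)\in\Delta$, $f_t(p_3)\in\Delta$ and $\operatorname{Im} f_t(p_2)\ge0$. Let $A(x;y)=(x+y;y)$ and $B(x;y)=(x;x+y)$. The characteristic sequences of a pair $(n;p)$ of coprime positive integers are the natural numbers $\alpha_1,\dots,\alpha_N$ and $\beta_1,\dots,\beta_N$ ($N\ge1$), with $\alpha_i>0$ for $i\ne1$ and $\beta_i>0$ for $i\neq N$, such that $(n;p)=B^{\beta_N}\circ A^{\alpha_N}\circ\cdots\circ B^{\beta_1}\circ A^{\alpha_1}(1;1)$. **Theorem.** Let $n,p$ be coprime positive integers with characteristic sequences $(\alpha_i)_{1\le i\le N}$, $(\beta_i)_{1\le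 i\le N}$, let $X=X_{n,p}=\{p_1,p_2,p_3\}$ be the set of centers of $\mathbb{SN}(n;p)$, and let $f_A$, $f_B$ be homeomorphisms of type $A$ and type $B$ relative to $p_1,p_2,p_3$. Put $F=f_B^{\beta_N}\circ f_A^{\alpha_N}\circ\cdots\circ f_B^{\beta_1}\circ f_A^{\alpha_1}$. Then: 1. $\{F(\Gamma) : \Gamma\in\mathbb{SN}_X(1;1)\}=\mathbb{SN}_X(n;p)$, and for every $\Gamma\in\mathbb{SN}_X(1;1)$ the set $F(\Gamma)$ is isotopic rel $X$ to the concrete snail $\mathbb{SN}(n;p)$. 2. For every $S\in\mathbb{SN}_X(n;p)$ (in particular for $S=\mathbb{SN}(n;p)$), $n$ is the minimum of the number of points of $S\cap K$ over all $K$ isotopic rel $X$ to the perpendicular bisector $\Delta_1$ of $[p_1,p_2]$, and $p$ is the minimum of the number of points of $S\cap K$ over all $K$ isotopic rel $X$ to the perpendicular bisector $\Delta_2$ of $[p_2,p_3]$. -/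

import Mathlib

noncomputable section

/-- An isotopy of the plane `ℝ² = ℂ` starting at the identity: a family `(φ t)`, `t ∈ [0,1]`, of
homeomorphisms of the plane with `φ 0 = id`, such that `(t, z) ↦ φ t z` and
`(t, z) ↦ (φ t)⁻¹ z` are continuous. -/
def IsIsotopyFromId (φ : unitInterval → (ℂ ≃ₜ ℂ)) : Prop :=
  φ 0 = Homeomorph.refl ℂ ∧
  Continuous (fun q : unitInterval × ℂ => φ q.1 q.2) ∧
  Continuous (fun q : unitInterval × ℂ => (φ q.1).symm q.2)

/-- `H` and `K` are isotopic relatively to `X`: an isotopy of the plane that starts at the identity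
and fixes every point of `X` at all times carries `H` to `K`. -/
def IsotopicRel (X H K : Set ℂ) : Prop :=
  ∃ φ : unitInterval → (ℂ ≃ₜ ℂ), IsIsotopyFromId φ ∧ (∀ t, ∀ x ∈ X, φ t x = x) ∧ φ 1 '' H = K

/-- `f` is of the type `A` (top-displacement of the middle point to the left) relatively to the
points `p₁, p₂, p₃` of the horizontal axis `Δ = {Im z = 0}`. -/
def IsTypeA (p₁ p₂ p₃ : ℂ) (f : ℂ ≃ₜ ℂ) : Prop :=
  f p₁ = p₂ ∧ f p₂ = p₁ ∧ f p₃ = p₃ ∧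
  ∃ φ : unitInterval → (ℂ ≃ₜ ℂ), IsIsotopyFromId φ ∧ φ 1 = f ∧
    ∀ t ∈ Set.Ioo (0 : unitInterval) 1,
      (φ t p₁).im = 0 ∧ (φ t p₃).im = 0 ∧ ¬ (φ t p₂).im < 0

/-- `f` is of the type `B` (top-displacement of the middle point to the right) relatively to the
points `p₁, p₂, p₃` of the horizontal axis `Δ = {Im z = 0}`. -/
def IsTypeB (p₁ p₂ p₃ : ℂ) (f : ℂ ≃ₜ ℂ) : Prop :=
  f p₁ = p₁ ∧ f p₂ = p₃ ∧ f p₃ = p₂ ∧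
  ∃ φ : unitInterval → (ℂ ≃ₜ ℂ), IsIsotopyFromId φ ∧ φ 1 = f ∧
    ∀ t ∈ Set.Ioo (0 : unitInterval) 1,
      (φ t p₁).im = 0 ∧ (φ t p₃).im = 0 ∧ ¬ (φ t p₂).im < 0

/-- The center `p₁ = -n/2` of the left sustaining half-circles. -/
def snailCenter₁ (n _p : ℕ) : ℂ := -(n : ℂ) / 2

/-- The center `p₂ = (-n+p)/2` of the emerging half-circles. -/
def snailCenter₂ (n p : ℕ) : ℂ := (-(n : ℂ) + p) / 2

/-- The center `p₃ = p/2` of the right sustaining half-circles. -/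
def snailCenter₃ (_n p : ℕ) : ℂ := (p : ℂ) / 2

/-- The set `X = {p₁, p₂, p₃}` of the three centers of the snail `SN(n;p)`. -/
def snailCenters (n p : ℕ) : Set ℂ := {snailCenter₁ n p, snailCenter₂ n p, snailCenter₃ n p}

/-- The radii `⌊m/2⌋ - m/2 + 1/2 + i`, `0 ≤ i ≤ ⌊(m-1)/2⌋`, of the concentric half-circles whose
ends are `m` consecutive points at distance one (the bound on `i` says `2 i + 1 ≤ m`). -/
def snailRadii (m : ℕ) : Set ℝ :=
  {r | ∃ i : ℕ, 2 * i + 1 ≤ m ∧ r = ((m / 2 : ℕ) : ℝ) - (m : ℝ) / 2 + 1 / 2 + i}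

/-- The concrete snail `SN(n;p)`: the union of the left and right sustaining half-circles in the
closed bottom half-plane and of the emerging half-circles in the closed top half-plane
(a half-circle of radius zero is its center). -/
def snail (n p : ℕ) : Set ℂ :=
  {z | z.im ≤ 0 ∧ ‖z - snailCenter₁ n p‖ ∈ snailRadii n} ∪
  {z | z.im ≤ 0 ∧ ‖z - snailCenter₃ n p‖ ∈ snailRadii p} ∪
  {z | 0 ≤ z.im ∧ ‖z - snailCenter₂ n p‖ ∈ snailRadii (n + p)}

/-- The class `SN(n;p)` relatively to a set `X` of points of the axis `Δ`: the sets obtained from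
the concrete snail by an isotopy that starts at the identity, moves the three centers along `Δ`,
and finally carries the set of centers to `X`. -/
def snailClass (X : Set ℂ) (n p : ℕ) : Set (Set ℂ) :=
  {H | ∃ φ : unitInterval → (ℂ ≃ₜ ℂ), IsIsotopyFromId φ ∧
    (∀ t, ∀ x ∈ snailCenters n p, (φ t x).im = 0) ∧
    φ 1 '' snailCenters n p = X ∧ φ 1 '' snail n p = H}

/-- `b^{β N} ∘ a^{α N} ∘ ⋯ ∘ b^{β 1} ∘ a^{α 1}`. -/
def alternatingProduct {S : Type*} (a b : S → S) (α β : ℕ → ℕ) : ℕ → S → S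
  | 0 => id
  | k + 1 => b^[β (k + 1)] ∘ a^[α (k + 1)] ∘ alternatingProduct a b α β k

/-- `(α 1, …, α N)` and `(β 1, …, β N)` are the characteristic sequences of `(n;p)`; here
`A(x;y) = (x+y;y)` and `B(x;y) = (x;x+y)`. -/
def IsCharacteristic (n p N : ℕ) (α β : ℕ → ℕ) : Prop :=
  0 < N ∧
  (∀ i, 1 < i → i ≤ N → 0 < α i) ∧
  (∀ i, 1 ≤ i → i < N → 0 < β i) ∧
  (n, p) = alternatingProduct (fun q : ℕ × ℕ => (q.1 + q.2, q.2))
    (fun q : ℕ × ℕ => (q.1, q.1 + q.2)) α β N (1, 1)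

/-- The possible numbers of intersection points of `S` with the members of the isotopy class
of `L` relatively to `X`. -/
def intersectionNumbers (X L S : Set ℂ) : Set ℕ∞ :=
  {k | ∃ K : Set ℂ, IsotopicRel X L K ∧ (S ∩ K).encard = k}

end

/-!
The two halves of the theorem rest on different ideas.

**Snails go to snails.** An isotopy along which the outer two of three points stay on the axis `Δ`
and the middle one avoids the open lower half-plane is determined, up to an isotopy relative to the
three points, by its ends: the configurations of such triples have a continuous section into the
homeomorphisms of the plane (`frameMap`), so that the path of configurations can be replaced by any
other one with the same ends (`exists_isotopy_along`), in particular by a linear one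
(`IsTopMove.exists_linear`). Hence homeomorphisms of type `A` act on the classes of snails as soon
as a single top move carries `SN(n;p)` to `SN(n+p;p)` and exchanges the centers in the same way
(`image_mem_snailClass_iff`, `IsTypeA.image_mem_snailClass_iff`), and type `B` follows by reflection
in the imaginary axis. Such a move is built in `hasLeftStep`. It is a half-twist about the left
center, preceded and followed by horizontal maps. The half-twist is the rotation by `π` above the
axis and on a central disk, the identity at the lower right, and its angle is interpolated along the
circles near the positive axis and in a region at the bottom that the snail does not meet. The
horizontal maps make the pieces of half-circles near the positive axis concentric about the left
center (`arcMap`), so that the interpolation there slides them along themselves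
(`onSource_iff_onTarget`).

**Counting intersections.** A vertical line close to the left center meets the snail in at most `n`
points, and a shear relative to the centers takes the bisector to it
(`exists_isotopicRel_encard_le`). For the lower bound, the plane is mapped to itself by a map
`branchedMap` that takes the values `1` and `-1` exactly at the centers and whose real part vanishes
only on the bisector. For coprime `n` and `p` the snail is an arc joining two of the centers
(`snailIndex`), and the image of this arc lifts through the cosine to a curve that crosses one after
the other the vertical strips between the multiples of `π`, always in the same direction, from one
multiple of `π` to another at distance `n π` (`arcLift`). An isotopy relative to the centers lifts
as well, by homotopy lifting through the exponential (`exists_cos_lift`), and leaves the ends of the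
lifted curve in place. So the lifted curve crosses at least `n` lines where the real part of the
cosine vanishes, and each such crossing is an intersection point (`le_encard_crossings`).
-/

noncomputable section

/-! ### Isotopies of the plane -/

/-- A continuous family of bijections of the plane that starts at the identity and is uniformly
proper is an isotopy: the total map of `[0,1] × ℂ` is a proper continuous bijection. -/
theorem exists_isotopy_of_proper (F : unitInterval → ℂ → ℂ)
    (hF : Continuous fun q : unitInterval × ℂ => F q.1 q.2)
    (hb : ∀ t, Function.Bijective (F t)) (h0 : ∀ z, F 0 z = z)
    (hp : ∀ R : ℝ, ∃ R' : ℝ, ∀ t z, ‖F t z‖ ≤ R → ‖z‖ ≤ R') :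
    ∃ φ : unitInterval → (ℂ ≃ₜ ℂ), IsIsotopyFromId φ ∧ ∀ t z, φ t z = F t z := by
  let f : unitInterval × ℂ → unitInterval × ℂ := fun q => (q.1, F q.1 q.2)
  have hf : Continuous f := continuous_fst.prodMk hF
  have hbij : Function.Bijective f := by
    constructor
    · rintro ⟨t, z⟩ ⟨t', z'⟩ h
      obtain ⟨h1, h2⟩ := Prod.mk.inj h
      obtain rfl : t = t' := h1
      exact Prod.ext rfl ((hb t).1 h2)
    · rintro ⟨t, w⟩
      obtain ⟨z, hz⟩ := (hb t).2 w
      exact ⟨(t, z), Prod.ext rfl hz⟩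
  have hprop : IsProperMap f := by
    refine isProperMap_iff_isCompact_preimage.2 ⟨hf, fun K hK => ?_⟩
    obtain ⟨R, hR⟩ := (hK.image continuous_snd).isBounded.subset_closedBall (0 : ℂ)
    obtain ⟨R', hR'⟩ := hp R
    refine (isCompact_univ.prod (isCompact_closedBall (0 : ℂ) R')).of_isClosed_subset
      (hK.isClosed.preimage hf) ?_
    rintro ⟨t, z⟩ hz
    refine ⟨trivial, ?_⟩
    have := hR ⟨_, hz, rfl⟩
    simp only [Metric.mem_closedBall, dist_zero_right] at this ⊢
    exact hR' t z this
  let e : unitInterval × ℂ ≃ₜ unitInterval × ℂ :=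
    (Equiv.ofBijective f hbij).toHomeomorphOfContinuousClosed hf hprop.isClosedMap
  have he : ∀ q, e q = f q := fun _ => rfl
  have hsymm : ∀ t w, (e.symm (t, w)).1 = t ∧ F t (e.symm (t, w)).2 = w := by
    intro t w
    have h := e.apply_symm_apply (t, w)
    rw [he] at h
    obtain ⟨h1, h2⟩ := Prod.mk.inj h
    exact ⟨h1, by rw [h1] at h2; exact h2⟩
  let φ : unitInterval → (ℂ ≃ₜ ℂ) := fun t =>
    { toFun := F t
      invFun := fun w => (e.symm (t, w)).2
      left_inv := fun z => (hb t).1 (hsymm t _).2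
      right_inv := fun w => (hsymm t w).2
      continuous_toFun := hF.comp (Continuous.prodMk_right t)
      continuous_invFun :=
        continuous_snd.comp (e.symm.continuous.comp (Continuous.prodMk_right t)) }
  refine ⟨φ, ⟨?_, hF, ?_⟩, fun t z => rfl⟩
  · ext z
    exact h0 z
  · exact continuous_snd.comp e.symm.continuous

theorem IsIsotopyFromId.continuous_apply {φ : unitInterval → (ℂ ≃ₜ ℂ)} (h : IsIsotopyFromId φ)
    (z : ℂ) : Continuous fun t => φ t z :=
  h.2.1.comp (Continuous.prodMk_left z)

theorem IsIsotopyFromId.zero_apply {φ : unitInterval → (ℂ ≃ₜ ℂ)} (h : IsIsotopyFromId φ)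
    (z : ℂ) : φ 0 z = z := by
  rw [h.1]; rfl

/-- Two isotopies performed one after the other. -/
theorem IsIsotopyFromId.exists_trans {φ ψ : unitInterval → (ℂ ≃ₜ ℂ)} (hφ : IsIsotopyFromId φ)
    (hψ : IsIsotopyFromId ψ) :
    ∃ χ : unitInterval → (ℂ ≃ₜ ℂ), IsIsotopyFromId χ ∧ (∀ z, χ 1 z = ψ 1 (φ 1 z)) ∧
      ∀ t, (∃ s, ∀ z, χ t z = φ s z) ∨ (∃ s, ∀ z, χ t z = ψ s (φ 1 z)) := by
  -- `χ t = ψ (2t-1) ∘ φ (2t)`, both parameters being clamped to `[0,1]`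
  let a : unitInterval → unitInterval := fun t => Set.projIcc 0 1 zero_le_one (2 * (t : ℝ))
  let b : unitInterval → unitInterval := fun t => Set.projIcc 0 1 zero_le_one (2 * (t : ℝ) - 1)
  have ha : Continuous a := continuous_projIcc.comp (by fun_prop)
  have hb : Continuous b := continuous_projIcc.comp (by fun_prop)
  have a0 : a 0 = 0 := by
    simp only [a]; rw [Set.projIcc_of_le_left] <;> simp
  have b0 : b 0 = 0 := by
    simp only [b]; rw [Set.projIcc_of_le_left] <;> simp
  have a1 : a 1 = 1 := by
    simp only [a]; rw [Set.projIcc_of_right_le] <;> simp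
  have b1 : b 1 = 1 := by
    simp only [b]; rw [Set.projIcc_of_right_le]
    · rfl
    · norm_num
  refine ⟨fun t => (φ (a t)).trans (ψ (b t)), ⟨?_, ?_, ?_⟩, ?_, ?_⟩
  · ext z
    simp [a0, b0, hφ.zero_apply, hψ.zero_apply]
  · exact hψ.2.1.comp ((hb.comp continuous_fst).prodMk
      (hφ.2.1.comp ((ha.comp continuous_fst).prodMk continuous_snd)))
  · exact hφ.2.2.comp ((ha.comp continuous_fst).prodMk
      (hψ.2.2.comp ((hb.comp continuous_fst).prodMk continuous_snd)))
  · intro z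
    simp [a1, b1]
  · intro t
    rcases le_total (2 * (t : ℝ)) 1 with h | h
    · left
      refine ⟨a t, fun z => ?_⟩
      have : b t = 0 := by
        simp only [b]; rw [Set.projIcc_of_le_left]
        · rfl
        · linarith
      simp [this, hψ.zero_apply]
    · right
      refine ⟨b t, fun z => ?_⟩
      have : a t = 1 := by
        simp only [a]; rw [Set.projIcc_of_right_le]
        · rfl
        · linarith
      simp [this]

/-- An isotopy run backwards, ending at the inverse homeomorphism. -/
theorem IsIsotopyFromId.reverse {φ : unitInterval → (ℂ ≃ₜ ℂ)} (hφ : IsIsotopyFromId φ) :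
    IsIsotopyFromId fun t => (φ 1).symm.trans (φ (unitInterval.symm t)) := by
  refine ⟨?_, ?_, ?_⟩
  · ext z
    simp
  · exact hφ.2.1.comp ((unitInterval.continuous_symm.comp continuous_fst).prodMk
      ((φ 1).symm.continuous.comp continuous_snd))
  · exact (φ 1).continuous.comp
      (hφ.2.2.comp ((unitInterval.continuous_symm.comp continuous_fst).prodMk continuous_snd))

/-- `g` is the end of an isotopy along which `a` and `c` stay on the axis `Δ` and `b` never enters
the open lower half-plane. -/
def IsTopMove (a b c : ℂ) (g : ℂ ≃ₜ ℂ) : Prop :=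
  ∃ φ : unitInterval → (ℂ ≃ₜ ℂ), IsIsotopyFromId φ ∧ φ 1 = g ∧
    ∀ t, (φ t a).im = 0 ∧ (φ t c).im = 0 ∧ 0 ≤ (φ t b).im

/-- `g` is the end of an isotopy along which `a`, `b` and `c` stay on the axis `Δ`. -/
def IsLineMove (a b c : ℂ) (g : ℂ ≃ₜ ℂ) : Prop :=
  ∃ φ : unitInterval → (ℂ ≃ₜ ℂ), IsIsotopyFromId φ ∧ φ 1 = g ∧
    ∀ t, (φ t a).im = 0 ∧ (φ t b).im = 0 ∧ (φ t c).im = 0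

theorem IsLineMove.isTopMove {a b c : ℂ} {g : ℂ ≃ₜ ℂ} (h : IsLineMove a b c g) :
    IsTopMove a b c g := by
  obtain ⟨φ, h1, h2, h3⟩ := h
  exact ⟨φ, h1, h2, fun t => ⟨(h3 t).1, (h3 t).2.2, (h3 t).2.1.ge⟩⟩

theorem IsLineMove.swap {a b c : ℂ} {g : ℂ ≃ₜ ℂ} (h : IsLineMove a b c g) :
    IsLineMove b a c g := by
  obtain ⟨φ, h1, h2, h3⟩ := h
  exact ⟨φ, h1, h2, fun t => ⟨(h3 t).2.1, (h3 t).1, (h3 t).2.2⟩⟩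

theorem IsLineMove.swap' {a b c : ℂ} {g : ℂ ≃ₜ ℂ} (h : IsLineMove a b c g) :
    IsLineMove a c b g := by
  obtain ⟨φ, h1, h2, h3⟩ := h
  exact ⟨φ, h1, h2, fun t => ⟨(h3 t).1, (h3 t).2.2, (h3 t).2.1⟩⟩

theorem IsTopMove.trans {a b c : ℂ} {g k : ℂ ≃ₜ ℂ} (h : IsTopMove a b c g)
    (h' : IsTopMove (g a) (g b) (g c) k) : IsTopMove a b c (g.trans k) := by
  obtain ⟨φ, h1, rfl, h3⟩ := h
  obtain ⟨ψ, k1, rfl, k3⟩ := h'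
  obtain ⟨χ, x1, x2, x3⟩ := h1.exists_trans k1
  refine ⟨χ, x1, by ext z; simpa using x2 z, fun t => ?_⟩
  rcases x3 t with ⟨s, hs⟩ | ⟨s, hs⟩
  · simpa only [hs] using h3 s
  · simpa only [hs] using k3 s

theorem IsTopMove.symm {a b c : ℂ} {g : ℂ ≃ₜ ℂ} (h : IsTopMove a b c g) :
    IsTopMove (g a) (g b) (g c) g.symm := by
  obtain ⟨φ, h1, rfl, h3⟩ := h
  refine ⟨_, h1.reverse, ?_, fun t => ?_⟩
  · ext z
    simp [h1.zero_apply]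
  · simpa using h3 (unitInterval.symm t)

theorem IsLineMove.symm {a b c : ℂ} {g : ℂ ≃ₜ ℂ} (h : IsLineMove a b c g) :
    IsLineMove (g a) (g b) (g c) g.symm := by
  obtain ⟨φ, h1, rfl, h3⟩ := h
  refine ⟨_, h1.reverse, ?_, fun t => ?_⟩
  · ext z
    simp [h1.zero_apply]
  · simpa using h3 (unitInterval.symm t)

theorem IsLineMove.trans {a b c : ℂ} {g k : ℂ ≃ₜ ℂ} (h : IsLineMove a b c g)
    (h' : IsLineMove (g a) (g b) (g c) k) : IsLineMove a b c (g.trans k) := by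
  obtain ⟨φ, h1, rfl, h3⟩ := h
  obtain ⟨ψ, k1, rfl, k3⟩ := h'
  obtain ⟨χ, x1, x2, x3⟩ := h1.exists_trans k1
  refine ⟨χ, x1, by ext z; simpa using x2 z, fun t => ?_⟩
  rcases x3 t with ⟨s, hs⟩ | ⟨s, hs⟩
  · simpa only [hs] using h3 s
  · simpa only [hs] using k3 s

theorem IsIsotopyFromId.conj {φ : unitInterval → (ℂ ≃ₜ ℂ)} (h : IsIsotopyFromId φ) (e : ℂ ≃ₜ ℂ) :
    IsIsotopyFromId fun t => (e.symm.trans (φ t)).trans e := by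
  refine ⟨?_, ?_, ?_⟩
  · ext z
    simp [h.zero_apply]
  · exact e.continuous.comp
      (h.2.1.comp (continuous_fst.prodMk (e.symm.continuous.comp continuous_snd)))
  · exact e.continuous.comp
      (h.2.2.comp (continuous_fst.prodMk (e.symm.continuous.comp continuous_snd)))

theorem IsTopMove.conj {a b c : ℂ} {g : ℂ ≃ₜ ℂ} (h : IsTopMove a b c g) (e : ℂ ≃ₜ ℂ)
    (he : ∀ z, (e z).im = z.im) :
    IsTopMove (e a) (e b) (e c) ((e.symm.trans g).trans e) := by
  obtain ⟨φ, h1, rfl, h3⟩ := h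
  refine ⟨_, h1.conj e, rfl, fun t => ?_⟩
  simpa [he] using h3 t

theorem IsTopMove.reverse_labels {a b c : ℂ} {g : ℂ ≃ₜ ℂ} (h : IsTopMove a b c g) :
    IsTopMove c b a g := by
  obtain ⟨φ, h1, h2, h3⟩ := h
  exact ⟨φ, h1, h2, fun t => ⟨(h3 t).2.1, (h3 t).1, (h3 t).2.2⟩⟩

/-! ### Prescribing the motion of three points -/

/-- The real distance from `x` to `{a, c}`. -/
def pairDist (a c x : ℝ) : ℝ := min |x - a| |x - c|

theorem continuous_pairDist {T : Type*} [TopologicalSpace T] {a c x : T → ℝ} (ha : Continuous a)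
    (hc : Continuous c) (hx : Continuous x) : Continuous fun t => pairDist (a t) (c t) (x t) := by
  unfold pairDist; fun_prop

/-- The height of `b` after it has been pushed up by the vertical shear of slope `pairDist a c`. -/
def liftedHeight (a c : ℝ) (b : ℂ) : ℝ := b.im + pairDist a c b.re

theorem liftedHeight_pos {a c : ℝ} {b : ℂ} (hb : 0 ≤ b.im) (ha : b ≠ a) (hc : b ≠ c) :
    0 < liftedHeight a c b := by
  unfold liftedHeight pairDist
  have h0 : 0 ≤ min |b.re - a| |b.re - c| := le_min (abs_nonneg _) (abs_nonneg _)
  rcases hb.lt_or_eq with h | h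
  · linarith
  · have h1 : b.re - a ≠ 0 := fun h' => ha (Complex.ext (by simp; linarith) (by simp [← h]))
    have h2 : b.re - c ≠ 0 := fun h' => hc (Complex.ext (by simp; linarith) (by simp [← h]))
    have := lt_min (abs_pos.2 h1) (abs_pos.2 h2)
    linarith

/-- A homeomorphism of the plane, depending continuously on the distinct points `a, c` of the axis
and on `b` in the closed upper half-plane, that sends `0, i, 1` to `a, b, c`: the real affine map
sending `0, i, 1` to `a`, the lift of `b`, and `c`, followed by a vertical shear that fixes `a`
and `c` and brings the lift of `b` down to `b`. -/
def frameMap (a c : ℝ) (b z : ℂ) : ℂ :=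
  ⟨a + (c - a) * z.re + (b.re - a) * z.im,
    liftedHeight a c b * z.im - pairDist a c (a + (c - a) * z.re + (b.re - a) * z.im)⟩

/-- The inverse of `frameMap`. -/
def frameInv (a c : ℝ) (b w : ℂ) : ℂ :=
  ⟨(w.re - a - (b.re - a) * ((w.im + pairDist a c w.re) / liftedHeight a c b)) / (c - a),
    (w.im + pairDist a c w.re) / liftedHeight a c b⟩

theorem frameMap_frameInv {a c : ℝ} {b : ℂ} (hac : a ≠ c) (hb : 0 < liftedHeight a c b) (w : ℂ) :
    frameMap a c b (frameInv a c b w) = w := by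
  have h1 : c - a ≠ 0 := sub_ne_zero.2 hac.symm
  have h2 : a + (c - a) * (frameInv a c b w).re + (b.re - a) * (frameInv a c b w).im = w.re := by
    simp only [frameInv]
    rw [mul_div_cancel₀ _ h1]; ring
  apply Complex.ext
  · simp only [frameMap]; exact h2
  · simp only [frameMap]
    rw [h2]
    simp only [frameInv]
    rw [mul_div_cancel₀ _ hb.ne']; ring

theorem frameInv_frameMap {a c : ℝ} {b : ℂ} (hac : a ≠ c) (hb : 0 < liftedHeight a c b) (z : ℂ) :
    frameInv a c b (frameMap a c b z) = z := by
  have h1 : c - a ≠ 0 := sub_ne_zero.2 hac.symm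
  have h2 : ((frameMap a c b z).im + pairDist a c (frameMap a c b z).re) / liftedHeight a c b
      = z.im := by
    simp only [frameMap]
    rw [sub_add_cancel, mul_div_cancel_left₀ _ hb.ne']
  apply Complex.ext
  · simp only [frameInv]
    rw [h2]
    simp only [frameMap]
    rw [div_eq_iff h1]; ring
  · simp only [frameInv]; exact h2

theorem frameMap_zero (a c : ℝ) (b : ℂ) : frameMap a c b 0 = a := by
  simp [frameMap, pairDist, Complex.ext_iff]

theorem frameMap_one (a c : ℝ) (b : ℂ) : frameMap a c b 1 = c := by
  simp [frameMap, pairDist, Complex.ext_iff]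

theorem frameMap_I (a c : ℝ) (b : ℂ) : frameMap a c b Complex.I = b := by
  simp [frameMap, liftedHeight]

theorem Continuous.complexMk {T : Type*} [TopologicalSpace T] {f g : T → ℝ} (hf : Continuous f)
    (hg : Continuous g) : Continuous fun t => (⟨f t, g t⟩ : ℂ) :=
  Complex.equivRealProdCLM.symm.continuous.comp (hf.prodMk hg)

theorem continuous_liftedHeight {T : Type*} [TopologicalSpace T] {a c : T → ℝ} {b : T → ℂ}
    (ha : Continuous a) (hc : Continuous c) (hb : Continuous b) :
    Continuous fun t => liftedHeight (a t) (c t) (b t) :=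
  (Complex.continuous_im.comp hb).add
    (continuous_pairDist ha hc (Complex.continuous_re.comp hb))

theorem continuous_frameMap {T : Type*} [TopologicalSpace T] {a c : T → ℝ} {b z : T → ℂ}
    (ha : Continuous a) (hc : Continuous c) (hb : Continuous b) (hz : Continuous z) :
    Continuous fun t => frameMap (a t) (c t) (b t) (z t) := by
  have h1 : Continuous fun t => a t + (c t - a t) * (z t).re + ((b t).re - a t) * (z t).im := by
    fun_prop
  exact h1.complexMk (((continuous_liftedHeight ha hc hb).mul
    (Complex.continuous_im.comp hz)).sub (continuous_pairDist ha hc h1))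

theorem continuous_frameInv {T : Type*} [TopologicalSpace T] {a c : T → ℝ} {b w : T → ℂ}
    (ha : Continuous a) (hc : Continuous c) (hb : Continuous b) (hw : Continuous w)
    (hac : ∀ t, a t ≠ c t) (hpos : ∀ t, 0 < liftedHeight (a t) (c t) (b t)) :
    Continuous fun t => frameInv (a t) (c t) (b t) (w t) := by
  have h1 : Continuous fun t =>
      ((w t).im + pairDist (a t) (c t) (w t).re) / liftedHeight (a t) (c t) (b t) :=
    ((Complex.continuous_im.comp hw).add
      (continuous_pairDist ha hc (Complex.continuous_re.comp hw))).div
      (continuous_liftedHeight ha hc hb) fun t => (hpos t).ne'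
  refine Continuous.complexMk (Continuous.div ?_ (hc.sub ha) fun t => sub_ne_zero.2 (hac t).symm) h1
  exact ((Complex.continuous_re.comp hw).sub ha).sub
    (((Complex.continuous_re.comp hb).sub ha).mul h1)

/-- An isotopy that moves `a` and `c` along the axis and `b` in the closed upper half-plane can be
replaced, with the same final homeomorphism, by one in which these points follow any other motion
of the same kind with the same end positions: the space of positions is contractible, and
`frameMap` is a section of the evaluation map over it. -/
theorem exists_isotopy_along {φ : unitInterval → (ℂ ≃ₜ ℂ)} (hφ : IsIsotopyFromId φ) {a b c : ℂ}
    (hab : b ≠ a) (hbc : b ≠ c) (hac : a ≠ c)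
    (hpath : ∀ t, (φ t a).im = 0 ∧ (φ t c).im = 0 ∧ 0 ≤ (φ t b).im)
    {a' c' : unitInterval → ℝ} {b' : unitInterval → ℂ} (ha' : Continuous a') (hb' : Continuous b')
    (hc' : Continuous c') (hac' : ∀ t, a' t ≠ c' t) (hab' : ∀ t, b' t ≠ a' t)
    (hbc' : ∀ t, b' t ≠ c' t) (him : ∀ t, 0 ≤ (b' t).im)
    (h0 : a' 0 = a ∧ b' 0 = b ∧ c' 0 = c)
    (h1 : a' 1 = φ 1 a ∧ b' 1 = φ 1 b ∧ c' 1 = φ 1 c) :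
    ∃ ψ : unitInterval → (ℂ ≃ₜ ℂ), IsIsotopyFromId ψ ∧ ψ 1 = φ 1 ∧
      ∀ t, ψ t a = a' t ∧ ψ t b = b' t ∧ ψ t c = c' t := by
  let p : unitInterval → ℝ := fun t => (φ t a).re
  let r : unitInterval → ℝ := fun t => (φ t c).re
  let q : unitInterval → ℂ := fun t => φ t b
  have hpa : ∀ t, (p t : ℂ) = φ t a := fun t => Complex.ext rfl (by simp [(hpath t).1])
  have hrc : ∀ t, (r t : ℂ) = φ t c := fun t => Complex.ext rfl (by simp [(hpath t).2.1])
  have cp : Continuous p := Complex.continuous_re.comp (hφ.continuous_apply a)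
  have cr : Continuous r := Complex.continuous_re.comp (hφ.continuous_apply c)
  have cq : Continuous q := hφ.continuous_apply b
  have hpr : ∀ t, p t ≠ r t := fun t h => hac ((φ t).injective (by rw [← hpa, ← hrc, h]))
  have hpos : ∀ t, 0 < liftedHeight (p t) (r t) (q t) := fun t =>
    liftedHeight_pos (hpath t).2.2 (by rw [hpa]; exact fun h => hab ((φ t).injective h))
      (by rw [hrc]; exact fun h => hbc ((φ t).injective h))
  have hpos' : ∀ t, 0 < liftedHeight (a' t) (c' t) (b' t) := fun t =>
    liftedHeight_pos (him t) (hab' t) (hbc' t)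
  have e0 : p 0 = a' 0 ∧ q 0 = b' 0 ∧ r 0 = c' 0 := by
    refine ⟨?_, ?_, ?_⟩
    · exact Complex.ofReal_injective (by rw [hpa, hφ.zero_apply, h0.1])
    · change φ 0 b = b' 0
      rw [hφ.zero_apply, h0.2.1]
    · exact Complex.ofReal_injective (by rw [hrc, hφ.zero_apply, h0.2.2])
  have e1 : p 1 = a' 1 ∧ q 1 = b' 1 ∧ r 1 = c' 1 := by
    refine ⟨?_, ?_, ?_⟩
    · exact Complex.ofReal_injective (by rw [hpa, h1.1])
    · exact h1.2.1.symm
    · exact Complex.ofReal_injective (by rw [hrc, h1.2.2])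
  have cF : Continuous fun x : unitInterval × ℂ =>
      frameMap (a' x.1) (c' x.1) (b' x.1) (frameInv (p x.1) (r x.1) (q x.1) (φ x.1 x.2)) :=
    continuous_frameMap (ha'.comp continuous_fst) (hc'.comp continuous_fst)
      (hb'.comp continuous_fst) (continuous_frameInv (cp.comp continuous_fst)
      (cr.comp continuous_fst) (cq.comp continuous_fst) hφ.2.1 (fun x => hpr x.1)
      fun x => hpos x.1)
  have cG : Continuous fun x : unitInterval × ℂ =>
      (φ x.1).symm (frameMap (p x.1) (r x.1) (q x.1)
        (frameInv (a' x.1) (c' x.1) (b' x.1) x.2)) :=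
    hφ.2.2.comp (continuous_fst.prodMk (continuous_frameMap (cp.comp continuous_fst)
      (cr.comp continuous_fst) (cq.comp continuous_fst) (continuous_frameInv
      (ha'.comp continuous_fst) (hc'.comp continuous_fst) (hb'.comp continuous_fst)
      continuous_snd (fun x => hac' x.1) fun x => hpos' x.1)))
  let ψ : unitInterval → (ℂ ≃ₜ ℂ) := fun t =>
    { toFun := fun z => frameMap (a' t) (c' t) (b' t) (frameInv (p t) (r t) (q t) (φ t z))
      invFun := fun w => (φ t).symm (frameMap (p t) (r t) (q t)
        (frameInv (a' t) (c' t) (b' t) w))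
      left_inv := fun z => by
        simp only [frameInv_frameMap (hac' t) (hpos' t), frameMap_frameInv (hpr t) (hpos t),
          Homeomorph.symm_apply_apply]
      right_inv := fun w => by
        simp only [Homeomorph.apply_symm_apply, frameInv_frameMap (hpr t) (hpos t),
          frameMap_frameInv (hac' t) (hpos' t)]
      continuous_toFun := cF.comp (Continuous.prodMk_right t)
      continuous_invFun := cG.comp (Continuous.prodMk_right t) }
  have hψ : ∀ t z, ψ t z =
    frameMap (a' t) (c' t) (b' t) (frameInv (p t) (r t) (q t) (φ t z)) := fun _ _ => rfl
  refine ⟨ψ, ⟨?_, cF, cG⟩, ?_, fun t => ⟨?_, ?_, ?_⟩⟩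
  · ext z
    rw [hψ, ← e0.1, ← e0.2.1, ← e0.2.2, frameMap_frameInv (hpr 0) (hpos 0), hφ.zero_apply]
    rfl
  · ext z
    rw [hψ, ← e1.1, ← e1.2.1, ← e1.2.2, frameMap_frameInv (hpr 1) (hpos 1)]
  · rw [hψ, ← hpa, ← frameMap_zero (p t) (r t) (q t), frameInv_frameMap (hpr t) (hpos t),
      frameMap_zero]
  · rw [hψ]
    change frameMap _ _ _ (frameInv _ _ _ (q t)) = _
    nth_rewrite 2 [← frameMap_I (p t) (r t) (q t)]
    rw [frameInv_frameMap (hpr t) (hpos t), frameMap_I]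
  · rw [hψ, ← hrc, ← frameMap_one (p t) (r t) (q t), frameInv_frameMap (hpr t) (hpos t),
      frameMap_one]

/-- A top move between two positions of the three points on the axis that has the same order at
both ends can be performed along the axis, by interpolating linearly. -/
theorem IsTopMove.exists_linear {a b c : ℂ} {g : ℂ ≃ₜ ℂ} (h : IsTopMove a b c g)
    (hb : b.im = 0) (hgb : (g b).im = 0)
    (h1 : 0 < (b.re - a.re) * ((g b).re - (g a).re))
    (h2 : 0 < (c.re - b.re) * ((g c).re - (g b).re))
    (h3 : 0 < (c.re - a.re) * ((g c).re - (g a).re)) :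
    ∃ φ : unitInterval → (ℂ ≃ₜ ℂ), IsIsotopyFromId φ ∧ φ 1 = g ∧ ∀ t : unitInterval,
      φ t a = (((1 - (t : ℝ)) * a.re + t * (g a).re : ℝ) : ℂ) ∧
      φ t b = (((1 - (t : ℝ)) * b.re + t * (g b).re : ℝ) : ℂ) ∧
      φ t c = (((1 - (t : ℝ)) * c.re + t * (g c).re : ℝ) : ℂ) := by
  obtain ⟨φ, hφ, rfl, hp⟩ := h
  have ha : a.im = 0 := by simpa [hφ.zero_apply] using (hp 0).1
  have hc : c.im = 0 := by simpa [hφ.zero_apply] using (hp 0).2.1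
  have key : ∀ {x y x' y' : ℝ}, 0 < (y - x) * (y' - x') → ∀ t : unitInterval,
      (1 - (t : ℝ)) * y + t * y' ≠ (1 - (t : ℝ)) * x + t * x' := by
    intro x y x' y' hxy t h
    have h0 : (1 - (t : ℝ)) * (y - x) + t * (y' - x') = 0 := by linarith
    have ht0 := t.2.1
    have ht1 := t.2.2
    rcases pos_and_pos_or_neg_and_neg_of_mul_pos hxy with ⟨p1, p2⟩ | ⟨p1, p2⟩
    · nlinarith [mul_nonneg (sub_nonneg.2 ht1) p1.le, mul_nonneg ht0 p2.le]
    · nlinarith [mul_nonneg (sub_nonneg.2 ht1) (neg_nonneg.2 p1.le),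
        mul_nonneg ht0 (neg_nonneg.2 p2.le)]
  have re0 : ∀ {z : ℂ}, z.im = 0 → ((z.re : ℝ) : ℂ) = z := fun hz =>
    Complex.ext rfl (by simp [hz])
  have hne : ∀ {x y : ℂ} {u : ℝ}, 0 < (y.re - x.re) * u → y ≠ x := by
    rintro x y u hu rfl
    simp at hu
  obtain ⟨ψ, k1, k2, k3⟩ := exists_isotopy_along hφ (hne h1) (hne h2).symm (hne h3).symm hp
    (a' := fun t => (1 - (t : ℝ)) * a.re + t * (φ 1 a).re)
    (b' := fun t => (((1 - (t : ℝ)) * b.re + t * (φ 1 b).re : ℝ) : ℂ))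
    (c' := fun t => (1 - (t : ℝ)) * c.re + t * (φ 1 c).re)
    (by fun_prop) (by fun_prop) (by fun_prop)
    (fun t => (key h3 t).symm) (fun t => by exact_mod_cast key h1 t)
    (fun t => by exact_mod_cast (key h2 t).symm) (fun t => by simp)
    (by simp [re0 ha, re0 hb, re0 hc])
    (by simp [re0 (hp 1).1, re0 hgb, re0 (hp 1).2.1])
  exact ⟨ψ, k1, k2, k3⟩

theorem IsTopMove.isLineMove {a b c : ℂ} {g : ℂ ≃ₜ ℂ} (h : IsTopMove a b c g)
    (hb : b.im = 0) (hgb : (g b).im = 0)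
    (h1 : 0 < (b.re - a.re) * ((g b).re - (g a).re))
    (h2 : 0 < (c.re - b.re) * ((g c).re - (g b).re))
    (h3 : 0 < (c.re - a.re) * ((g c).re - (g a).re)) : IsLineMove a b c g := by
  obtain ⟨φ, k1, k2, k3⟩ := h.exists_linear hb hgb h1 h2 h3
  refine ⟨φ, k1, k2, fun t => ?_⟩
  obtain ⟨e1, e2, e3⟩ := k3 t
  rw [e1, e2, e3]
  simp only [Complex.ofReal_im, and_self]

theorem IsLineMove.isotopicRel {a b c : ℂ} {g : ℂ ≃ₜ ℂ} (h : IsLineMove a b c g)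
    (hab : a.re < b.re) (hbc : b.re < c.re) (ha : g a = a) (hb : g b = b) (hc : g c = c)
    (H : Set ℂ) : IsotopicRel {a, b, c} H (g '' H) := by
  have him : a.im = 0 ∧ b.im = 0 ∧ c.im = 0 := by
    obtain ⟨φ, k1, k2, k3⟩ := h
    simpa [k1.zero_apply] using k3 0
  obtain ⟨φ, k1, k2, k3⟩ := h.isTopMove.exists_linear him.2.1 (by rw [hb]; exact him.2.1)
    (by rw [ha, hb]; nlinarith) (by rw [hb, hc]; nlinarith) (by rw [ha, hc]; nlinarith)
  refine ⟨φ, k1, fun t x hx => ?_, by rw [k2]⟩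
  obtain ⟨e1, e2, e3⟩ := k3 t
  rw [ha] at e1
  rw [hb] at e2
  rw [hc] at e3
  rcases hx with rfl | rfl | rfl
  · rw [e1]; exact Complex.ext (by simp; ring) (by simp [him.1])
  · rw [e2]; exact Complex.ext (by simp; ring) (by simp [him.2.1])
  · rw [e3]; exact Complex.ext (by simp; ring) (by simp [him.2.2])

end

noncomputable section

/-! ### Snail classes and the action of the homeomorphisms of type A and B -/

theorem IsLineMove.re_lt {a b c : ℂ} {g : ℂ ≃ₜ ℂ} (h : IsLineMove a b c g) (hab : a.re < b.re) :
    (g a).re < (g b).re := by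
  obtain ⟨φ, h1, rfl, h3⟩ := h
  by_contra! hcon
  have hcont : Continuous fun t => (φ t b).re - (φ t a).re :=
    (Complex.continuous_re.comp (h1.continuous_apply b)).sub
      (Complex.continuous_re.comp (h1.continuous_apply a))
  obtain ⟨t, ht⟩ := mem_range_of_exists_le_of_exists_ge hcont (c := 0)
    ⟨1, by simpa using hcon⟩ ⟨0, by simpa [h1.zero_apply] using hab.le⟩
  have : φ t b = φ t a :=
    Complex.ext (by linarith [ht]) (by rw [(h3 t).1, (h3 t).2.1])
  exact hab.ne' (congrArg Complex.re ((φ t).injective this))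

theorem snailCenter₁_re (n p : ℕ) : (snailCenter₁ n p).re = -(n : ℝ) / 2 := by
  simp [snailCenter₁]

theorem snailCenter₂_re (n p : ℕ) : (snailCenter₂ n p).re = (-(n : ℝ) + p) / 2 := by
  simp [snailCenter₂]

theorem snailCenter₃_re (n p : ℕ) : (snailCenter₃ n p).re = (p : ℝ) / 2 := by
  simp [snailCenter₃]

theorem snailCenter₁_im (n p : ℕ) : (snailCenter₁ n p).im = 0 := by
  simp [snailCenter₁]

theorem snailCenter₂_im (n p : ℕ) : (snailCenter₂ n p).im = 0 := by
  simp [snailCenter₂]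

theorem snailCenter₃_im (n p : ℕ) : (snailCenter₃ n p).im = 0 := by
  simp [snailCenter₃]

theorem snailCenter₁_lt (n : ℕ) {p : ℕ} (hp : 0 < p) :
    (snailCenter₁ n p).re < (snailCenter₂ n p).re := by
  have : (0 : ℝ) < p := by exact_mod_cast hp
  rw [snailCenter₁_re, snailCenter₂_re]; linarith

theorem snailCenter₂_lt {n : ℕ} (hn : 0 < n) (p : ℕ) :
    (snailCenter₂ n p).re < (snailCenter₃ n p).re := by
  have : (0 : ℝ) < n := by exact_mod_cast hn
  rw [snailCenter₃_re, snailCenter₂_re]; linarith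

/-- Three points of the axis, in increasing order. -/
structure IsOrderedTriple (a b c : ℂ) : Prop where
  im₁ : a.im = 0
  im₂ : b.im = 0
  im₃ : c.im = 0
  lt₁₂ : a.re < b.re
  lt₂₃ : b.re < c.re

theorem isOrderedTriple_snailCenter {n p : ℕ} (hn : 0 < n) (hp : 0 < p) :
    IsOrderedTriple (snailCenter₁ n p) (snailCenter₂ n p) (snailCenter₃ n p) :=
  ⟨snailCenter₁_im n p, snailCenter₂_im n p, snailCenter₃_im n p, snailCenter₁_lt n hp,
    snailCenter₂_lt hn p⟩

/-- A motion along the axis preserves the order of the centers, so the class of `SN(n;p)` relative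
to an increasing triple consists of the images of `SN(n;p)` that send each center to the point of
the triple of the same index. -/
theorem mem_snailClass_iff {n p : ℕ} (hn : 0 < n) (hp : 0 < p) {a b c : ℂ}
    (habc : IsOrderedTriple a b c) (H : Set ℂ) :
    H ∈ snailClass {a, b, c} n p ↔
      ∃ g, IsLineMove (snailCenter₁ n p) (snailCenter₂ n p) (snailCenter₃ n p) g ∧
        g (snailCenter₁ n p) = a ∧ g (snailCenter₂ n p) = b ∧ g (snailCenter₃ n p) = c ∧
        g '' snail n p = H := by
  constructor
  · rintro ⟨φ, h1, h2, h3, h4⟩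
    have hl : IsLineMove (snailCenter₁ n p) (snailCenter₂ n p) (snailCenter₃ n p) (φ 1) :=
      ⟨φ, h1, rfl, fun t => ⟨h2 t _ (by simp [snailCenters]), h2 t _ (by simp [snailCenters]),
        h2 t _ (by simp [snailCenters])⟩⟩
    have l1 := hl.re_lt (snailCenter₁_lt n hp)
    have l2 := hl.swap.swap'.re_lt (snailCenter₂_lt hn p)
    have mem : ∀ x ∈ snailCenters n p, φ 1 x ∈ ({a, b, c} : Set ℂ) := fun x hx =>
      h3 ▸ Set.mem_image_of_mem _ hx
    have m1 := mem (snailCenter₁ n p) (by simp [snailCenters])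
    have m2 := mem (snailCenter₂ n p) (by simp [snailCenters])
    have m3 := mem (snailCenter₃ n p) (by simp [snailCenters])
    have o1 := habc.lt₁₂
    have o2 := habc.lt₂₃
    refine ⟨φ 1, hl, ?_⟩
    simp only [Set.mem_insert_iff, Set.mem_singleton_iff] at m1 m2 m3
    rcases m1 with m1 | m1 | m1 <;> rcases m2 with m2 | m2 | m2 <;>
      rcases m3 with m3 | m3 | m3 <;> rw [m1, m2] at l1 <;> rw [m2, m3] at l2 <;>
      first
      | exact ⟨m1, m2, m3, h4⟩
      | (exfalso; linarith)
  · rintro ⟨g, ⟨φ, h1, rfl, h3⟩, rfl, rfl, rfl, rfl⟩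
    refine ⟨φ, h1, ?_, ?_, rfl⟩
    · rintro t x (rfl | rfl | rfl)
      exacts [(h3 t).1, (h3 t).2.1, (h3 t).2.2]
    · simp only [snailCenters, Set.image_insert_eq, Set.image_singleton]

/-- If a top move carries the snail `SN(n;p)` to `SN(n';p')` and `f` permutes the points
`P₁, P₂, P₃` through a top move as the first move permutes the ranks of the centers, then `f`
carries the class of `SN(n;p)` to that of `SN(n';p')`. -/
theorem image_mem_snailClass_iff {n p n' p' : ℕ} (hn : 0 < n) (hp : 0 < p) (hn' : 0 < n')
    (hp' : 0 < p') {P₁ P₂ P₃ Q₁ Q₂ Q₃ d₁ d₂ d₃ : ℂ} (hP : IsOrderedTriple P₁ P₂ P₃)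
    {f g₀ : ℂ ≃ₜ ℂ} (hf : IsTopMove P₁ P₂ P₃ f)
    (hg₀ : IsTopMove (snailCenter₁ n p) (snailCenter₂ n p) (snailCenter₃ n p) g₀)
    (e1 : g₀ (snailCenter₁ n p) = d₁) (e2 : g₀ (snailCenter₂ n p) = d₂)
    (e3 : g₀ (snailCenter₃ n p) = d₃) (f1 : f P₁ = Q₁) (f2 : f P₂ = Q₂) (f3 : f P₃ = Q₃)
    (him : d₂.im = 0) (hQim : Q₂.im = 0)
    (s1 : 0 < (d₂.re - d₁.re) * (Q₂.re - Q₁.re)) (s2 : 0 < (d₃.re - d₂.re) * (Q₃.re - Q₂.re))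
    (s3 : 0 < (d₃.re - d₁.re) * (Q₃.re - Q₁.re))
    (hsw : ∀ k, IsLineMove (snailCenter₁ n' p') (snailCenter₂ n' p') (snailCenter₃ n' p') k ↔
      IsLineMove d₁ d₂ d₃ k)
    (hmap : ∀ k : ℂ ≃ₜ ℂ, k (snailCenter₁ n' p') = P₁ ∧ k (snailCenter₂ n' p') = P₂ ∧
      k (snailCenter₃ n' p') = P₃ ↔ k d₁ = Q₁ ∧ k d₂ = Q₂ ∧ k d₃ = Q₃)
    (him₀ : g₀ '' snail n p = snail n' p') (H : Set ℂ) :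
    f '' H ∈ snailClass {P₁, P₂, P₃} n' p' ↔ H ∈ snailClass {P₁, P₂, P₃} n p := by
  rw [mem_snailClass_iff hn hp hP, mem_snailClass_iff hn' hp' hP]
  have hc := isOrderedTriple_snailCenter hn hp
  constructor
  · rintro ⟨g, hg, g1, g2, g3, himg⟩
    obtain ⟨q1, q2, q3⟩ := (hmap g).1 ⟨g1, g2, g3⟩
    have hfs := hf.symm
    rw [f1, f2, f3, ← q1, ← q2, ← q3] at hfs
    have hk : IsTopMove d₁ d₂ d₃ (g.trans f.symm) := ((hsw g).1 hg).isTopMove.trans hfs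
    rw [← e1, ← e2, ← e3] at hk
    have hk' := hg₀.trans hk
    have k1 : (g₀.trans (g.trans f.symm)) (snailCenter₁ n p) = P₁ := by
      simp [e1, q1, ← f1]
    have k2 : (g₀.trans (g.trans f.symm)) (snailCenter₂ n p) = P₂ := by
      simp [e2, q2, ← f2]
    have k3 : (g₀.trans (g.trans f.symm)) (snailCenter₃ n p) = P₃ := by
      simp [e3, q3, ← f3]
    refine ⟨_, hk'.isLineMove hc.im₂ (by rw [k2]; exact hP.im₂) ?_ ?_ ?_, k1, k2, k3, ?_⟩
    · rw [k1, k2]; exact mul_pos (sub_pos.2 hc.lt₁₂) (sub_pos.2 hP.lt₁₂)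
    · rw [k2, k3]; exact mul_pos (sub_pos.2 hc.lt₂₃) (sub_pos.2 hP.lt₂₃)
    · rw [k1, k3]
      exact mul_pos (sub_pos.2 (hc.lt₁₂.trans hc.lt₂₃)) (sub_pos.2 (hP.lt₁₂.trans hP.lt₂₃))
    · have : (g₀.trans (g.trans f.symm)) '' snail n p = f.symm '' (g '' (g₀ '' snail n p)) := by
        rw [Set.image_image, Set.image_image]; rfl
      rw [this, him₀, himg, Set.image_image]
      simp
  · rintro ⟨g, hg, g1, g2, g3, rfl⟩
    have hk : IsTopMove (snailCenter₁ n p) (snailCenter₂ n p) (snailCenter₃ n p) (g.trans f) :=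
      hg.isTopMove.trans (by rw [g1, g2, g3]; exact hf)
    have hs := hg₀.symm
    have hk' : IsTopMove d₁ d₂ d₃ (g₀.symm.trans (g.trans f)) := by
      rw [e1, e2, e3] at hs
      refine hs.trans ?_
      rw [← e1, ← e2, ← e3]
      simpa using hk
    have k1 : (g₀.symm.trans (g.trans f)) d₁ = Q₁ := by
      rw [← e1, ← f1]; simp [g1]
    have k2 : (g₀.symm.trans (g.trans f)) d₂ = Q₂ := by
      rw [← e2, ← f2]; simp [g2]
    have k3 : (g₀.symm.trans (g.trans f)) d₃ = Q₃ := by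
      rw [← e3, ← f3]; simp [g3]
    obtain ⟨m1, m2, m3⟩ := (hmap _).2 ⟨k1, k2, k3⟩
    refine ⟨_, (hsw _).2 (hk'.isLineMove him (by rw [k2]; exact hQim) ?_ ?_ ?_), m1, m2, m3, ?_⟩
    · rw [k1, k2]; exact s1
    · rw [k2, k3]; exact s2
    · rw [k1, k3]; exact s3
    · have : (g₀.symm.trans (g.trans f)) '' snail n' p' = f '' (g '' (g₀.symm '' snail n' p')) := by
        rw [Set.image_image, Set.image_image]; rfl
      rw [this, ← him₀, Set.image_image g₀.symm]
      simp

/-- The left step: a top move takes `SN(n;p)` to `SN(n+p;p)`, the middle center passing over the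
left one. -/
def HasLeftStep (n p : ℕ) : Prop :=
  ∃ g, IsTopMove (snailCenter₁ n p) (snailCenter₂ n p) (snailCenter₃ n p) g ∧
    g (snailCenter₁ n p) = snailCenter₂ (n + p) p ∧
    g (snailCenter₂ n p) = snailCenter₁ (n + p) p ∧
    g (snailCenter₃ n p) = snailCenter₃ (n + p) p ∧ g '' snail n p = snail (n + p) p

/-- The right step: a top move takes `SN(n;p)` to `SN(n;n+p)`, the middle center passing over the
right one. -/
def HasRightStep (n p : ℕ) : Prop :=
  ∃ g, IsTopMove (snailCenter₁ n p) (snailCenter₂ n p) (snailCenter₃ n p) g ∧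
    g (snailCenter₁ n p) = snailCenter₁ n (n + p) ∧
    g (snailCenter₂ n p) = snailCenter₃ n (n + p) ∧
    g (snailCenter₃ n p) = snailCenter₂ n (n + p) ∧ g '' snail n p = snail n (n + p)

/-- The reflection of the plane in the imaginary axis. -/
def reflection : ℂ ≃ₜ ℂ := Complex.conjLIE.toHomeomorph.trans (Homeomorph.neg ℂ)

theorem reflection_apply (z : ℂ) : reflection z = -(starRingEnd ℂ) z := rfl

theorem reflection_reflection (z : ℂ) : reflection (reflection z) = z := by
  simp [reflection_apply]

theorem reflection_symm : reflection.symm = reflection := by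
  ext z
  rw [Homeomorph.symm_apply_eq, reflection_reflection]

theorem reflection_im (z : ℂ) : (reflection z).im = z.im := by
  simp [reflection_apply]

theorem reflection_re (z : ℂ) : (reflection z).re = -z.re := by
  simp [reflection_apply]

theorem norm_reflection_sub (z w : ℂ) : ‖reflection z - w‖ = ‖z - reflection w‖ := by
  rw [← Complex.norm_conj, ← norm_neg]
  congr 1
  simp [reflection_apply]
  ring

theorem reflection_snailCenter₁ (n p : ℕ) : reflection (snailCenter₁ n p) = snailCenter₃ p n :=
  Complex.ext (by rw [reflection_re, snailCenter₁_re, snailCenter₃_re]; ring)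
    (by rw [reflection_im, snailCenter₁_im, snailCenter₃_im])

theorem reflection_snailCenter₂ (n p : ℕ) : reflection (snailCenter₂ n p) = snailCenter₂ p n :=
  Complex.ext (by rw [reflection_re, snailCenter₂_re, snailCenter₂_re]; ring)
    (by rw [reflection_im, snailCenter₂_im, snailCenter₂_im])

theorem reflection_snailCenter₃ (n p : ℕ) : reflection (snailCenter₃ n p) = snailCenter₁ p n :=
  Complex.ext (by rw [reflection_re, snailCenter₁_re, snailCenter₃_re]; ring)
    (by rw [reflection_im, snailCenter₁_im, snailCenter₃_im])

theorem reflection_mem_snail {n p : ℕ} {z : ℂ} : reflection z ∈ snail p n ↔ z ∈ snail n p := by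
  simp only [snail, Set.mem_union, Set.mem_ofPred_eq, reflection_im, norm_reflection_sub,
    reflection_snailCenter₁, reflection_snailCenter₂, reflection_snailCenter₃, add_comm p n]
  tauto

theorem reflection_image_snail (n p : ℕ) : reflection '' snail n p = snail p n := by
  ext z
  constructor
  · rintro ⟨w, hw, rfl⟩
    exact reflection_mem_snail.2 hw
  · intro hz
    exact ⟨reflection z, reflection_mem_snail.2 hz, reflection_reflection z⟩

theorem HasLeftStep.hasRightStep {n p : ℕ} (h : HasLeftStep p n) : HasRightStep n p := by
  obtain ⟨g, h1, h2, h3, h4, h5⟩ := h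
  have h6 := (h1.conj reflection reflection_im).reverse_labels
  rw [reflection_snailCenter₁, reflection_snailCenter₂, reflection_snailCenter₃,
    reflection_symm] at h6
  refine ⟨_, h6, ?_, ?_, ?_, ?_⟩
  · simp [reflection_snailCenter₁, reflection_snailCenter₃, h4, add_comm n p]
  · simp [reflection_snailCenter₁, reflection_snailCenter₂, h3, add_comm n p]
  · simp [reflection_snailCenter₂, reflection_snailCenter₃, h2, add_comm n p]
  · change (reflection ∘ g ∘ reflection) '' snail n p = _
    rw [Set.image_comp, Set.image_comp, reflection_image_snail, h5, reflection_image_snail,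
      add_comm n p]

theorem IsTypeA.isTopMove {P₁ P₂ P₃ : ℂ} (hP : IsOrderedTriple P₁ P₂ P₃) {f : ℂ ≃ₜ ℂ}
    (h : IsTypeA P₁ P₂ P₃ f) : IsTopMove P₁ P₂ P₃ f := by
  obtain ⟨h1, h2, h3, φ, k1, rfl, k3⟩ := h
  refine ⟨φ, k1, rfl, fun t => ?_⟩
  rcases eq_or_ne t 0 with rfl | h0
  · simp [k1.zero_apply, hP.im₁, hP.im₂, hP.im₃]
  rcases eq_or_ne t 1 with rfl | h1'
  · simp [h1, h2, h3, hP.im₁, hP.im₂, hP.im₃]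
  simpa using k3 t ⟨unitInterval.pos_iff_ne_zero.2 h0, unitInterval.lt_one_iff_ne_one.2 h1'⟩

theorem IsTypeB.isTopMove {P₁ P₂ P₃ : ℂ} (hP : IsOrderedTriple P₁ P₂ P₃) {f : ℂ ≃ₜ ℂ}
    (h : IsTypeB P₁ P₂ P₃ f) : IsTopMove P₁ P₂ P₃ f := by
  obtain ⟨h1, h2, h3, φ, k1, rfl, k3⟩ := h
  refine ⟨φ, k1, rfl, fun t => ?_⟩
  rcases eq_or_ne t 0 with rfl | h0
  · simp [k1.zero_apply, hP.im₁, hP.im₂, hP.im₃]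
  rcases eq_or_ne t 1 with rfl | h1'
  · simp [h1, h2, h3, hP.im₁, hP.im₂, hP.im₃]
  simpa using k3 t ⟨unitInterval.pos_iff_ne_zero.2 h0, unitInterval.lt_one_iff_ne_one.2 h1'⟩

theorem IsTypeA.image_mem_snailClass_iff {n p : ℕ} (hn : 0 < n) (hp : 0 < p)
    (hstep : HasLeftStep n p) {P₁ P₂ P₃ : ℂ} (hP : IsOrderedTriple P₁ P₂ P₃) {f : ℂ ≃ₜ ℂ}
    (hf : IsTypeA P₁ P₂ P₃ f) (H : Set ℂ) :
    f '' H ∈ snailClass {P₁, P₂, P₃} (n + p) p ↔ H ∈ snailClass {P₁, P₂, P₃} n p := by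
  obtain ⟨g₀, h0, e1, e2, e3, e4⟩ := hstep
  have hc := isOrderedTriple_snailCenter (Nat.add_pos_left hn p) hp
  have := hc.lt₁₂
  have := hc.lt₂₃
  have := hP.lt₁₂
  have := hP.lt₂₃
  refine _root_.image_mem_snailClass_iff hn hp (by omega) hp hP (hf.isTopMove hP) h0 e1 e2 e3
    hf.1 hf.2.1 hf.2.2.1 hc.im₁ hP.im₁ ?_ ?_ ?_ (fun k => ⟨fun h => h.swap, fun h => h.swap⟩)
    (fun k => by tauto) e4 H
  · exact mul_pos_of_neg_of_neg (by linarith) (by linarith)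
  · exact mul_pos (by linarith) (by linarith)
  · exact mul_pos (by linarith) (by linarith)

theorem IsTypeB.image_mem_snailClass_iff {n p : ℕ} (hn : 0 < n) (hp : 0 < p)
    (hstep : HasRightStep n p) {P₁ P₂ P₃ : ℂ} (hP : IsOrderedTriple P₁ P₂ P₃) {f : ℂ ≃ₜ ℂ}
    (hf : IsTypeB P₁ P₂ P₃ f) (H : Set ℂ) :
    f '' H ∈ snailClass {P₁, P₂, P₃} n (n + p) ↔ H ∈ snailClass {P₁, P₂, P₃} n p := by
  obtain ⟨g₀, h0, e1, e2, e3, e4⟩ := hstep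
  have hc := isOrderedTriple_snailCenter hn (Nat.add_pos_left hn p)
  have := hc.lt₁₂
  have := hc.lt₂₃
  have := hP.lt₁₂
  have := hP.lt₂₃
  refine _root_.image_mem_snailClass_iff hn hp hn (by omega) hP (hf.isTopMove hP) h0 e1 e2 e3
    hf.1 hf.2.1 hf.2.2.1 hc.im₃ hP.im₃ ?_ ?_ ?_ (fun k => ⟨fun h => h.swap', fun h => h.swap'⟩)
    (fun k => by tauto) e4 H
  · exact mul_pos (by linarith) (by linarith)
  · exact mul_pos_of_neg_of_neg (by linarith) (by linarith)
  · exact mul_pos (by linarith) (by linarith)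

/-- Each factor of `F` acts on the snail classes as the corresponding factor acts on the pair of
integers. -/
theorem alternatingProduct_image_mem_snailClass_iff
    (hL : ∀ n p : ℕ, 0 < n → 0 < p → HasLeftStep n p) {P₁ P₂ P₃ : ℂ}
    (hP : IsOrderedTriple P₁ P₂ P₃) {fA fB : ℂ ≃ₜ ℂ} (hA : IsTypeA P₁ P₂ P₃ fA)
    (hB : IsTypeB P₁ P₂ P₃ fB) (α β : ℕ → ℕ) (H : Set ℂ) (k : ℕ) :
    ∀ q : ℕ × ℕ, alternatingProduct (fun q : ℕ × ℕ => (q.1 + q.2, q.2))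
      (fun q : ℕ × ℕ => (q.1, q.1 + q.2)) α β k (1, 1) = q →
      (0 < q.1 ∧ 0 < q.2) ∧ (alternatingProduct fA fB α β k '' H ∈
        snailClass {P₁, P₂, P₃} q.1 q.2 ↔ H ∈ snailClass {P₁, P₂, P₃} 1 1) := by
  have itA : ∀ (j : ℕ) (q : ℕ × ℕ) (K : Set ℂ), 0 < q.1 → 0 < q.2 →
      ∀ q', (fun q : ℕ × ℕ => (q.1 + q.2, q.2))^[j] q = q' → (0 < q'.1 ∧ 0 < q'.2) ∧
        (fA^[j] '' K ∈ snailClass {P₁, P₂, P₃} q'.1 q'.2 ↔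
          K ∈ snailClass {P₁, P₂, P₃} q.1 q.2) := by
    intro j
    induction j with
    | zero => rintro q K h1 h2 q' rfl; simpa using ⟨h1, h2⟩
    | succ j ih =>
      rintro q K h1 h2 q' rfl
      obtain ⟨⟨i1, i2⟩, i3⟩ := ih q K h1 h2 _ rfl
      rw [Function.iterate_succ_apply', Function.iterate_succ', Set.image_comp]
      refine ⟨⟨Nat.add_pos_left i1 _, i2⟩, ?_⟩
      rw [← i3]
      exact hA.image_mem_snailClass_iff i1 i2 (hL _ _ i1 i2) hP _
  have itB : ∀ (j : ℕ) (q : ℕ × ℕ) (K : Set ℂ), 0 < q.1 → 0 < q.2 →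
      ∀ q', (fun q : ℕ × ℕ => (q.1, q.1 + q.2))^[j] q = q' → (0 < q'.1 ∧ 0 < q'.2) ∧
        (fB^[j] '' K ∈ snailClass {P₁, P₂, P₃} q'.1 q'.2 ↔
          K ∈ snailClass {P₁, P₂, P₃} q.1 q.2) := by
    intro j
    induction j with
    | zero => rintro q K h1 h2 q' rfl; simpa using ⟨h1, h2⟩
    | succ j ih =>
      rintro q K h1 h2 q' rfl
      obtain ⟨⟨i1, i2⟩, i3⟩ := ih q K h1 h2 _ rfl
      rw [Function.iterate_succ_apply', Function.iterate_succ', Set.image_comp]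
      refine ⟨⟨i1, Nat.add_pos_left i1 _⟩, ?_⟩
      rw [← i3]
      exact hB.image_mem_snailClass_iff i1 i2 (hL _ _ i2 i1).hasRightStep hP _
  induction k with
  | zero => rintro q rfl; simp [alternatingProduct]
  | succ k ih =>
    rintro q rfl
    obtain ⟨⟨i1, i2⟩, i3⟩ := ih _ rfl
    simp only [alternatingProduct, Function.comp_apply]
    obtain ⟨⟨a1, a2⟩, a3⟩ := itA (α (k + 1)) _ (alternatingProduct fA fB α β k '' H) i1 i2 _ rfl
    obtain ⟨b12, b3⟩ := itB (β (k + 1)) _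
      (fA^[α (k + 1)] '' (alternatingProduct fA fB α β k '' H)) a1 a2 _ rfl
    refine ⟨b12, ?_⟩
    rw [← i3, ← a3, ← b3, Set.image_image, Set.image_image]

theorem alternatingProduct_surjective {S : Type*} {a b : S → S} (ha : Function.Surjective a)
    (hb : Function.Surjective b) (α β : ℕ → ℕ) (k : ℕ) :
    Function.Surjective (alternatingProduct a b α β k) := by
  induction k with
  | zero => exact Function.surjective_id
  | succ k ih => exact (hb.iterate _).comp ((ha.iterate _).comp ih)

theorem isotopicRel_of_mem_snailClass {n p : ℕ} (hn : 0 < n) (hp : 0 < p) {H : Set ℂ}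
    (h : H ∈ snailClass (snailCenters n p) n p) :
    IsotopicRel (snailCenters n p) (snail n p) H := by
  have hc := isOrderedTriple_snailCenter hn hp
  obtain ⟨g, h1, h2, h3, h4, rfl⟩ := (mem_snailClass_iff hn hp hc H).1 h
  exact h1.isotopicRel hc.lt₁₂ hc.lt₂₃ h2 h3 h4 _

end

noncomputable section

/-! ### Horizontal shears and twists -/

/-- A horizontal map of the plane with bounded displacement that is increasing on each horizontal
line is isotopic to the identity by linear interpolation. -/
theorem exists_isotopy_horizontal (σ : ℝ → ℝ → ℝ) (hc : Continuous fun q : ℝ × ℝ => σ q.1 q.2)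
    (hm : ∀ y, StrictMono fun x => σ x y) {C : ℝ} (hC : ∀ x y, |σ x y - x| ≤ C) :
    ∃ φ : unitInterval → (ℂ ≃ₜ ℂ), IsIsotopyFromId φ ∧
      ∀ (t : unitInterval) (z : ℂ), φ t z = ⟨(1 - (t : ℝ)) * z.re + t * σ z.re z.im, z.im⟩ := by
  have hdisp : ∀ (t : unitInterval) x y, |(1 - (t : ℝ)) * x + t * σ x y - x| ≤ C := by
    intro t x y
    have : (1 - (t : ℝ)) * x + t * σ x y - x = t * (σ x y - x) := by ring
    rw [this, abs_mul, abs_of_nonneg t.2.1]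
    exact (mul_le_of_le_one_left (abs_nonneg _) t.2.2).trans (hC x y)
  have hmono : ∀ (t : unitInterval) y, StrictMono fun x => (1 - (t : ℝ)) * x + t * σ x y := by
    intro t y x x' hx
    have h1 := hm y hx
    have h0 := t.2.1
    have h2 := t.2.2
    simp only at h1 ⊢
    rcases h0.lt_or_eq with h | h
    · nlinarith [mul_pos h (sub_pos.2 h1), mul_nonneg (sub_nonneg.2 h2) (sub_pos.2 hx).le]
    · rw [← h]; linarith
  have hcont : Continuous fun q : unitInterval × ℂ =>
      (⟨(1 - (q.1 : ℝ)) * q.2.re + q.1 * σ q.2.re q.2.im, q.2.im⟩ : ℂ) := by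
    have : Continuous fun q : unitInterval × ℂ => σ q.2.re q.2.im :=
      hc.comp ((Complex.continuous_re.comp continuous_snd).prodMk
        (Complex.continuous_im.comp continuous_snd))
    exact Continuous.complexMk (by fun_prop) (by fun_prop)
  refine exists_isotopy_of_proper
    (fun t z => ⟨(1 - (t : ℝ)) * z.re + t * σ z.re z.im, z.im⟩) hcont (fun t => ⟨?_, ?_⟩) ?_ ?_
  · intro z w h
    obtain ⟨h1, h2⟩ := Complex.ext_iff.1 h
    simp only at h1 h2
    rw [h2] at h1
    exact Complex.ext ((hmono t w.im).injective h1) h2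
  · intro w
    have hcy : Continuous fun x => (1 - (t : ℝ)) * x + t * σ x w.im := by
      have : Continuous fun x => σ x w.im := hc.comp (Continuous.prodMk_left w.im)
      fun_prop
    obtain ⟨x, hx⟩ := mem_range_of_exists_le_of_exists_ge hcy (c := w.re)
      ⟨w.re - C, by have := abs_le.1 (hdisp t (w.re - C) w.im); linarith⟩
      ⟨w.re + C, by have := abs_le.1 (hdisp t (w.re + C) w.im); linarith⟩
    exact ⟨⟨x, w.im⟩, Complex.ext hx rfl⟩
  · intro z
    simp
  · intro R
    refine ⟨R + C, fun t z hz => ?_⟩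
    have h1 : z = ⟨(1 - (t : ℝ)) * z.re + t * σ z.re z.im, z.im⟩
        - (((1 - (t : ℝ)) * z.re + t * σ z.re z.im - z.re : ℝ) : ℂ) :=
      Complex.ext (by simp) (by simp)
    have h2 := norm_sub_le (⟨(1 - (t : ℝ)) * z.re + t * σ z.re z.im, z.im⟩ : ℂ)
      (((1 - (t : ℝ)) * z.re + t * σ z.re z.im - z.re : ℝ) : ℂ)
    rw [← h1, Complex.norm_real, Real.norm_eq_abs] at h2
    exact h2.trans (add_le_add hz (hdisp t z.re z.im))

/-- The point at distance `r` from the origin whose angle, counted counterclockwise from the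
negative imaginary axis, is `ψ`. -/
def bottomPolar (r ψ : ℝ) : ℂ := ⟨r * Real.sin ψ, -(r * Real.cos ψ)⟩

theorem norm_bottomPolar {r : ℝ} (hr : 0 ≤ r) (ψ : ℝ) : ‖bottomPolar r ψ‖ = r := by
  rw [Complex.norm_def, Complex.normSq_apply]
  simp only [bottomPolar]
  rw [← Real.sqrt_mul_self hr]
  congr 1
  rw [Real.sqrt_mul_self hr]
  linear_combination r ^ 2 * Real.sin_sq_add_cos_sq ψ

theorem bottomPolar_arg (z : ℂ) : bottomPolar ‖z‖ (Complex.arg (Complex.I * z)) = z := by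
  have h1 := Complex.norm_mul_cos_arg (Complex.I * z)
  have h2 := Complex.norm_mul_sin_arg (Complex.I * z)
  rw [norm_mul, Complex.norm_I, one_mul] at h1 h2
  apply Complex.ext
  · simp only [bottomPolar]; rw [h2]; simp
  · simp only [bottomPolar]; rw [h1]; simp

theorem bottomPolar_mul_exp (r ψ θ : ℝ) :
    bottomPolar r ψ * Complex.exp (θ * Complex.I) = bottomPolar r (ψ + θ) := by
  apply Complex.ext
  · simp [bottomPolar, Complex.exp_ofReal_mul_I_re, Complex.exp_ofReal_mul_I_im, Real.sin_add]
    ring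
  · simp [bottomPolar, Complex.exp_ofReal_mul_I_re, Complex.exp_ofReal_mul_I_im, Real.cos_add]
    ring

theorem bottomPolar_eq_iff {r : ℝ} (hr : 0 < r) {a b : ℝ} (h : bottomPolar r a = bottomPolar r b) :
    ∃ k : ℤ, a - b = 2 * Real.pi * k := by
  obtain ⟨h1, h2⟩ := Complex.ext_iff.1 h
  simp only [bottomPolar] at h1 h2
  have h1' := mul_left_cancel₀ hr.ne' h1
  have h2' := mul_left_cancel₀ hr.ne' (neg_injective h2)
  exact Real.Angle.angle_eq_iff_two_pi_dvd_sub.1 (Real.Angle.cos_sin_inj h2' h1')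

theorem bottomPolar_add_int_mul (r ψ : ℝ) (k : ℤ) :
    bottomPolar r (ψ + k * (2 * Real.pi)) = bottomPolar r ψ := by
  simp only [bottomPolar, Real.sin_add_int_mul_two_pi, Real.cos_add_int_mul_two_pi]

theorem continuous_bottomPolar (r : ℝ) : Continuous (bottomPolar r) :=
  Continuous.complexMk (by fun_prop) (by fun_prop)

/-- Rotating each point `z` about the origin by the angle `E z` is the end of an isotopy as soon as
the angular map is increasing on each circle, at all intermediate times. -/
theorem exists_isotopy_twist (E : ℂ → ℝ) (hE : Continuous E)
    (hm : ∀ (t : unitInterval) (r : ℝ), 0 < r →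
      StrictMonoOn (fun ψ => ψ + t * E (bottomPolar r ψ)) (Set.Icc (-Real.pi) Real.pi)) :
    ∃ φ : unitInterval → (ℂ ≃ₜ ℂ), IsIsotopyFromId φ ∧
      ∀ (t : unitInterval) (z : ℂ), φ t z = z * Complex.exp (((t : ℝ) * E z : ℝ) * Complex.I) := by
  have hnorm : ∀ (t : unitInterval) (z : ℂ),
      ‖z * Complex.exp (((t : ℝ) * E z : ℝ) * Complex.I)‖ = ‖z‖ := by
    intro t z
    rw [norm_mul, Complex.norm_exp_ofReal_mul_I, mul_one]
  have hpi := Real.pi_pos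
  have hends : ∀ r, bottomPolar r Real.pi = bottomPolar r (-Real.pi) := by
    intro r; simp [bottomPolar]
  refine exists_isotopy_of_proper
    (fun t z => z * Complex.exp (((t : ℝ) * E z : ℝ) * Complex.I)) (by fun_prop)
    (fun t => ⟨?_, ?_⟩) (by simp) (fun R => ⟨R, fun t z hz => by rwa [hnorm] at hz⟩)
  · intro z w h
    simp only at h
    have hn : ‖z‖ = ‖w‖ := by rw [← hnorm t z, ← hnorm t w, h]
    rcases eq_or_ne w 0 with rfl | hw
    · simpa using hn
    have hr : 0 < ‖w‖ := norm_pos_iff.2 hw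
    set r := ‖w‖ with hrdef
    obtain ⟨ψ, hψ, rfl⟩ : ∃ ψ ∈ Set.Ioc (-Real.pi) Real.pi, bottomPolar r ψ = z :=
      ⟨_, Complex.arg_mem_Ioc (Complex.I * z), by rw [← hn]; exact bottomPolar_arg z⟩
    obtain ⟨ψ', hψ', hw'⟩ : ∃ ψ ∈ Set.Ioc (-Real.pi) Real.pi, bottomPolar r ψ = w :=
      ⟨_, Complex.arg_mem_Ioc (Complex.I * w), bottomPolar_arg w⟩
    rw [← hw', bottomPolar_mul_exp, bottomPolar_mul_exp] at h
    obtain ⟨k, hk⟩ := bottomPolar_eq_iff hr h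
    have mono := hm t r hr
    have bound : ∀ x ∈ Set.Ioc (-Real.pi) Real.pi,
        -Real.pi + t * E (bottomPolar r (-Real.pi)) < x + t * E (bottomPolar r x) ∧
        x + t * E (bottomPolar r x) ≤ Real.pi + t * E (bottomPolar r (-Real.pi)) := by
      intro x hx
      refine ⟨mono ⟨le_rfl, by linarith⟩ ⟨hx.1.le, hx.2⟩ hx.1, ?_⟩
      rw [← hends]
      exact mono.monotoneOn ⟨hx.1.le, hx.2⟩ ⟨by linarith, le_rfl⟩ hx.2
    have b1 := bound ψ hψ
    have b2 := bound ψ' hψ'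
    have hk0 : k = 0 := by
      have h1 : (k : ℝ) < 1 := by nlinarith
      have h2 : (-1 : ℝ) < k := by nlinarith
      have h1' : k < 1 := by exact_mod_cast h1
      have h2' : -1 < k := by exact_mod_cast h2
      omega
    rw [← hw', mono.injOn ⟨hψ.1.le, hψ.2⟩ ⟨hψ'.1.le, hψ'.2⟩ (by
      rw [hk0] at hk; simp at hk; linarith)]
  · intro w
    rcases eq_or_ne w 0 with rfl | hw
    · exact ⟨0, by simp⟩
    have hr : 0 < ‖w‖ := norm_pos_iff.2 hw
    set r := ‖w‖
    set θ := Complex.arg (Complex.I * w)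
    have hθ : bottomPolar r θ = w := bottomPolar_arg w
    set g : ℝ → ℝ := fun ψ => ψ + t * E (bottomPolar r ψ)
    have hg : Continuous g :=
      continuous_id.add (continuous_const.mul (hE.comp (continuous_bottomPolar r)))
    have hgpi : g Real.pi = g (-Real.pi) + 2 * Real.pi := by
      simp only [g]; rw [hends]; ring
    obtain ⟨k, hk, -⟩ := existsUnique_add_zsmul_mem_Ico (by positivity : 0 < 2 * Real.pi) θ
      (g (-Real.pi))
    rw [zsmul_eq_mul] at hk
    obtain ⟨ψ, -, hψ⟩ := intermediate_value_Icc (by linarith : -Real.pi ≤ Real.pi)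
      hg.continuousOn (show θ + k * (2 * Real.pi) ∈ Set.Icc (g (-Real.pi)) (g Real.pi) from
        ⟨hk.1, by rw [hgpi]; exact hk.2.le⟩)
    refine ⟨bottomPolar r ψ, ?_⟩
    simp only
    rw [bottomPolar_mul_exp]
    change bottomPolar r (g ψ) = w
    rw [hψ, bottomPolar_add_int_mul, hθ]

/-! ### The radii of the half-circles -/

/-- Twice the radii are the natural numbers below `m` of the parity opposite to that of `m`. -/
theorem mem_snailRadii {m : ℕ} {r : ℝ} :
    r ∈ snailRadii m ↔ ∃ j : ℕ, j < m ∧ Odd (j + m) ∧ 2 * r = j := by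
  constructor
  · rintro ⟨i, hi, rfl⟩
    rcases Nat.even_or_odd' m with ⟨q, rfl | rfl⟩
    · refine ⟨2 * i + 1, by omega, ⟨i + q, by ring⟩, ?_⟩
      rw [Nat.mul_div_cancel_left q (by norm_num)]
      push_cast; ring
    · refine ⟨2 * i, by omega, ⟨i + q, by ring⟩, ?_⟩
      rw [show (2 * q + 1) / 2 = q by omega]
      push_cast; ring
  · rintro ⟨j, hj, hodd, hr⟩
    rcases Nat.even_or_odd' m with ⟨q, rfl | rfl⟩
    · obtain ⟨i, rfl⟩ : Odd j := by
        rcases hodd with ⟨s, hs⟩; exact ⟨s - q, by omega⟩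
      refine ⟨i, by omega, ?_⟩
      rw [Nat.mul_div_cancel_left q (by norm_num)]
      push_cast at hr ⊢; linarith
    · obtain ⟨i, rfl⟩ : Even j := by
        rcases hodd with ⟨s, hs⟩; exact ⟨s - q, by omega⟩
      refine ⟨i, by omega, ?_⟩
      rw [show (2 * q + 1) / 2 = q by omega]
      push_cast at hr ⊢; linarith

theorem le_of_mem_snailRadii {m : ℕ} {r : ℝ} (h : r ∈ snailRadii m) :
    0 ≤ r ∧ 2 * r + 1 ≤ m := by
  obtain ⟨j, hj, -, hr⟩ := mem_snailRadii.1 h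
  have h1 : (j : ℝ) + 1 ≤ m := by exact_mod_cast hj
  have h2 : (0 : ℝ) ≤ j := j.cast_nonneg
  constructor <;> linarith

theorem eq_zero_of_mem_snailRadii {m : ℕ} {r : ℝ} (h : r ∈ snailRadii m) (hr : r < 1 / 2) :
    r = 0 := by
  obtain ⟨j, hj, -, h2⟩ := mem_snailRadii.1 h
  have : (j : ℝ) < 1 := by linarith
  have : j = 0 := by
    have : j < 1 := by exact_mod_cast this
    omega
  rw [this] at h2
  simpa using h2

theorem abs_mem_snailRadii {m : ℕ} {u : ℝ} :
    |u| ∈ snailRadii m ↔ ∃ k : ℤ, |k| < m ∧ Odd (k + m) ∧ 2 * u = k := by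
  rw [mem_snailRadii]
  constructor
  · rintro ⟨j, h1, ⟨s, hs⟩, h3⟩
    rcases abs_cases u with ⟨h, -⟩ | ⟨h, -⟩ <;> rw [h] at h3
    · exact ⟨j, by rw [abs_of_nonneg (by omega)]; exact_mod_cast h1, ⟨s, by omega⟩,
        by push_cast; linarith⟩
    · exact ⟨-j, by rw [abs_neg, abs_of_nonneg (by omega)]; exact_mod_cast h1, ⟨s - j, by omega⟩,
        by push_cast; linarith⟩
  · rintro ⟨k, h1, ⟨s, hs⟩, h3⟩
    have h1' : k.natAbs < m := by rw [Int.abs_eq_natAbs] at h1; exact_mod_cast h1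
    refine ⟨k.natAbs, h1', ?_, ?_⟩
    · rcases le_total 0 k with hk | hk
      · exact ⟨s.natAbs, by omega⟩
      · exact ⟨(s - k).natAbs, by omega⟩
    · rw [Nat.cast_natAbs, Int.cast_abs, ← h3, abs_mul]
      norm_num

end

noncomputable section

/-! ### Straightening concentric half-circles near the axis -/

/-- The amount by which `bendRadius` moves the point at distance `v` from the center. -/
def bendDepth (L v y : ℝ) : ℝ := min (min |y| (1 / 4)) (min (v / 2) (max (L - v) 0))

/-- For `v` in the relevant range, `bendRadius L v y` is the distance to the vertical line through
the center of the point of height `y` on the circle of radius `v`. -/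
def bendRadius (L v y : ℝ) : ℝ := √(v ^ 2 - bendDepth L v y ^ 2)

/-- The horizontal map that sends the vertical segments above and below the points `x` of the axis,
up to height `1/4`, to arcs of circles with center `c`; it is supported in `|x - c| ≤ L`. -/
def bend (c L x y : ℝ) : ℝ :=
  c + (bendRadius L (max (x - c) 0) y - bendRadius L (max (c - x) 0) y)

theorem bendDepth_nonneg {L v : ℝ} (hv : 0 ≤ v) (y : ℝ) : 0 ≤ bendDepth L v y := by
  unfold bendDepth
  exact le_min (le_min (abs_nonneg _) (by norm_num)) (le_min (by linarith) (le_max_right _ _))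

theorem bendDepth_le_half (L v y : ℝ) : bendDepth L v y ≤ v / 2 :=
  (min_le_right _ _).trans (min_le_left _ _)

theorem bendDepth_le_abs (L v y : ℝ) : bendDepth L v y ≤ |y| :=
  (min_le_left _ _).trans (min_le_left _ _)

theorem bendDepth_le_quarter (L v y : ℝ) : bendDepth L v y ≤ 1 / 4 :=
  (min_le_left _ _).trans (min_le_right _ _)

theorem bendDepth_sq_le {L v : ℝ} (hv : 0 ≤ v) (y : ℝ) : bendDepth L v y ^ 2 ≤ v ^ 2 :=
  pow_le_pow_left₀ (bendDepth_nonneg hv y) ((bendDepth_le_half L v y).trans (by linarith)) 2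

theorem bendDepth_add_le {L v w : ℝ} (hvw : v ≤ w) (y : ℝ) :
    bendDepth L w y ≤ bendDepth L v y + (w - v) / 2 := by
  unfold bendDepth
  rw [← sub_le_iff_le_add]
  refine le_min (le_min ?_ ?_) (le_min ?_ ?_)
  · have : min (min |y| (1 / 4)) (min (w / 2) (max (L - w) 0)) ≤ |y| :=
      (min_le_left _ _).trans (min_le_left _ _)
    linarith
  · have : min (min |y| (1 / 4)) (min (w / 2) (max (L - w) 0)) ≤ 1 / 4 :=
      (min_le_left _ _).trans (min_le_right _ _)
    linarith
  · have : min (min |y| (1 / 4)) (min (w / 2) (max (L - w) 0)) ≤ w / 2 :=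
      (min_le_right _ _).trans (min_le_left _ _)
    linarith
  · have h1 : min (min |y| (1 / 4)) (min (w / 2) (max (L - w) 0)) ≤ max (L - w) 0 :=
      (min_le_right _ _).trans (min_le_right _ _)
    have h2 : max (L - w) 0 ≤ max (L - v) 0 := max_le_max (by linarith) le_rfl
    linarith

theorem bendRadius_sq {L v : ℝ} (hv : 0 ≤ v) (y : ℝ) :
    bendRadius L v y ^ 2 = v ^ 2 - bendDepth L v y ^ 2 :=
  Real.sq_sqrt (sub_nonneg.2 (bendDepth_sq_le hv y))

theorem bendRadius_lt {L v w : ℝ} (hv : 0 ≤ v) (hvw : v < w) (y : ℝ) :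
    bendRadius L v y < bendRadius L w y := by
  refine Real.sqrt_lt_sqrt (sub_nonneg.2 (bendDepth_sq_le hv y)) ?_
  have h1 := bendDepth_add_le (L := L) hvw.le y
  have h2 := bendDepth_le_half L v y
  have h3 := bendDepth_le_half L w y
  have h4 := bendDepth_nonneg (L := L) hv y
  have h5 := bendDepth_nonneg (L := L) (hv.trans hvw.le) y
  nlinarith [mul_nonneg (sub_nonneg.2 h1) (add_nonneg h4 h5),
    mul_nonneg (sub_pos.2 hvw).le (sub_nonneg.2 (add_le_add h2 h3)),
    mul_pos (sub_pos.2 hvw) (add_pos_of_nonneg_of_pos hv (hv.trans_lt hvw))]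

theorem bendRadius_zero (L y : ℝ) : bendRadius L 0 y = 0 := by
  have h1 := bendRadius_sq (L := L) le_rfl y
  have h2 := bendDepth_sq_le (L := L) le_rfl y
  have h3 : 0 ≤ bendRadius L 0 y := Real.sqrt_nonneg _
  nlinarith [sq_nonneg (bendDepth L 0 y)]

theorem abs_bendRadius_sub_le {L v : ℝ} (hv : 0 ≤ v) (y : ℝ) :
    v - 1 / 4 ≤ bendRadius L v y ∧ bendRadius L v y ≤ v := by
  have h1 := bendRadius_sq (L := L) hv y
  have h2 := bendDepth_nonneg (L := L) hv y
  have h3 : 0 ≤ bendRadius L v y := Real.sqrt_nonneg _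
  have h4 := bendDepth_le_half L v y
  have h5 := bendDepth_le_quarter L v y
  constructor
  · have : v - bendDepth L v y ≤ bendRadius L v y := by
      refine le_of_sq_le_sq ?_ h3
      nlinarith
    linarith
  · exact le_of_sq_le_sq (by nlinarith) hv

theorem continuous_bendRadius {T : Type*} [TopologicalSpace T] (L : ℝ) {v y : T → ℝ}
    (hv : Continuous v) (hy : Continuous y) : Continuous fun t => bendRadius L (v t) (y t) := by
  unfold bendRadius bendDepth; fun_prop

theorem continuous_bend (c L : ℝ) : Continuous fun q : ℝ × ℝ => bend c L q.1 q.2 := by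
  unfold bend
  exact continuous_const.add ((continuous_bendRadius L (by fun_prop) continuous_snd).sub
    (continuous_bendRadius L (by fun_prop) continuous_snd))

theorem bend_of_le {c L x : ℝ} (h : c ≤ x) (y : ℝ) : bend c L x y = c + bendRadius L (x - c) y := by
  unfold bend
  rw [max_eq_left (by linarith), max_eq_right (by linarith), bendRadius_zero, sub_zero]

theorem bend_of_ge {c L x : ℝ} (h : x ≤ c) (y : ℝ) : bend c L x y = c - bendRadius L (c - x) y := by
  unfold bend
  rw [max_eq_right (by linarith), max_eq_left (by linarith), bendRadius_zero]; ring

theorem strictMono_bend (c L y : ℝ) : StrictMono fun x => bend c L x y := by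
  intro x x' h
  have nn : ∀ v, 0 ≤ bendRadius L v y := fun v => Real.sqrt_nonneg _
  simp only
  rcases le_total c x with h1 | h1
  · rw [bend_of_le h1, bend_of_le (h1.trans h.le)]
    have := bendRadius_lt (L := L) (sub_nonneg.2 h1) (sub_lt_sub_right h c) y
    linarith
  rcases le_total c x' with h2 | h2
  · rw [bend_of_ge h1, bend_of_le h2]
    rcases h1.lt_or_eq with h3 | h3
    · have := bendRadius_lt (L := L) le_rfl (sub_pos.2 h3) y
      rw [bendRadius_zero] at this
      have := nn (x' - c)
      linarith
    · have := bendRadius_lt (L := L) le_rfl (show 0 < x' - c by linarith) y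
      rw [bendRadius_zero] at this
      have := nn (c - x)
      rw [h3, sub_self, bendRadius_zero]; linarith
  · rw [bend_of_ge h1, bend_of_ge h2]
    have := bendRadius_lt (L := L) (sub_nonneg.2 h2) (sub_lt_sub_left h c) y
    linarith

theorem abs_bend_sub_le (c L x y : ℝ) : |bend c L x y - x| ≤ 1 / 4 := by
  rw [abs_le]
  rcases le_total c x with h1 | h1
  · rw [bend_of_le h1]
    have := abs_bendRadius_sub_le (L := L) (sub_nonneg.2 h1) y
    constructor <;> linarith
  · rw [bend_of_ge h1]
    have := abs_bendRadius_sub_le (L := L) (sub_nonneg.2 h1) y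
    constructor <;> linarith

theorem bend_sub_sq (c L x y : ℝ) :
    (bend c L x y - c) ^ 2 = |x - c| ^ 2 - bendDepth L |x - c| y ^ 2 := by
  rcases le_total c x with h1 | h1
  · rw [bend_of_le h1, add_sub_cancel_left, abs_of_nonneg (sub_nonneg.2 h1),
      bendRadius_sq (sub_nonneg.2 h1)]
  · rw [bend_of_ge h1, abs_sub_comm, abs_of_nonneg (sub_nonneg.2 h1), sub_sub_cancel_left, neg_sq,
      bendRadius_sq (sub_nonneg.2 h1)]

theorem bend_of_far {c L x : ℝ} (h : L ≤ |x - c|) (hL : 0 ≤ L) (y : ℝ) : bend c L x y = x := by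
  have h0 : ∀ v, L ≤ v → bendRadius L v y = v := by
    intro v hv
    have : bendDepth L v y = 0 := le_antisymm
      ((min_le_right _ _).trans ((min_le_right _ _).trans (max_le (by linarith) le_rfl)))
      (bendDepth_nonneg (hL.trans hv) y)
    unfold bendRadius
    rw [this]
    simp [Real.sqrt_sq (hL.trans hv)]
  rcases le_total c x with h1 | h1
  · rw [abs_of_nonneg (by linarith)] at h
    rw [bend_of_le h1, h0 _ h]; ring
  · rw [abs_sub_comm, abs_of_nonneg (by linarith)] at h
    rw [bend_of_ge h1, h0 _ h]; ring

theorem bend_zero (c L x : ℝ) : bend c L x 0 = x := by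
  have h0 : ∀ v, 0 ≤ v → bendRadius L v 0 = v := by
    intro v hv
    have : bendDepth L v 0 = 0 := le_antisymm
      ((bendDepth_le_abs L v 0).trans (by simp)) (bendDepth_nonneg hv 0)
    unfold bendRadius
    rw [this]
    simp [Real.sqrt_sq hv]
  rcases le_total c x with h1 | h1
  · rw [bend_of_le h1, h0 _ (by linarith)]; ring
  · rw [bend_of_ge h1, h0 _ (by linarith)]; ring

/-- The horizontal map that sends the arcs of circles centered at the origin to vertical segments,
near the part of the axis to the right of `ν`; it fixes all points to the left of `ν`. -/
def straighten (ν x y : ℝ) : ℝ :=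
  x + (√(x ^ 2 + min (min |y| (1 / 4)) (max (x - ν) 0) ^ 2) - |x|)

theorem continuous_straighten (ν : ℝ) : Continuous fun q : ℝ × ℝ => straighten ν q.1 q.2 := by
  unfold straighten; fun_prop

theorem straighten_of_le {ν x : ℝ} (h : x ≤ ν) (y : ℝ) : straighten ν x y = x := by
  unfold straighten
  rw [max_eq_right (by linarith : x - ν ≤ 0), min_eq_right (le_min (abs_nonneg _) (by norm_num))]
  simp [Real.sqrt_sq_eq_abs]

theorem straighten_of_ge {ν x : ℝ} (hν : 0 ≤ ν) (h : ν ≤ x) (y : ℝ) :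
    straighten ν x y = √(x ^ 2 + min (min |y| (1 / 4)) (x - ν) ^ 2) := by
  unfold straighten
  rw [max_eq_left (by linarith : 0 ≤ x - ν), abs_of_nonneg (hν.trans h)]
  ring

theorem le_straighten (ν x y : ℝ) : x ≤ straighten ν x y := by
  unfold straighten
  have : |x| ≤ √(x ^ 2 + min (min |y| (1 / 4)) (max (x - ν) 0) ^ 2) :=
    Real.abs_le_sqrt (by nlinarith [sq_nonneg (min (min |y| (1 / 4)) (max (x - ν) 0))])
  linarith

theorem straighten_le (ν x y : ℝ) : straighten ν x y ≤ x + 1 / 4 := by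
  unfold straighten
  have h0 : 0 ≤ min (min |y| (1 / 4)) (max (x - ν) 0) :=
    le_min (le_min (abs_nonneg _) (by norm_num)) (le_max_right _ _)
  have h1 : min (min |y| (1 / 4)) (max (x - ν) 0) ≤ 1 / 4 :=
    (min_le_left _ _).trans (min_le_right _ _)
  have : √(x ^ 2 + min (min |y| (1 / 4)) (max (x - ν) 0) ^ 2) ≤ |x| + 1 / 4 := by
    refine Real.sqrt_le_iff.2 ⟨by positivity, ?_⟩
    nlinarith [abs_nonneg x, sq_abs x]
  linarith

theorem strictMono_straighten {ν : ℝ} (hν : 0 ≤ ν) (y : ℝ) :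
    StrictMono fun x => straighten ν x y := by
  intro x x' h
  simp only
  rcases le_total x ν with h1 | h1
  · rw [straighten_of_le h1]
    exact h.trans_le (le_straighten ν x' y)
  · rw [straighten_of_ge hν h1, straighten_of_ge hν (h1.trans h.le)]
    refine Real.sqrt_lt_sqrt (by positivity) (add_lt_add_of_lt_of_le ?_ ?_)
    · nlinarith
    · exact pow_le_pow_left₀ (le_min (le_min (abs_nonneg _) (by norm_num)) (by linarith))
        (min_le_min le_rfl (by linarith)) 2

theorem straighten_zero (ν x : ℝ) : straighten ν x 0 = x := by
  unfold straighten
  rw [abs_zero, min_eq_left (by norm_num : (0 : ℝ) ≤ 1 / 4), min_eq_left (le_max_right _ _)]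
  simp [Real.sqrt_sq_eq_abs]

/-- `arcMap c L ν` sends arcs of circles centered at the origin, near the part of the axis to the
right of `ν`, to arcs with the same end on the axis of circles centered at `c`. -/
def arcMap (c L ν x y : ℝ) : ℝ := bend c L (straighten ν x y) y

theorem continuous_arcMap (c L ν : ℝ) : Continuous fun q : ℝ × ℝ => arcMap c L ν q.1 q.2 :=
  (continuous_bend c L).comp ((continuous_straighten ν).prodMk continuous_snd)

theorem strictMono_arcMap {ν : ℝ} (hν : 0 ≤ ν) (c L y : ℝ) : StrictMono fun x => arcMap c L ν x y :=
  (strictMono_bend c L y).comp (strictMono_straighten hν y)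

theorem abs_arcMap_sub_le (c L ν x y : ℝ) : |arcMap c L ν x y - x| ≤ 1 / 2 := by
  have h1 := abs_le.1 (abs_bend_sub_le c L (straighten ν x y) y)
  have h2 := le_straighten ν x y
  have h3 := straighten_le ν x y
  rw [abs_le]
  unfold arcMap
  constructor <;> linarith

theorem arcMap_zero (c L ν x : ℝ) : arcMap c L ν x 0 = x := by
  rw [arcMap, straighten_zero, bend_zero]

/-- The distance from the image of `(x, y)` under `arcMap c L ν` to `c`. -/
def arcDist (c L ν x y : ℝ) : ℝ := √((arcMap c L ν x y - c) ^ 2 + y ^ 2)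

theorem norm_mk_sub (x y c : ℝ) : ‖(⟨x, y⟩ : ℂ) - c‖ = √((x - c) ^ 2 + y ^ 2) := by
  rw [Complex.norm_def, Complex.normSq_apply]
  congr 1
  simp; ring

theorem arcDist_sq (c L ν x y : ℝ) : arcDist c L ν x y ^ 2 =
    |straighten ν x y - c| ^ 2 - bendDepth L |straighten ν x y - c| y ^ 2 + y ^ 2 := by
  unfold arcDist
  rw [Real.sq_sqrt (by positivity), arcMap, bend_sub_sq]

theorem abs_straighten_sub_le_arcDist (c L ν x y : ℝ) :
    |straighten ν x y - c| ≤ arcDist c L ν x y := by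
  refine le_of_sq_le_sq ?_ (Real.sqrt_nonneg _)
  rw [arcDist_sq]
  have h1 := bendDepth_le_abs L |straighten ν x y - c| y
  have h2 := bendDepth_nonneg (L := L) (abs_nonneg (straighten ν x y - c)) y
  nlinarith [sq_abs y]

/-- Close to the axis, `arcMap` matches radii exactly, apart from the center of the circles, which
is its own degenerate circle. -/
theorem arcDist_mem_snailRadii {m : ℕ} {L : ℝ} (hL : 2 * L = m) {c ν x y : ℝ} (hy : |y| ≤ 1 / 8) :
    arcDist c L ν x y ∈ snailRadii m ↔
      |straighten ν x y - c| ∈ snailRadii m ∧ (straighten ν x y = c → y = 0) := by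
  have h0 := arcDist_sq c L ν x y
  have hle := abs_straighten_sub_le_arcDist c L ν x y
  set d := arcDist c L ν x y
  set v := |straighten ν x y - c| with hv
  have hv0 : 0 ≤ v := abs_nonneg _
  have hd0 : 0 ≤ d := Real.sqrt_nonneg _
  have hvc : straighten ν x y = c ↔ v = 0 := by rw [hv, abs_eq_zero, sub_eq_zero]
  rw [hvc]
  have e0 := bendDepth_nonneg (L := L) hv0 y
  have e1 := bendDepth_le_half L v y
  rcases lt_or_ge v (1 / 4) with h1 | h1
  · have hd : d < 1 / 2 := by
      refine lt_of_pow_lt_pow_left₀ 2 (by norm_num) ?_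
      rw [h0]
      nlinarith [sq_abs y, abs_nonneg y, sq_nonneg (bendDepth L v y)]
    constructor
    · intro h
      have hz := eq_zero_of_mem_snailRadii h hd
      rw [hz] at h0
      have hvz : v = 0 := by nlinarith [sq_nonneg y]
      rw [hz] at h
      refine ⟨by rwa [hvz], fun _ => ?_⟩
      rw [hvz] at e1 h0
      have : bendDepth L 0 y = 0 := by rw [hvz] at e0; linarith
      rw [this] at h0
      nlinarith
    · rintro ⟨h, hy0⟩
      have hvz := eq_zero_of_mem_snailRadii h (by linarith)
      rw [hy0 hvz, hvz] at h0
      have : bendDepth L 0 0 = 0 := by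
        have := bendDepth_le_half L 0 0
        have := bendDepth_nonneg (L := L) le_rfl 0
        linarith
      rw [this] at h0
      have : d = 0 := by nlinarith
      rw [this, ← hvz]; exact h
  rcases le_or_gt v (L - 1 / 8) with h2 | h2
  · have : bendDepth L v y = |y| := by
      unfold bendDepth
      rw [min_eq_left (by linarith : |y| ≤ 1 / 4), min_eq_left]
      exact le_min (by linarith) (le_max_of_le_left (by linarith))
    rw [this, sq_abs y] at h0
    have : d = v := by
      rw [← abs_of_nonneg hd0, ← abs_of_nonneg hv0, ← sq_eq_sq_iff_abs_eq_abs]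
      linarith
    rw [this]
    exact ⟨fun h => ⟨h, fun h' => by linarith⟩, fun h => h.1⟩
  · constructor
    · intro h
      have := le_of_mem_snailRadii h
      linarith
    · rintro ⟨h, -⟩
      have := le_of_mem_snailRadii h
      linarith

/-- Near the axis `straighten` recovers the distance to the origin, except close to the gap around
`ν`. -/
theorem straighten_eq_or {ν x y : ℝ} (hν : 1 / 2 ≤ ν) (hx : 0 < x) (hy : |y| ≤ 1 / 8)
    (hr : ν - 1 / 4 ≤ √(x ^ 2 + y ^ 2)) :
    straighten ν x y = √(x ^ 2 + y ^ 2) ∨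
      (ν - 1 / 2 < straighten ν x y ∧ straighten ν x y < ν + 1 / 2 ∧
        √(x ^ 2 + y ^ 2) < ν + 1 / 2) := by
  rcases le_or_gt |y| (x - ν) with h | h
  · left
    have : ν ≤ x := by linarith [abs_nonneg y]
    rw [straighten_of_ge (by linarith) this, min_eq_left (by linarith : |y| ≤ 1 / 4),
      min_eq_left h, sq_abs]
  · right
    have h1 : √(x ^ 2 + y ^ 2) ≤ x + |y| := by
      refine Real.sqrt_le_iff.2 ⟨by positivity, ?_⟩
      nlinarith [sq_abs y, abs_nonneg y]
    have h2 := le_straighten ν x y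
    have h3 : straighten ν x y < ν + 1 / 2 := by
      linarith [straighten_le ν x y]
    refine ⟨by linarith, h3, by linarith⟩

section Radii

variable {n p : ℕ} {ν μ : ℝ}

/-- No half-circle of the target centered at the origin has a radius within `1/2` of `ν`. -/
theorem not_mem_of_gap (hν : 2 * ν = n) {r : ℝ} (h1 : ν - 1 / 2 < r) (h2 : r < ν + 1 / 2) :
    r ∉ snailRadii (n + p + p) := by
  intro h
  obtain ⟨j, -, hodd, hj⟩ := mem_snailRadii.1 h
  have h3 : (n : ℝ) - 1 < j := by linarith
  have h4 : (j : ℝ) < n + 1 := by linarith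
  have h3' : n < j + 1 := by exact_mod_cast (by linarith : (n : ℝ) < j + 1)
  have h4' : j < n + 1 := by exact_mod_cast h4
  obtain ⟨s, hs⟩ := hodd
  omega

theorem top_radius_iff (hν : 2 * ν = n) (hμ : 2 * μ = p) {r : ℝ} (hr : ν - 1 / 2 < r)
    (hr0 : 0 ≤ r) : |r - μ| ∈ snailRadii (n + p) ↔ r ∈ snailRadii (n + p + p) := by
  rw [abs_mem_snailRadii, mem_snailRadii]
  constructor
  · rintro ⟨k, h1, ⟨s, hs⟩, h3⟩
    rw [abs_lt] at h1
    have h4 : 2 * r = ((k + p : ℤ) : ℝ) := by push_cast; linarith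
    have h5 : 0 ≤ k + p := by
      have : (0 : ℝ) ≤ ((k + p : ℤ) : ℝ) := by linarith
      exact_mod_cast this
    refine ⟨(k + p).toNat, by omega, ⟨(s + p).toNat, by omega⟩, ?_⟩
    rw [h4]
    exact_mod_cast (Int.toNat_of_nonneg h5).symm
  · rintro ⟨j, h1, ⟨s, hs⟩, h3⟩
    refine ⟨j - p, ?_, ⟨s - p, by omega⟩, by push_cast; linarith⟩
    have h4 : (n : ℝ) - 1 < j := by linarith
    have h5 : n < j + 1 := by exact_mod_cast (by linarith : (n : ℝ) < j + 1)
    rw [abs_lt]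
    omega

theorem low_radius_iff (hν : 2 * ν = n) (hμ : 2 * μ = p) {r : ℝ} (hr : ν - 1 / 2 < r)
    (hr0 : 0 ≤ r) : |r - (ν + μ)| ∈ snailRadii p ↔ r ∈ snailRadii (n + p + p) := by
  rw [abs_mem_snailRadii, mem_snailRadii]
  constructor
  · rintro ⟨k, h1, ⟨s, hs⟩, h3⟩
    rw [abs_lt] at h1
    have h4 : 2 * r = ((k + n + p : ℤ) : ℝ) := by push_cast; linarith
    have h5 : 0 ≤ k + n + p := by
      have : (0 : ℝ) ≤ ((k + n + p : ℤ) : ℝ) := by linarith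
      exact_mod_cast this
    refine ⟨(k + n + p).toNat, by omega, ⟨(s + n + p).toNat, by omega⟩, ?_⟩
    rw [h4]
    exact_mod_cast (Int.toNat_of_nonneg h5).symm
  · rintro ⟨j, h1, ⟨s, hs⟩, h3⟩
    refine ⟨j - n - p, ?_, ⟨s - n - p, by omega⟩, by push_cast; linarith⟩
    have h4 : (n : ℝ) - 1 < j := by linarith
    have h5 : n < j + 1 := by exact_mod_cast (by linarith : (n : ℝ) < j + 1)
    rw [abs_lt]
    omega

theorem left_radius_iff (hν : 2 * ν = n) {r : ℝ} (hr : r < ν) :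
    r ∈ snailRadii n ↔ r ∈ snailRadii (n + p + p) := by
  rw [mem_snailRadii, mem_snailRadii]
  constructor
  · rintro ⟨j, h1, ⟨s, hs⟩, h3⟩
    exact ⟨j, by omega, ⟨s + p, by omega⟩, h3⟩
  · rintro ⟨j, h1, ⟨s, hs⟩, h3⟩
    have h4 : (j : ℝ) < n := by linarith
    exact ⟨j, by exact_mod_cast h4, ⟨s - p, by
      have : j < n := by exact_mod_cast h4
      omega⟩, h3⟩

/-- The top half-circles of `SN(n;p)` near the axis, in straightened position. -/
theorem top_collar (hν : 2 * ν = n) (hμ : 2 * μ = p) (hn : 0 < n) {x y : ℝ}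
    (hx : 0 < x) (hy : |y| ≤ 1 / 8) (hr : ν - 1 / 4 ≤ √(x ^ 2 + y ^ 2)) :
    arcDist μ (ν + μ) ν x y ∈ snailRadii (n + p) ↔
      √(x ^ 2 + y ^ 2) ∈ snailRadii (n + p + p) ∧ (√(x ^ 2 + y ^ 2) = μ → y = 0) := by
  have hn' : (1 : ℝ) ≤ n := by exact_mod_cast hn
  have hr0 := Real.sqrt_nonneg (x ^ 2 + y ^ 2)
  rw [arcDist_mem_snailRadii (by push_cast; linarith) hy]
  rcases straighten_eq_or (by linarith) hx hy hr with h | ⟨h1, h2, h3⟩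
  · rw [h, top_radius_iff hν hμ (by linarith) hr0]
  · rw [top_radius_iff hν hμ h1 (by linarith [le_straighten ν x y])]
    exact ⟨fun h => absurd h.1 (not_mem_of_gap hν h1 h2),
      fun h => absurd h.1 (not_mem_of_gap hν (by linarith) h3)⟩

/-- The bottom right half-circles of `SN(n;p)` near the axis, in straightened position. -/
theorem low_collar (hν : 2 * ν = n) (hμ : 2 * μ = p) (hn : 0 < n) {x y : ℝ}
    (hx : 0 < x) (hy : |y| ≤ 1 / 8) (hr : ν - 1 / 4 ≤ √(x ^ 2 + y ^ 2)) :
    arcDist (ν + μ) μ ν x y ∈ snailRadii p ↔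
      √(x ^ 2 + y ^ 2) ∈ snailRadii (n + p + p) ∧ (√(x ^ 2 + y ^ 2) = ν + μ → y = 0) := by
  have hn' : (1 : ℝ) ≤ n := by exact_mod_cast hn
  have hr0 := Real.sqrt_nonneg (x ^ 2 + y ^ 2)
  rw [arcDist_mem_snailRadii hμ hy]
  rcases straighten_eq_or (by linarith) hx hy hr with h | ⟨h1, h2, h3⟩
  · rw [h, low_radius_iff hν hμ (by linarith) hr0]
  · rw [low_radius_iff hν hμ h1 (by linarith [le_straighten ν x y])]
    exact ⟨fun h => absurd h.1 (not_mem_of_gap hν h1 h2),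
      fun h => absurd h.1 (not_mem_of_gap hν (by linarith) h3)⟩

/-- The top half-circles lie to the right of the abscissa `-(ν - 1/4)`. -/
theorem top_far (hν : 2 * ν = n) (hμ : 2 * μ = p) (hn : 0 < n) {x : ℝ}
    (hx : x ≤ -(ν - 1 / 4)) (y : ℝ) : arcDist μ (ν + μ) ν x y ∉ snailRadii (n + p) := by
  intro h
  have hn' : (1 : ℝ) ≤ n := by exact_mod_cast hn
  have h1 := (le_of_mem_snailRadii h).2
  have h2 := abs_straighten_sub_le_arcDist μ (ν + μ) ν x y
  rw [straighten_of_le (by linarith)] at h2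
  have h3 := neg_abs_le (x - μ)
  push_cast at h1
  linarith

/-- The bottom right half-circles lie to the right of the abscissa `ν + 1/4`. -/
theorem low_far (hν : 2 * ν = n) (hμ : 2 * μ = p) (hn : 0 < n) {x : ℝ}
    (hx : x ≤ ν + 1 / 4) (y : ℝ) : arcDist (ν + μ) μ ν x y ∉ snailRadii p := by
  intro h
  have hn' : (1 : ℝ) ≤ n := by exact_mod_cast hn
  have h1 := (le_of_mem_snailRadii h).2
  have h2 := abs_straighten_sub_le_arcDist (ν + μ) μ ν x y
  have h3 := neg_abs_le (straighten ν x y - (ν + μ))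
  have h4 : straighten ν x y < ν + 1 / 2 := by
    rcases le_total x ν with h | h
    · rw [straighten_of_le h]; linarith
    · rw [straighten_of_ge (by linarith) h]
      refine (Real.sqrt_lt' (by linarith)).2 ?_
      have h5 : min (min |y| (1 / 4)) (x - ν) ≤ 1 / 4 := (min_le_left _ _).trans (min_le_right _ _)
      have h6 : 0 ≤ min (min |y| (1 / 4)) (x - ν) :=
        le_min (le_min (abs_nonneg _) (by norm_num)) (by linarith)
      nlinarith
  linarith

end Radii

end

noncomputable section

/-! ### The half-twist -/

/-- The nearest point of `[0,1]`. -/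
def unitClamp (x : ℝ) : ℝ := max 0 (min 1 x)

theorem unitClamp_nonneg (x : ℝ) : 0 ≤ unitClamp x := le_max_left _ _

theorem unitClamp_le_one (x : ℝ) : unitClamp x ≤ 1 := max_le zero_le_one (min_le_left _ _)

theorem unitClamp_of_le {x : ℝ} (h : x ≤ 0) : unitClamp x = 0 :=
  max_eq_left ((min_le_right _ _).trans h)

theorem unitClamp_of_ge {x : ℝ} (h : 1 ≤ x) : unitClamp x = 1 := by
  unfold unitClamp; rw [min_eq_left h]; norm_num

theorem unitClamp_of_mem {x : ℝ} (h0 : 0 ≤ x) (h1 : x ≤ 1) : unitClamp x = x := by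
  unfold unitClamp; rw [min_eq_right h1, max_eq_right h0]

theorem unitClamp_mono {x y : ℝ} (h : x ≤ y) : unitClamp x ≤ unitClamp y :=
  max_le_max le_rfl (min_le_min le_rfl h)

theorem unitClamp_add_le {x d : ℝ} (hd : 0 ≤ d) : unitClamp (x + d) ≤ unitClamp x + d := by
  unfold unitClamp
  refine max_le (by positivity) ?_
  rcases le_total 1 x with h | h
  · rw [min_eq_left h, min_eq_left (by linarith)]
    have : (1 : ℝ) ≤ max 0 1 := le_max_right _ _
    linarith
  · have h1 : min 1 x = x := min_eq_right h
    rw [h1]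
    have := le_max_right 0 x
    have := min_le_right 1 (x + d)
    linarith

/-- The angle, from the negative imaginary axis, of the point of abscissa `a` on the lower half of
the circle of radius `r`; the right end of that half if there is no such point. -/
def abscissaAngle (a r : ℝ) : ℝ := Real.arcsin (a / r)

/-- The part of the twist function that decreases from `1` to `0` along the lower half of each
circle, between the vertical lines of abscissas `-(ν - 1/4)` and `ν + 1/4`. -/
def twistDrop (ν r ψ : ℝ) : ℝ :=
  unitClamp ((abscissaAngle (ν + 1 / 4) r - ψ) /
    (Real.pi + abscissaAngle (ν + 1 / 4) r - abscissaAngle (ν - 1 / 4) r))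

/-- The part of the twist function that increases from `0` to `1` when the positive real axis is
crossed upwards. The increase takes place below the axis at distance `μ` from the origin and above
the axis at distance `ν + μ`. -/
def twistRise (ν μ r ψ : ℝ) : ℝ :=
  unitClamp (8 * r * (ψ - Real.pi / 2) + unitClamp ((ν + μ - r) / ν))

/-- The part of the twist function that makes it `1` on the disk of radius `ν - 1/4`. -/
def twistCore (ν r : ℝ) : ℝ := unitClamp (2 * (ν + 1 / 4 - r))

/-- The twist function: the half-twist rotates the point at distance `r` and angle `ψ` by
`π` times its value. -/
def twistFun (ν μ r ψ : ℝ) : ℝ := max (max (twistDrop ν r ψ) (twistRise ν μ r ψ)) (twistCore ν r)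

section Angles

variable {ν μ r ψ : ℝ}

theorem abscissaAngle_le (a r : ℝ) : abscissaAngle a r ≤ Real.pi / 2 := Real.arcsin_le_pi_div_two _

theorem abscissaAngle_nonneg {a r : ℝ} (ha : 0 ≤ a) (hr : 0 < r) : 0 ≤ abscissaAngle a r :=
  Real.arcsin_nonneg.2 (by positivity)

theorem mul_sin_abscissaAngle {a r : ℝ} (ha : 0 ≤ a) (hr : 0 < r) :
    r * Real.sin (abscissaAngle a r) = min r a := by
  unfold abscissaAngle
  rcases le_total r a with h | h
  · rw [Real.arcsin_of_one_le ((one_le_div hr).2 h), Real.sin_pi_div_two, mul_one, min_eq_left h]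
  · rw [Real.sin_arcsin (by have : 0 ≤ a / r := by positivity
                            linarith) ((div_le_one hr).2 h), mul_div_cancel₀ _ hr.ne',
      min_eq_right h]

theorem le_mul_sin {a : ℝ} (ha : 0 ≤ a) (hr : 0 < r) (har : a ≤ r) (h1 : abscissaAngle a r ≤ ψ)
    (h2 : ψ ≤ Real.pi / 2) : a ≤ r * Real.sin ψ := by
  have h := mul_sin_abscissaAngle ha hr
  rw [min_eq_right har] at h
  rw [← h]
  exact mul_le_mul_of_nonneg_left (Real.sin_le_sin_of_le_of_le_pi_div_two
    (by have := abscissaAngle_nonneg ha hr; have := Real.pi_pos; linarith) h2 h1) hr.le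

theorem mul_sin_le {a : ℝ} (ha : 0 ≤ a) (hr : 0 < r) (h1 : ψ ≤ abscissaAngle a r)
    (h2 : -(Real.pi / 2) ≤ ψ) : r * Real.sin ψ ≤ a := by
  have h := mul_sin_abscissaAngle ha hr
  refine le_trans ?_ (min_le_right r a)
  rw [← h]
  exact mul_le_mul_of_nonneg_left
    (Real.sin_le_sin_of_le_of_le_pi_div_two h2 (abscissaAngle_le a r) h1) hr.le

theorem drop_width_ge (hr : 0 < r) :
    Real.pi ≤ Real.pi + abscissaAngle (ν + 1 / 4) r - abscissaAngle (ν - 1 / 4) r := by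
  have : abscissaAngle (ν - 1 / 4) r ≤ abscissaAngle (ν + 1 / 4) r :=
    Real.monotone_arcsin (div_le_div_of_nonneg_right (by linarith) hr.le)
  linarith

theorem drop_width_gt (hν : 1 / 2 ≤ ν) (hr : ν - 1 / 4 < r) :
    Real.pi < Real.pi + abscissaAngle (ν + 1 / 4) r - abscissaAngle (ν - 1 / 4) r := by
  have hr0 : 0 < r := by linarith
  have h1 : (ν - 1 / 4) / r < 1 := (div_lt_one hr0).2 hr
  have h2 : (0 : ℝ) < (ν - 1 / 4) / r := div_pos (by linarith) hr0
  have : abscissaAngle (ν - 1 / 4) r < abscissaAngle (ν + 1 / 4) r := by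
    unfold abscissaAngle
    rcases le_total 1 ((ν + 1 / 4) / r) with h | h
    · rw [Real.arcsin_of_one_le h]
      exact Real.arcsin_lt_pi_div_two.2 h1
    · exact Real.strictMonoOn_arcsin ⟨by linarith, h1.le⟩
        ⟨by have : 0 ≤ (ν + 1 / 4) / r := by positivity
            linarith, h⟩ (div_lt_div_of_pos_right (by linarith) hr0)
  linarith

theorem twistFun_nonneg (ν μ r ψ : ℝ) : 0 ≤ twistFun ν μ r ψ :=
  (unitClamp_nonneg _).trans (le_max_right _ _)

theorem twistFun_le_one (ν μ r ψ : ℝ) : twistFun ν μ r ψ ≤ 1 :=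
  max_le (max_le (unitClamp_le_one _) (unitClamp_le_one _)) (unitClamp_le_one _)

theorem twistFun_core (h : r ≤ ν - 1 / 4) : twistFun ν μ r ψ = 1 :=
  le_antisymm (twistFun_le_one _ _ _ _) (by
    refine le_trans ?_ (le_max_right _ _)
    rw [twistCore, unitClamp_of_ge (by linarith)])

theorem twistDrop_eq_one (hr : 0 < r) (h : ψ ≤ -Real.pi + abscissaAngle (ν - 1 / 4) r) :
    twistDrop ν r ψ = 1 := by
  have := drop_width_ge (ν := ν) hr
  have := Real.pi_pos
  rw [twistDrop, unitClamp_of_ge]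
  rw [le_div_iff₀ (by linarith)]
  linarith

theorem twistDrop_eq_zero (hr : 0 < r) (h : abscissaAngle (ν + 1 / 4) r ≤ ψ) :
    twistDrop ν r ψ = 0 := by
  have := drop_width_ge (ν := ν) hr
  have := Real.pi_pos
  rw [twistDrop, unitClamp_of_le]
  exact div_nonpos_of_nonpos_of_nonneg (by linarith) (by linarith)

theorem twistFun_of_drop (h : twistDrop ν r ψ = 1) : twistFun ν μ r ψ = 1 :=
  le_antisymm (twistFun_le_one _ _ _ _)
    (h.ge.trans ((le_max_left _ _).trans (le_max_left _ _)))

theorem twistFun_of_rise (h : twistRise ν μ r ψ = 1) : twistFun ν μ r ψ = 1 :=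
  le_antisymm (twistFun_le_one _ _ _ _)
    (h.ge.trans ((le_max_right _ _).trans (le_max_left _ _)))

theorem twistRise_eq_one (h : 1 ≤ 8 * r * (ψ - Real.pi / 2)) : twistRise ν μ r ψ = 1 :=
  unitClamp_of_ge (by have := unitClamp_nonneg ((ν + μ - r) / ν); linarith)

theorem twistFun_pi (hν : 1 / 2 ≤ ν) : twistFun ν μ r Real.pi = 1 := by
  rcases le_or_gt r (ν - 1 / 4) with h | h
  · exact twistFun_core h
  · refine twistFun_of_rise (twistRise_eq_one ?_)
    nlinarith [Real.pi_gt_three]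

theorem twistFun_neg_pi (hν : 1 / 2 ≤ ν) (hr : 0 < r) : twistFun ν μ r (-Real.pi) = 1 :=
  twistFun_of_drop (twistDrop_eq_one hr (by
    have := abscissaAngle_nonneg (show 0 ≤ ν - 1 / 4 by linarith) hr
    linarith))

/-- The angular map of the half-twist is increasing at all times: the twist function decreases by
one over an arc of angle larger than `π`. -/
theorem strictMono_twist (hν : 1 / 2 ≤ ν) {t : ℝ} (ht0 : 0 ≤ t) (ht1 : t ≤ 1)
    (hr : 0 < r) : StrictMono fun ψ => ψ + t * (Real.pi * twistFun ν μ r ψ) := by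
  intro ψ ψ' h
  simp only
  rcases le_or_gt r (ν - 1 / 4) with h1 | h1
  · rw [twistFun_core h1, twistFun_core h1]; linarith
  set w := Real.pi + abscissaAngle (ν + 1 / 4) r - abscissaAngle (ν - 1 / 4) r with hw
  have hwpi : Real.pi < w := drop_width_gt hν h1
  have hpi := Real.pi_pos
  have hw0 : 0 < w := hpi.trans hwpi
  have hd : 0 ≤ (ψ' - ψ) / w := div_nonneg (by linarith) hw0.le
  have key : twistFun ν μ r ψ ≤ twistFun ν μ r ψ' + (ψ' - ψ) / w := by
    have a1 : twistDrop ν r ψ ≤ twistFun ν μ r ψ' + (ψ' - ψ) / w := by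
      have : twistDrop ν r ψ ≤ twistDrop ν r ψ' + (ψ' - ψ) / w := by
        unfold twistDrop
        rw [← hw]
        have e : (abscissaAngle (ν + 1 / 4) r - ψ) / w =
          (abscissaAngle (ν + 1 / 4) r - ψ') / w + (ψ' - ψ) / w := by
          field_simp; ring
        rw [e]
        exact unitClamp_add_le hd
      have : twistDrop ν r ψ' ≤ twistFun ν μ r ψ' := (le_max_left _ _).trans (le_max_left _ _)
      linarith
    have a2 : twistRise ν μ r ψ ≤ twistFun ν μ r ψ' + (ψ' - ψ) / w := by
      have : twistRise ν μ r ψ ≤ twistRise ν μ r ψ' := unitClamp_mono (by nlinarith)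
      have : twistRise ν μ r ψ' ≤ twistFun ν μ r ψ' := (le_max_right _ _).trans (le_max_left _ _)
      linarith
    have a3 : twistCore ν r ≤ twistFun ν μ r ψ' + (ψ' - ψ) / w := by
      have : twistCore ν r ≤ twistFun ν μ r ψ' := le_max_right _ _
      linarith
    exact max_le (max_le a1 a2) a3
  have h2 : t * Real.pi * ((ψ' - ψ) / w) < ψ' - ψ := by
    rw [mul_div_assoc', div_lt_iff₀ hw0]
    have : t * Real.pi < w := by nlinarith
    nlinarith
  have h3 := mul_le_mul_of_nonneg_left key (mul_nonneg ht0 hpi.le)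
  nlinarith

theorem arg_I_mul_bottomPolar (hr : 0 < r) (h1 : -Real.pi < ψ) (h2 : ψ ≤ Real.pi) :
    Complex.arg (Complex.I * bottomPolar r ψ) = ψ := by
  have : Complex.I * bottomPolar r ψ =
      r * (Complex.cos ψ + Complex.sin ψ * Complex.I) := by
    rw [← Complex.ofReal_cos, ← Complex.ofReal_sin]
    apply Complex.ext <;> simp [bottomPolar, -Complex.ofReal_cos, -Complex.ofReal_sin]
  rw [this]
  exact Complex.arg_mul_cos_add_sin_mul_I hr ⟨h1, h2⟩

/-- The rotation angle of the half-twist as a function of the point. -/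
def twistAngle (ν μ : ℝ) (z : ℂ) : ℝ :=
  Real.pi * twistFun ν μ ‖z‖ (Complex.arg (Complex.I * z))

theorem twistAngle_bottomPolar (hν : 1 / 2 ≤ ν) (hr : 0 < r) (h1 : -Real.pi ≤ ψ)
    (h2 : ψ ≤ Real.pi) : twistAngle ν μ (bottomPolar r ψ) = Real.pi * twistFun ν μ r ψ := by
  unfold twistAngle
  rw [norm_bottomPolar hr.le]
  rcases h1.lt_or_eq with h | rfl
  · rw [arg_I_mul_bottomPolar hr h h2]
  · have : bottomPolar r (-Real.pi) = bottomPolar r Real.pi := by simp [bottomPolar]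
    rw [this, arg_I_mul_bottomPolar hr (by linarith [Real.pi_pos]) le_rfl, twistFun_pi hν,
      twistFun_neg_pi hν hr]

theorem twistFun_eq_one_of_top (hν : 1 / 2 ≤ ν) {z : ℂ} (hy : 1 / 8 < z.im) (hx : |z.re| < 1 / 4) :
    twistFun ν μ ‖z‖ (Complex.arg (Complex.I * z)) = 1 := by
  have hz : z ≠ 0 := by rintro rfl; norm_num at hy
  have hr : 0 < ‖z‖ := norm_pos_iff.2 hz
  have hψ := Complex.arg_mem_Ioc (Complex.I * z)
  have hb := bottomPolar_arg z
  set ψ := Complex.arg (Complex.I * z)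
  set r := ‖z‖
  have e1 : z.re = r * Real.sin ψ := by rw [← hb]; rfl
  have e2 : z.im = -(r * Real.cos ψ) := by rw [← hb]; rfl
  have hcos : Real.cos ψ < 0 := by
    by_contra! h
    nlinarith [mul_nonneg hr.le h]
  rcases le_total 0 ψ with h | h
  · refine twistFun_of_rise (twistRise_eq_one ?_)
    have h1 : Real.pi / 2 < ψ := by
      by_contra! h'
      exact hcos.not_ge (Real.cos_nonneg_of_neg_pi_div_two_le_of_le (by linarith [Real.pi_pos]) h')
    have h2 : -Real.cos ψ ≤ ψ - Real.pi / 2 := by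
      have := Real.sin_le (show 0 ≤ ψ - Real.pi / 2 by linarith)
      rwa [Real.sin_sub_pi_div_two] at this
    nlinarith [mul_le_mul_of_nonneg_left h2 hr.le]
  · refine twistFun_of_drop (twistDrop_eq_one hr ?_)
    have h1 : ψ < -(Real.pi / 2) := by
      by_contra! h'
      exact hcos.not_ge (Real.cos_nonneg_of_neg_pi_div_two_le_of_le (by linarith)
        (by linarith [Real.pi_pos]))
    have h2 : ψ + Real.pi = Real.arcsin (-z.re / r) := by
      rw [e1, ← mul_neg, mul_div_cancel_left₀ _ hr.ne', ← Real.sin_add_pi]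
      exact (Real.arcsin_sin (by linarith [hψ.1]) (by linarith)).symm
    have h3 : Real.arcsin (-z.re / r) ≤ abscissaAngle (ν - 1 / 4) r :=
      Real.monotone_arcsin (div_le_div_of_nonneg_right (by linarith [neg_abs_le z.re]) hr.le)
    linarith

theorem continuous_twistAngle (hν : 1 / 2 ≤ ν) : Continuous (twistAngle ν μ) := by
  rw [continuous_iff_continuousAt]
  intro z
  by_cases hs : Complex.I * z ∈ Complex.slitPlane
  · have hz : z ≠ 0 := by
      rintro rfl
      simp [Complex.slitPlane] at hs
    have hr : 0 < ‖z‖ := norm_pos_iff.2 hz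
    have hψ : ContinuousAt (fun w : ℂ => Complex.arg (Complex.I * w)) z :=
      (Complex.continuousAt_arg hs).comp (by fun_prop)
    have hA : ∀ a : ℝ, ContinuousAt (fun w : ℂ => abscissaAngle a ‖w‖) z := fun a =>
      Real.continuous_arcsin.continuousAt.comp
        (continuousAt_const.div continuous_norm.continuousAt hr.ne')
    have hclamp : Continuous unitClamp := by unfold unitClamp; fun_prop
    have hdrop : ContinuousAt (fun w : ℂ => twistDrop ν ‖w‖ (Complex.arg (Complex.I * w))) z := by
      refine hclamp.continuousAt.comp (((hA _).sub hψ).div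
        ((continuousAt_const.add (hA _)).sub (hA _)) ?_)
      have := drop_width_ge (ν := ν) hr
      have := Real.pi_pos
      exact ne_of_gt (by linarith)
    have hrise : ContinuousAt
        (fun w : ℂ => twistRise ν μ ‖w‖ (Complex.arg (Complex.I * w))) z := by
      refine hclamp.continuousAt.comp (ContinuousAt.add ?_ ?_)
      · exact (continuousAt_const.mul continuous_norm.continuousAt).mul
          (hψ.sub continuousAt_const)
      · exact hclamp.continuousAt.comp (by fun_prop)
    have hcore : ContinuousAt (fun w : ℂ => twistCore ν ‖w‖) z :=
      hclamp.continuousAt.comp (by fun_prop)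
    exact continuousAt_const.mul ((hdrop.max hrise).max hcore)
  · -- the branch cut of the angle lies in an open set on which the twist function is `1`
    rw [Complex.mem_slitPlane_iff_not_le_zero, not_not, Complex.le_def] at hs
    simp only [Complex.mul_re, Complex.I_re, zero_mul, Complex.I_im, one_mul, zero_sub,
      Complex.zero_re, Complex.mul_im, Complex.zero_im, zero_add] at hs
    have hone : ∀ᶠ w in nhds z, twistAngle ν μ w = Real.pi * 1 := by
      rcases lt_or_ge (1 / 8) z.im with h | h
      · filter_upwards [(isOpen_lt continuous_const Complex.continuous_im).mem_nhds h,
          (isOpen_lt Complex.continuous_re.abs continuous_const).mem_nhds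
            (show |z.re| < 1 / 4 by rw [hs.2]; norm_num)] with w h1 h2
        rw [twistAngle, twistFun_eq_one_of_top hν h1 h2]
      · have : ‖z‖ < ν - 1 / 4 := by
          have h1 := Complex.norm_le_abs_re_add_abs_im z
          rw [hs.2, abs_zero, zero_add, abs_of_nonneg (by linarith)] at h1
          linarith
        filter_upwards [(isOpen_lt continuous_norm continuous_const).mem_nhds this] with w h1
        rw [twistAngle, twistFun_core (le_of_lt h1)]
    exact ContinuousAt.congr continuousAt_const (Filter.EventuallyEq.symm hone)

/-- The half-twist and its isotopy. -/
theorem exists_halfTwist (hν : 1 / 2 ≤ ν) :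
    ∃ φ : unitInterval → (ℂ ≃ₜ ℂ), IsIsotopyFromId φ ∧ ∀ (t : unitInterval) (z : ℂ),
      φ t z = z * Complex.exp (((t : ℝ) * twistAngle ν μ z : ℝ) * Complex.I) := by
  refine exists_isotopy_twist (twistAngle ν μ) (continuous_twistAngle hν) fun t r hr => ?_
  refine StrictMonoOn.congr ((strictMono_twist (μ := μ) hν t.2.1 t.2.2 hr).strictMonoOn _) ?_
  intro ψ hψ
  simp only
  rw [twistAngle_bottomPolar hν hr hψ.1 hψ.2]

end Angles

end

noncomputable section

/-! ### The half-twist carries one snail to the next -/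

section Step

variable {n p : ℕ} {ν μ r ψ : ℝ}

theorem collar_bounds (hr : 1 / 4 ≤ r) (h : r * |ψ - Real.pi / 2| ≤ 1 / 8) :
    r - 1 / 16 ≤ r * Real.sin ψ ∧ |-(r * Real.cos ψ)| ≤ 1 / 8 := by
  have h0 := abs_nonneg (ψ - Real.pi / 2)
  have h1 := Real.one_sub_sq_div_two_le_cos (x := ψ - Real.pi / 2)
  have h2 := Real.abs_sin_le_abs (x := ψ - Real.pi / 2)
  rw [Real.cos_sub_pi_div_two, ← sq_abs] at h1
  rw [Real.sin_sub_pi_div_two, abs_neg] at h2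
  have h3 : |ψ - Real.pi / 2| ≤ 1 / 2 := by nlinarith
  constructor
  · nlinarith [mul_le_mul h h3 h0 (by norm_num : (0 : ℝ) ≤ 1 / 8)]
  · rw [abs_neg, abs_mul, abs_of_nonneg (by linarith : 0 ≤ r)]
    nlinarith

theorem sqrt_polar (hr : 0 ≤ r) : √((r * Real.sin ψ) ^ 2 + (-(r * Real.cos ψ)) ^ 2) = r := by
  rw [show (r * Real.sin ψ) ^ 2 + (-(r * Real.cos ψ)) ^ 2 = r ^ 2 by
    linear_combination r ^ 2 * Real.sin_sq_add_cos_sq ψ]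
  exact Real.sqrt_sq hr

theorem top_polar (hν : 2 * ν = n) (hμ : 2 * μ = p) (hn : 0 < n) (hr : ν - 1 / 4 ≤ r)
    (h : r * |ψ - Real.pi / 2| ≤ 1 / 8) (hne : r = μ → -(r * Real.cos ψ) = 0) :
    arcDist μ (ν + μ) ν (r * Real.sin ψ) (-(r * Real.cos ψ)) ∈ snailRadii (n + p) ↔
      r ∈ snailRadii (n + p + p) := by
  have hn' : (1 : ℝ) ≤ n := by exact_mod_cast hn
  obtain ⟨h1, h2⟩ := collar_bounds (by linarith) h
  have e : √((r * Real.sin ψ) ^ 2 + (-(r * Real.cos ψ)) ^ 2) = r := sqrt_polar (by linarith)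
  rw [top_collar hν hμ hn (by linarith) h2 (by rw [e]; exact hr), e]
  exact ⟨fun h => h.1, fun h => ⟨h, hne⟩⟩

theorem low_polar (hν : 2 * ν = n) (hμ : 2 * μ = p) (hn : 0 < n) (hr : ν - 1 / 4 ≤ r)
    (h : r * |ψ - Real.pi / 2| ≤ 1 / 8) (hne : r = ν + μ → -(r * Real.cos ψ) = 0) :
    arcDist (ν + μ) μ ν (r * Real.sin ψ) (-(r * Real.cos ψ)) ∈ snailRadii p ↔
      r ∈ snailRadii (n + p + p) := by
  have hn' : (1 : ℝ) ≤ n := by exact_mod_cast hn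
  obtain ⟨h1, h2⟩ := collar_bounds (by linarith) h
  have e : √((r * Real.sin ψ) ^ 2 + (-(r * Real.cos ψ)) ^ 2) = r := sqrt_polar (by linarith)
  rw [low_collar hν hμ hn (by linarith) h2 (by rw [e]; exact hr), e]
  exact ⟨fun h => h.1, fun h => ⟨h, hne⟩⟩

/-- The point `(x, y)` at distance `r` from the origin lies on the snail `SN(n;p)`, translated so
that its left center is the origin and straightened near the axis. -/
def OnSource (n p : ℕ) (ν μ r x y : ℝ) : Prop :=
  (y ≤ 0 ∧ r ∈ snailRadii n) ∨ (y ≤ 0 ∧ arcDist (ν + μ) μ ν x y ∈ snailRadii p) ∨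
    (0 ≤ y ∧ arcDist μ (ν + μ) ν x y ∈ snailRadii (n + p))

/-- The point `(x, y)` at distance `r` from the origin lies on the snail `SN(n+p;p)`, translated so
that its middle center is the origin and straightened below the axis. -/
def OnTarget (n p : ℕ) (ν μ r x y : ℝ) : Prop :=
  (y ≤ 0 ∧ arcDist μ (ν + μ) ν (-x) (-y) ∈ snailRadii (n + p)) ∨
    (y ≤ 0 ∧ arcDist (ν + μ) μ ν x y ∈ snailRadii p) ∨ (0 ≤ y ∧ r ∈ snailRadii (n + p + p))

/-- On the disk of radius `ν - 1/4` the half-twist is the rotation by `π`. It takes the left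
half-circles of the source to the emerging half-circles of the target, which have the same radii
there. -/
theorem onSource_iff_onTarget_inner (hν : 2 * ν = n) (hμ : 2 * μ = p) (hn : 0 < n) {x y : ℝ}
    (hx : |x| ≤ r) (hr : r ≤ ν - 1 / 4) :
    OnSource n p ν μ r x y ↔ OnTarget n p ν μ r (-x) (-y) := by
  obtain ⟨h1, h2⟩ := abs_le.1 hx
  have l1 := low_far hν hμ hn (show x ≤ ν + 1 / 4 by linarith) y
  have l2 := low_far hν hμ hn (show -x ≤ ν + 1 / 4 by linarith) (-y)
  have l3 : r ∈ snailRadii n ↔ r ∈ snailRadii (n + p + p) := left_radius_iff hν (by linarith)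
  unfold OnSource OnTarget
  simp only [neg_neg, l1, l2, l3, and_false, false_or, Left.neg_nonpos_iff, Left.nonneg_neg_iff]
  tauto

theorem twistCore_eq_zero (h : ν + 1 / 4 ≤ r) : twistCore ν r = 0 :=
  unitClamp_of_le (by linarith)

theorem twistRise_eq_zero (h : 8 * r * (ψ - Real.pi / 2) ≤ -1) : twistRise ν μ r ψ = 0 :=
  unitClamp_of_le (by have := unitClamp_le_one ((ν + μ - r) / ν); linarith)

theorem lt_of_twistRise_pos (h : 0 < twistRise ν μ r ψ) : -1 < 8 * r * (ψ - Real.pi / 2) := by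
  by_contra! h1
  rw [twistRise_eq_zero h1] at h
  exact lt_irrefl _ h

theorem twistFun_eq_drop (h1 : twistRise ν μ r ψ = 0) (h2 : twistCore ν r = 0) :
    twistFun ν μ r ψ = twistDrop ν r ψ := by
  have : 0 ≤ twistDrop ν r ψ := unitClamp_nonneg _
  rw [twistFun, h1, h2, max_eq_left this, max_eq_left this]

theorem twistFun_eq_rise (h1 : twistDrop ν r ψ = 0) (h2 : twistCore ν r = 0) :
    twistFun ν μ r ψ = twistRise ν μ r ψ := by
  have : 0 ≤ twistRise ν μ r ψ := unitClamp_nonneg _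
  rw [twistFun, h1, h2, max_eq_right this, max_eq_left this]

theorem add_twistDrop_le (hr : 0 < r) (h : ψ ≤ abscissaAngle (ν + 1 / 4) r) :
    ψ + Real.pi * twistDrop ν r ψ ≤ abscissaAngle (ν + 1 / 4) r := by
  have hw := drop_width_ge (ν := ν) hr
  have hpi := Real.pi_pos
  have h1 : twistDrop ν r ψ ≤ (abscissaAngle (ν + 1 / 4) r - ψ) / Real.pi := by
    refine max_le (div_nonneg (by linarith) hpi.le) ((min_le_right _ _).trans ?_)
    exact div_le_div_of_nonneg_left (by linarith) hpi hw
  rw [le_div_iff₀ hpi] at h1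
  linarith

theorem lt_add_twistFun (hν : 1 / 2 ≤ ν) (hr : 0 < r)
    (h : -Real.pi + abscissaAngle (ν - 1 / 4) r < ψ) :
    abscissaAngle (ν - 1 / 4) r < ψ + Real.pi * twistFun ν μ r ψ := by
  have h1 := strictMono_twist (μ := μ) hν zero_le_one le_rfl hr h
  have h2 : twistFun ν μ r (-Real.pi + abscissaAngle (ν - 1 / 4) r) = 1 :=
    twistFun_of_drop (twistDrop_eq_one hr le_rfl)
  simp only [h2, one_mul] at h1
  linarith

theorem not_mem_left (hν : 2 * ν = n) (hr : ν - 1 / 4 < r) : r ∉ snailRadii n := by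
  intro h
  have := (le_of_mem_snailRadii h).2
  linarith

/-- The image angle lies on the lower right quarter, between the vertical lines of abscissas
`ν - 1/4` and `ν + 1/4`: there the target is empty. -/
theorem not_onTarget_of_between (hν : 2 * ν = n) (hμ : 2 * μ = p) (hn : 0 < n)
    (hr : ν - 1 / 4 < r) {θ : ℝ} (h1 : abscissaAngle (ν - 1 / 4) r ≤ θ) (h2 : θ < Real.pi / 2)
    (h3 : r * Real.sin θ ≤ ν + 1 / 4) :
    ¬ OnTarget n p ν μ r (r * Real.sin θ) (-(r * Real.cos θ)) := by
  have hn' : (1 : ℝ) ≤ n := by exact_mod_cast hn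
  have hA := abscissaAngle_nonneg (show 0 ≤ ν - 1 / 4 by linarith) (show 0 < r by linarith)
  have hx := le_mul_sin (by linarith) (by linarith) hr.le h1 h2.le
  have hc : 0 < r * Real.cos θ :=
    mul_pos (by linarith) (Real.cos_pos_of_mem_Ioo ⟨by linarith, h2⟩)
  rintro (h | h | h)
  · exact top_far hν hμ hn (by linarith) _ h.2
  · exact low_far hν hμ hn h3 _ h.2
  · linarith [h.1]

/-- The points at the upper left. Those that are rotated by less than `π` lie outside the source,
and their images outside the target. -/
theorem onSource_iff_onTarget_left (hν : 2 * ν = n) (hμ : 2 * μ = p) (hn : 0 < n)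
    (hr : ν - 1 / 4 < r) (h1 : -Real.pi ≤ ψ) (h2 : ψ ≤ -(Real.pi / 2)) :
    OnSource n p ν μ r (r * Real.sin ψ) (-(r * Real.cos ψ)) ↔
      OnTarget n p ν μ r (r * Real.sin (ψ + Real.pi * twistFun ν μ r ψ))
        (-(r * Real.cos (ψ + Real.pi * twistFun ν μ r ψ))) := by
  have hn' : (1 : ℝ) ≤ n := by exact_mod_cast hn
  have hr0 : 0 < r := by linarith
  have hpi := Real.pi_gt_three
  have hx : r * Real.sin ψ ≤ 0 :=
    mul_nonpos_of_nonneg_of_nonpos hr0.le (Real.sin_nonpos_of_nonpos_of_neg_pi_le (by linarith) h1)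
  have hsin : r * Real.sin ψ = -(r * Real.sin (ψ + Real.pi)) := by rw [Real.sin_add_pi]; ring
  have hA : 0 ≤ abscissaAngle (ν - 1 / 4) r :=
    abscissaAngle_nonneg (by linarith) hr0
  have hA2 : abscissaAngle (ν - 1 / 4) r < Real.pi / 2 :=
    Real.arcsin_lt_pi_div_two.2 ((div_lt_one hr0).2 hr)
  have hlow := low_far hν hμ hn (show r * Real.sin ψ ≤ ν + 1 / 4 by linarith) (-(r * Real.cos ψ))
  have hleft := not_mem_left hν hr
  have hrise : twistRise ν μ r ψ = 0 := twistRise_eq_zero (by nlinarith)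
  rcases le_or_gt ψ (-Real.pi + abscissaAngle (ν - 1 / 4) r) with h | h
  · rw [twistFun_of_drop (twistDrop_eq_one hr0 h), mul_one, Real.sin_add_pi, Real.cos_add_pi]
    have hx' : r * Real.sin (ψ + Real.pi) ≤ ν - 1 / 4 :=
      mul_sin_le (by linarith) hr0 (by linarith) (by linarith)
    have hy : r * Real.cos ψ < 0 := by
      refine mul_neg_of_pos_of_neg hr0 ?_
      have : 0 < Real.cos (ψ + Real.pi) :=
        Real.cos_pos_of_mem_Ioo ⟨by linarith, by linarith⟩
      rw [Real.cos_add_pi] at this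
      linarith
    have hlow' := low_far hν hμ hn (show r * -Real.sin ψ ≤ ν + 1 / 4 by linarith)
      (-(r * -Real.cos ψ))
    have f1 : ¬ (0 ≤ -(r * -Real.cos ψ)) := by linarith
    have f2 : 0 ≤ -(r * Real.cos ψ) := by linarith
    have f3 : -(r * -Real.cos ψ) ≤ 0 := by linarith
    have f4 : ¬ (-(r * Real.cos ψ) ≤ 0) := by linarith
    unfold OnSource OnTarget
    simp only [hlow, f2, f4, mul_neg, neg_neg] at *
    simp only [hlow', f1, f3, false_and, and_false, true_and, false_or, or_false]
  · have htop : arcDist μ (ν + μ) ν (r * Real.sin ψ) (-(r * Real.cos ψ)) ∉ snailRadii (n + p) := by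
      refine top_far hν hμ hn ?_ _
      rw [hsin]
      have := le_mul_sin (by linarith) hr0 hr.le
        (show abscissaAngle (ν - 1 / 4) r ≤ ψ + Real.pi by linarith) (by linarith)
      linarith
    have hs : ¬ OnSource n p ν μ r (r * Real.sin ψ) (-(r * Real.cos ψ)) := by
      rintro (h | h | h)
      exacts [hleft h.2, hlow h.2, htop h.2]
    have hθ := lt_add_twistFun (μ := μ) (by linarith) hr0 h
    have hD := twistFun_le_one ν μ r ψ
    refine iff_of_false hs (not_onTarget_of_between hν hμ hn hr hθ.le ?_ ?_)
    · -- the twist function is smaller than `1` beyond the angle where the decrease starts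
      have hdrop : twistDrop ν r ψ < 1 := by
        have hw := drop_width_gt (show 1 / 2 ≤ ν by linarith) hr
        refine max_lt one_pos ((min_le_right _ _).trans_lt ?_)
        rw [div_lt_one (by linarith)]
        linarith
      have hcore : twistCore ν r < 1 :=
        max_lt one_pos ((min_le_right _ _).trans_lt (by linarith))
      have : twistFun ν μ r ψ < 1 := max_lt (max_lt hdrop (by rw [hrise]; exact one_pos)) hcore
      nlinarith
    · rcases le_or_gt r (ν + 1 / 4) with h3 | h3
      · have := Real.sin_le_one (ψ + Real.pi * twistFun ν μ r ψ)
        nlinarith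
      · have hB : 0 ≤ abscissaAngle (ν + 1 / 4) r := abscissaAngle_nonneg (by linarith) hr0
        have := add_twistDrop_le hr0 (show ψ ≤ abscissaAngle (ν + 1 / 4) r by linarith)
        rw [twistFun_eq_drop hrise (twistCore_eq_zero h3.le)] at hθ ⊢
        exact mul_sin_le (by linarith) hr0 this (by linarith)

/-- The points of the lower half-plane to the right of the imaginary axis: up to the abscissa
`ν + 1/4` the source is empty, beyond it the half-twist moves only the points close to the axis. -/
theorem onSource_iff_onTarget_bottom (hν : 2 * ν = n) (hμ : 2 * μ = p) (hn : 0 < n) (hp : 0 < p)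
    (hr : ν - 1 / 4 < r) (h1 : -(Real.pi / 2) < ψ) (h2 : ψ < Real.pi / 2) :
    OnSource n p ν μ r (r * Real.sin ψ) (-(r * Real.cos ψ)) ↔
      OnTarget n p ν μ r (r * Real.sin (ψ + Real.pi * twistFun ν μ r ψ))
        (-(r * Real.cos (ψ + Real.pi * twistFun ν μ r ψ))) := by
  have hn' : (1 : ℝ) ≤ n := by exact_mod_cast hn
  have hr0 : 0 < r := by linarith
  have hp' : (1 : ℝ) ≤ p := by exact_mod_cast hp
  have hpi := Real.pi_gt_three
  have hA : 0 ≤ abscissaAngle (ν - 1 / 4) r := abscissaAngle_nonneg (by linarith) hr0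
  have hA2 : abscissaAngle (ν - 1 / 4) r < Real.pi / 2 :=
    Real.arcsin_lt_pi_div_two.2 ((div_lt_one hr0).2 hr)
  have hB : 0 ≤ abscissaAngle (ν + 1 / 4) r := abscissaAngle_nonneg (by linarith) hr0
  have hy : 0 < r * Real.cos ψ := mul_pos hr0 (Real.cos_pos_of_mem_Ioo ⟨h1, h2⟩)
  have hleft := not_mem_left hν hr
  have hD := twistFun_le_one ν μ r ψ
  have hD0 := twistFun_nonneg ν μ r ψ
  have hθ := lt_add_twistFun (μ := μ) (show 1 / 2 ≤ ν by linarith) hr0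
    (show -Real.pi + abscissaAngle (ν - 1 / 4) r < ψ by linarith)
  have hsrc : OnSource n p ν μ r (r * Real.sin ψ) (-(r * Real.cos ψ)) ↔
      arcDist (ν + μ) μ ν (r * Real.sin ψ) (-(r * Real.cos ψ)) ∈ snailRadii p := by
    unfold OnSource
    constructor
    · rintro (h | h | h)
      exacts [absurd h.2 hleft, h.2, by linarith [h.1]]
    · exact fun h => Or.inr (Or.inl ⟨by linarith, h⟩)
  -- the disjuncts of the target below the axis, at angles up to `π / 2`
  have hT : ∀ {θ : ℝ}, abscissaAngle (ν - 1 / 4) r ≤ θ → θ ≤ Real.pi / 2 →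
      arcDist μ (ν + μ) ν (-(r * Real.sin θ)) (-(-(r * Real.cos θ))) ∉ snailRadii (n + p) :=
    fun h3 h4 => top_far hν hμ hn (by
      linarith [le_mul_sin (show 0 ≤ ν - 1 / 4 by linarith) hr0 hr.le h3 h4]) _
  have hle : ∀ {θ : ℝ}, Real.pi / 2 < θ → θ < 3 * (Real.pi / 2) → 0 < -(r * Real.cos θ) := by
    intro θ h3 h4
    have := Real.cos_neg_of_pi_div_two_lt_of_lt h3 (by linarith)
    nlinarith
  rw [hsrc]
  rcases le_or_gt ψ (abscissaAngle (ν + 1 / 4) r) with h | h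
  · refine iff_of_false (low_far hν hμ hn (mul_sin_le (by linarith) hr0 h h1.le) _) ?_
    by_cases hc : ν + 1 / 4 < r ∧ twistRise ν μ r ψ = 0
    · have h3 := add_twistDrop_le hr0 h
      rw [twistFun_eq_drop hc.2 (twistCore_eq_zero hc.1.le)] at hθ ⊢
      refine not_onTarget_of_between hν hμ hn hr hθ.le (h3.trans_lt ?_) ?_
      · exact Real.arcsin_lt_pi_div_two.2 ((div_lt_one hr0).2 hc.1)
      · exact mul_sin_le (by linarith) hr0 h3 (by linarith)
    · have hcol : ν + 1 / 4 < r → r * |ψ - Real.pi / 2| ≤ 1 / 8 := by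
        intro h3
        have h4 := lt_of_twistRise_pos
          (lt_of_le_of_ne (unitClamp_nonneg _) (Ne.symm (fun h => hc ⟨h3, h⟩)))
        rw [abs_of_neg (by linarith)]
        linarith
      have hgap : r < ν + 1 / 2 := by
        by_contra! h3
        have := (collar_bounds (by linarith) (hcol (by linarith))).1
        linarith [mul_sin_le (by linarith) hr0 h h1.le]
      have hnot : r ∉ snailRadii (n + p + p) := not_mem_of_gap hν (by linarith) hgap
      generalize twistFun ν μ r ψ = D at *
      rcases le_or_gt (ψ + Real.pi * D) (Real.pi / 2) with h3 | h3
      · rintro (h | h | h)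
        · exact hT hθ.le h3 h.2
        · rcases le_or_gt r (ν + 1 / 4) with h4 | h4
          · refine low_far hν hμ hn ?_ _ h.2
            have := Real.sin_le_one (ψ + Real.pi * D)
            nlinarith
          · refine hnot ((low_polar hν hμ hn hr.le ?_ ?_).1 h.2)
            · have h5 := hcol h4
              rw [abs_of_neg (by linarith)] at h5
              rw [abs_of_nonpos (by linarith)]
              nlinarith [mul_nonneg hr0.le (mul_nonneg (by linarith : 0 ≤ Real.pi) hD0)]
            · intro h5
              linarith
        · exact hnot h.2
      · have := hle h3 (by nlinarith)
        rintro (h | h | h)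
        exacts [by linarith [h.1], by linarith [h.1], hnot h.2]
  · have hB2 : ν + 1 / 4 < r := by
      by_contra! h3
      have : abscissaAngle (ν + 1 / 4) r = Real.pi / 2 :=
        Real.arcsin_of_one_le ((one_le_div hr0).2 h3)
      linarith
    have hrise := twistFun_eq_rise (μ := μ) (twistDrop_eq_zero hr0 h.le) (twistCore_eq_zero hB2.le)
    have hAB : abscissaAngle (ν - 1 / 4) r ≤ abscissaAngle (ν + 1 / 4) r :=
      Real.monotone_arcsin (div_le_div_of_nonneg_right (by linarith) hr0.le)
    rcases eq_or_ne (twistRise ν μ r ψ) 0 with h0 | h0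
    · rw [hrise, h0, mul_zero, add_zero]
      have := hT (hAB.trans h.le) h2.le
      unfold OnTarget
      constructor
      · exact fun h => Or.inr (Or.inl ⟨by linarith, h⟩)
      · rintro (h | h | h)
        exacts [absurd h.2 this, h.2, by linarith [h.1]]
    · have hpos : 0 < twistRise ν μ r ψ := lt_of_le_of_ne (unitClamp_nonneg _) h0.symm
      have hcol := lt_of_twistRise_pos hpos
      have hne : r ≠ ν + μ := by
        intro h3
        refine h0 (unitClamp_of_le ?_)
        rw [h3, sub_self, zero_div, unitClamp_of_le le_rfl, ← h3]
        nlinarith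
      rw [low_polar hν hμ hn hr.le (by rw [abs_of_neg (by linarith)]; linarith)
        (fun h => absurd h hne)]
      rw [← hrise] at hpos
      generalize twistFun ν μ r ψ = D at *
      rcases le_or_gt (ψ + Real.pi * D) (Real.pi / 2) with h3 | h3
      · have hlow := low_polar (ψ := ψ + Real.pi * D) hν hμ hn hr.le (by
          rw [abs_of_nonpos (by linarith)]
          nlinarith [mul_nonneg hr0.le (mul_nonneg (by linarith : 0 ≤ Real.pi) hD0)])
          (fun h => absurd h hne)
        have hy' : 0 ≤ r * Real.cos (ψ + Real.pi * D) :=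
          mul_nonneg hr0.le (Real.cos_nonneg_of_neg_pi_div_two_le_of_le (by linarith) h3)
        unfold OnTarget
        constructor
        · exact fun h => Or.inr (Or.inl ⟨by linarith, hlow.2 h⟩)
        · rintro (h | h | h)
          exacts [absurd h.2 (hT hθ.le h3), hlow.1 h.2, h.2]
      · have := hle h3 (by nlinarith)
        unfold OnTarget
        constructor
        · exact fun h => Or.inr (Or.inr ⟨this.le, h⟩)
        · rintro (h | h | h)
          exacts [by linarith [h.1], by linarith [h.1], h.2]

/-- The points at the upper right. Those that are rotated by less than `π` are so close to the
axis that membership, on both sides, depends on the radius only. -/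
theorem onSource_iff_onTarget_right (hν : 2 * ν = n) (hμ : 2 * μ = p) (hn : 0 < n) (hp : 0 < p)
    (hr : ν - 1 / 4 < r) (h1 : Real.pi / 2 ≤ ψ) (h2 : ψ ≤ Real.pi) :
    OnSource n p ν μ r (r * Real.sin ψ) (-(r * Real.cos ψ)) ↔
      OnTarget n p ν μ r (r * Real.sin (ψ + Real.pi * twistFun ν μ r ψ))
        (-(r * Real.cos (ψ + Real.pi * twistFun ν μ r ψ))) := by
  have hn' : (1 : ℝ) ≤ n := by exact_mod_cast hn
  have hp' : (1 : ℝ) ≤ p := by exact_mod_cast hp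
  have hr0 : 0 < r := by linarith
  have hpi := Real.pi_gt_three
  have hx : 0 ≤ r * Real.sin ψ :=
    mul_nonneg hr0.le (Real.sin_nonneg_of_nonneg_of_le_pi (by linarith) h2)
  have hy : 0 ≤ -(r * Real.cos ψ) := by
    have := Real.cos_nonpos_of_pi_div_two_le_of_le h1 (by linarith)
    nlinarith
  have hleft := not_mem_left hν hr
  have hD := twistFun_le_one ν μ r ψ
  have hD0 := twistFun_nonneg ν μ r ψ
  -- on the axis the four families of half-circles agree
  have hzero : ∀ {θ : ℝ}, θ = Real.pi / 2 →
      (arcDist μ (ν + μ) ν (r * Real.sin θ) (-(r * Real.cos θ)) ∈ snailRadii (n + p) ↔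
        r ∈ snailRadii (n + p + p)) ∧
      (arcDist (ν + μ) μ ν (r * Real.sin θ) (-(r * Real.cos θ)) ∈ snailRadii p ↔
        r ∈ snailRadii (n + p + p)) := by
    rintro _ rfl
    exact ⟨top_polar hν hμ hn hr.le (by simp) (by simp),
      low_polar hν hμ hn hr.le (by simp) (by simp)⟩
  have hyz : -(r * Real.cos ψ) ≤ 0 → ψ = Real.pi / 2 := by
    intro h
    by_contra h3
    have := Real.cos_neg_of_pi_div_two_lt_of_lt (lt_of_le_of_ne h1 (Ne.symm h3)) (by linarith)
    nlinarith
  have hsrc : OnSource n p ν μ r (r * Real.sin ψ) (-(r * Real.cos ψ)) ↔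
      arcDist μ (ν + μ) ν (r * Real.sin ψ) (-(r * Real.cos ψ)) ∈ snailRadii (n + p) := by
    unfold OnSource
    constructor
    · rintro (h | h | h)
      · exact absurd h.2 hleft
      · have := hzero (hyz h.1)
        exact this.1.2 (this.2.1 h.2)
      · exact h.2
    · exact fun h => Or.inr (Or.inr ⟨hy, h⟩)
  rw [hsrc]
  rcases hD.eq_or_lt with hD1 | hD1
  · rw [hD1, mul_one, Real.sin_add_pi, Real.cos_add_pi]
    have hlow := low_far hν hμ hn (show r * -Real.sin ψ ≤ ν + 1 / 4 by linarith)
      (-(r * -Real.cos ψ))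
    have e1 : -(r * -Real.sin ψ) = r * Real.sin ψ := by ring
    have e2 : -(-(r * -Real.cos ψ)) = -(r * Real.cos ψ) := by ring
    unfold OnTarget
    rw [e1, e2]
    constructor
    · exact fun h => Or.inl ⟨by linarith, h⟩
    · rintro (h | h | h)
      · exact h.2
      · exact absurd h.2 hlow
      · exact (hzero (hyz (by linarith [h.1]))).1.2 h.2
  · have hrise : twistRise ν μ r ψ < 1 :=
      lt_of_le_of_lt ((le_max_right _ _).trans (le_max_left _ _)) hD1
    have hcol : r * (ψ - Real.pi / 2) ≤ 1 / 8 := by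
      by_contra! h
      rw [twistRise_eq_one (by linarith)] at hrise
      exact lt_irrefl _ hrise
    have hne : r ≠ μ := by
      intro h
      refine hrise.ne (unitClamp_of_ge ?_)
      rw [h, add_sub_cancel_right, div_self (by linarith), unitClamp_of_ge le_rfl, ← h]
      nlinarith
    rw [top_polar hν hμ hn hr.le (by rwa [abs_of_nonneg (by linarith)]) (fun h => absurd h hne)]
    generalize twistFun ν μ r ψ = D at *
    have hDpi : Real.pi * D ≤ Real.pi := by nlinarith
    have hDpi0 : 0 ≤ Real.pi * D := by positivity
    have e1 : -(r * Real.sin (ψ + Real.pi * D)) = r * Real.sin (ψ + Real.pi * D - Real.pi) := by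
      rw [Real.sin_sub_pi]; ring
    have e2 : -(-(r * Real.cos (ψ + Real.pi * D))) =
        -(r * Real.cos (ψ + Real.pi * D - Real.pi)) := by
      rw [Real.cos_sub_pi]; ring
    rcases lt_or_ge (ψ + Real.pi * D) (3 * (Real.pi / 2)) with h3 | h3
    · have hy' : 0 ≤ -(r * Real.cos (ψ + Real.pi * D)) := by
        have := Real.cos_nonpos_of_pi_div_two_le_of_le
          (show Real.pi / 2 ≤ ψ + Real.pi * D by linarith) (by linarith)
        nlinarith
      have hyz' : -(r * Real.cos (ψ + Real.pi * D)) ≤ 0 → ψ + Real.pi * D = Real.pi / 2 := by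
        intro h
        by_contra h4
        have := Real.cos_neg_of_pi_div_two_lt_of_lt
          (lt_of_le_of_ne (show Real.pi / 2 ≤ ψ + Real.pi * D by linarith) (Ne.symm h4))
          (by linarith)
        nlinarith
      unfold OnTarget
      constructor
      · exact fun h => Or.inr (Or.inr ⟨hy', h⟩)
      · rintro (h | h | h)
        · refine absurd h.2 (top_far hν hμ hn ?_ _)
          rw [hyz' h.1, Real.sin_pi_div_two]
          linarith
        · exact (hzero (hyz' h.1)).2.1 h.2
        · exact h.2
    · have htop := top_polar (ψ := ψ + Real.pi * D - Real.pi) hν hμ hn hr.le (by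
        rw [abs_of_nonneg (by linarith)]
        nlinarith) (fun h => absurd h hne)
      rw [← e1, ← e2] at htop
      have hx' : r * Real.sin (ψ + Real.pi * D) ≤ 0 := by
        have := Real.sin_nonneg_of_nonneg_of_le_pi
          (show 0 ≤ ψ + Real.pi * D - Real.pi by linarith) (by linarith)
        rw [Real.sin_sub_pi] at this
        nlinarith
      have hy' : -(r * Real.cos (ψ + Real.pi * D)) ≤ 0 := by
        have := Real.cos_nonpos_of_pi_div_two_le_of_le
          (show Real.pi / 2 ≤ ψ + Real.pi * D - Real.pi by linarith) (by linarith)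
        rw [Real.cos_sub_pi] at this
        nlinarith
      unfold OnTarget
      constructor
      · exact fun h => Or.inl ⟨hy', htop.2 h⟩
      · rintro (h | h | h)
        · exact htop.1 h.2
        · exact absurd h.2 (low_far hν hμ hn (by linarith) _)
        · exact h.2

/-- The half-twist carries the straightened source to the straightened target. -/
theorem onSource_iff_onTarget (hν : 2 * ν = n) (hμ : 2 * μ = p) (hn : 0 < n) (hp : 0 < p)
    {z w : ℂ} (hw : w = z * Complex.exp ((twistAngle ν μ z : ℝ) * Complex.I)) :
    OnSource n p ν μ ‖z‖ z.re z.im ↔ OnTarget n p ν μ ‖z‖ w.re w.im := by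
  have hn' : (1 : ℝ) ≤ n := by exact_mod_cast hn
  rcases eq_or_ne z 0 with rfl | hz
  · rw [zero_mul] at hw
    subst hw
    have : (0 : ℝ) ∈ snailRadii n ↔ (0 : ℝ) ∈ snailRadii (n + p + p) :=
      left_radius_iff hν (by linarith)
    simp only [OnSource, OnTarget, norm_zero, Complex.zero_re, Complex.zero_im, le_refl, true_and,
      neg_zero, this]
    tauto
  · have hr : 0 < ‖z‖ := norm_pos_iff.2 hz
    obtain ⟨h1, h2⟩ := Complex.arg_mem_Ioc (Complex.I * z)
    have hb := bottomPolar_arg z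
    have ha : twistAngle ν μ z = Real.pi * twistFun ν μ ‖z‖ (Complex.arg (Complex.I * z)) := rfl
    have hre := Complex.abs_re_le_norm z
    rw [ha] at hw
    set r := ‖z‖
    set ψ := Complex.arg (Complex.I * z)
    rw [← hb, bottomPolar_mul_exp] at hw
    rcases le_or_gt r (ν - 1 / 4) with h | h
    · rw [twistFun_core h, mul_one] at hw
      have e : w = -z := by
        rw [hw, ← hb]
        simp [bottomPolar, Complex.ext_iff]
      rw [e]
      exact onSource_iff_onTarget_inner hν hμ hn hre h
    · rw [← hb, hw]
      rcases le_or_gt ψ (-(Real.pi / 2)) with h3 | h3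
      · exact onSource_iff_onTarget_left hν hμ hn h h1.le h3
      · rcases lt_or_ge ψ (Real.pi / 2) with h4 | h4
        · exact onSource_iff_onTarget_bottom hν hμ hn hp h h3 h4
        · exact onSource_iff_onTarget_right hν hμ hn hp h h4 h2

end Step
end

noncomputable section

section Step

variable {n p : ℕ} {ν μ : ℝ}

theorem lowMap_of_le {x : ℝ} (hμ : 0 ≤ μ) (h : x ≤ ν) (y : ℝ) : arcMap (ν + μ) μ ν x y = x := by
  rw [arcMap, straighten_of_le h, bend_of_far (by rw [abs_of_nonpos (by linarith)]; linarith) hμ]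

theorem topMap_of_le {x : ℝ} (hν : 0 ≤ ν) (hμ : 0 ≤ μ) (h : x ≤ -ν) (y : ℝ) :
    arcMap μ (ν + μ) ν x y = x := by
  rw [arcMap, straighten_of_le (by linarith),
    bend_of_far (by rw [abs_of_nonpos (by linarith)]; linarith) (by linarith)]

/-- The horizontal map that bends straightened arcs into the half-circles of `SN(n;p)`. -/
def sourceMap (ν μ x y : ℝ) : ℝ :=
  if 0 ≤ y then arcMap μ (ν + μ) ν x y else arcMap (ν + μ) μ ν x y

/-- The horizontal map that bends straightened arcs into the half-circles of `SN(n+p;p)`. -/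
def targetMap (ν μ x y : ℝ) : ℝ :=
  if 0 ≤ y then x else arcMap (ν + μ) μ ν x y + -arcMap μ (ν + μ) ν (-x) (-y) - x

theorem targetMap_of_le (hμ : 0 ≤ μ) {x y : ℝ} (hx : x ≤ ν) (hy : y ≤ 0) :
    targetMap ν μ x y = -arcMap μ (ν + μ) ν (-x) (-y) := by
  unfold targetMap
  split_ifs with h
  · rw [le_antisymm hy h, neg_zero, arcMap_zero, neg_neg]
  · rw [lowMap_of_le hμ hx]; ring

theorem targetMap_of_ge (hν : 0 ≤ ν) (hμ : 0 ≤ μ) {x y : ℝ} (hx : ν ≤ x) (hy : y ≤ 0) :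
    targetMap ν μ x y = arcMap (ν + μ) μ ν x y := by
  unfold targetMap
  split_ifs with h
  · rw [le_antisymm hy h, arcMap_zero]
  · rw [topMap_of_le hν hμ (by linarith)]; ring

theorem sourceMap_of_nonpos {x y : ℝ} (hy : y ≤ 0) :
    sourceMap ν μ x y = arcMap (ν + μ) μ ν x y := by
  unfold sourceMap
  split_ifs with h
  · rw [le_antisymm hy h, arcMap_zero, arcMap_zero]
  · rfl

theorem continuous_sourceMap (ν μ : ℝ) : Continuous fun q : ℝ × ℝ => sourceMap ν μ q.1 q.2 := by
  refine Continuous.if_le (continuous_arcMap _ _ _) (continuous_arcMap _ _ _) continuous_const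
    continuous_snd ?_
  rintro ⟨x, y⟩ h
  simp only at h ⊢
  rw [← h, arcMap_zero, arcMap_zero]

theorem continuous_targetMap (ν μ : ℝ) : Continuous fun q : ℝ × ℝ => targetMap ν μ q.1 q.2 := by
  refine Continuous.if_le continuous_fst ?_ continuous_const continuous_snd ?_
  · refine ((continuous_arcMap _ _ _).add ?_).sub continuous_fst
    exact ((continuous_arcMap μ (ν + μ) ν).comp
      (continuous_fst.neg.prodMk continuous_snd.neg)).neg
  · rintro ⟨x, y⟩ h
    simp only at h ⊢
    rw [← h, neg_zero, arcMap_zero, arcMap_zero]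
    ring

theorem strictMono_targetMap (hν : 0 ≤ ν) (hμ : 0 ≤ μ) (y : ℝ) :
    StrictMono fun x => targetMap ν μ x y := by
  rcases le_or_gt 0 y with h | h
  · intro a b hab
    simpa [targetMap, h] using hab
  · refine StrictMonoOn.Iic_union_Ici (a := ν) ?_ ?_
    · intro a ha b hb hab
      simp only
      rw [targetMap_of_le hμ ha h.le, targetMap_of_le hμ hb h.le]
      exact neg_lt_neg (strictMono_arcMap hν _ _ _ (neg_lt_neg hab))
    · intro a ha b hb hab
      simp only
      rw [targetMap_of_ge hν hμ ha h.le, targetMap_of_ge hν hμ hb h.le]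
      exact strictMono_arcMap hν _ _ _ hab

theorem exists_sourceIsotopy (hν : 0 ≤ ν) (μ : ℝ) : ∃ φ : unitInterval → (ℂ ≃ₜ ℂ),
    IsIsotopyFromId φ ∧ ∀ (t : unitInterval) (z : ℂ),
      φ t z = ⟨(1 - (t : ℝ)) * z.re + t * sourceMap ν μ z.re z.im, z.im⟩ := by
  refine exists_isotopy_horizontal _ (continuous_sourceMap ν μ) (fun y => ?_) (C := 1 / 2) ?_
  · unfold sourceMap
    split_ifs
    exacts [strictMono_arcMap hν _ _ _, strictMono_arcMap hν _ _ _]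
  · intro x y
    unfold sourceMap
    split_ifs
    exacts [abs_arcMap_sub_le _ _ _ _ _, abs_arcMap_sub_le _ _ _ _ _]

theorem exists_targetIsotopy (hν : 0 ≤ ν) (hμ : 0 ≤ μ) : ∃ φ : unitInterval → (ℂ ≃ₜ ℂ),
    IsIsotopyFromId φ ∧ ∀ (t : unitInterval) (z : ℂ),
      φ t z = ⟨(1 - (t : ℝ)) * z.re + t * targetMap ν μ z.re z.im, z.im⟩ := by
  refine exists_isotopy_horizontal _ (continuous_targetMap ν μ) (strictMono_targetMap hν hμ)
    (C := 1) ?_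
  intro x y
  unfold targetMap
  split_ifs
  · simp
  · have h1 := abs_le.1 (abs_arcMap_sub_le (ν + μ) μ ν x y)
    have h2 := abs_le.1 (abs_arcMap_sub_le μ (ν + μ) ν (-x) (-y))
    exact abs_le.2 ⟨by linarith, by linarith⟩

/-- An isotopy of horizontal maps that fixes the points of the axis is a top move of any three
points of the axis. -/
theorem isTopMove_horizontal {φ : unitInterval → (ℂ ≃ₜ ℂ)} {σ : ℝ → ℝ → ℝ}
    (h : IsIsotopyFromId φ)
    (h1 : ∀ (t : unitInterval) (z : ℂ), φ t z = ⟨(1 - (t : ℝ)) * z.re + t * σ z.re z.im, z.im⟩)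
    (a b c : ℝ) : IsTopMove a b c (φ 1) := by
  refine ⟨φ, h, rfl, fun t => ?_⟩
  simp [h1]

theorem mk_mem_snail_iff_onSource (hν : 2 * ν = n) (hμ : 2 * μ = p) (z : ℂ) :
    (⟨sourceMap ν μ z.re z.im, z.im⟩ : ℂ) + (-ν : ℝ) ∈ snail n p ↔
      OnSource n p ν μ ‖z‖ z.re z.im := by
  have hν0 : 0 ≤ ν := by have : (0 : ℝ) ≤ n := n.cast_nonneg
                         linarith
  have hμ0 : 0 ≤ μ := by have : (0 : ℝ) ≤ p := p.cast_nonneg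
                         linarith
  set w : ℂ := ⟨sourceMap ν μ z.re z.im, z.im⟩ with hw
  have c1 : w + (-ν : ℝ) - snailCenter₁ n p = w - (0 : ℝ) := by
    rw [snailCenter₁, ← Complex.ofReal_natCast, ← hν]; push_cast; ring
  have c2 : w + (-ν : ℝ) - snailCenter₂ n p = w - (μ : ℝ) := by
    rw [snailCenter₂, ← Complex.ofReal_natCast, ← Complex.ofReal_natCast, ← hν, ← hμ]
    push_cast; ring
  have c3 : w + (-ν : ℝ) - snailCenter₃ n p = w - (ν + μ : ℝ) := by
    rw [snailCenter₃, ← Complex.ofReal_natCast, ← hμ]; push_cast; ring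
  have him : (w + (-ν : ℝ)).im = z.im := by simp [hw]
  have d2 : 0 ≤ z.im → ‖w - (μ : ℝ)‖ = arcDist μ (ν + μ) ν z.re z.im := by
    intro h
    rw [hw, norm_mk_sub, sourceMap, if_pos h, arcDist]
  have d3 : z.im ≤ 0 → ‖w - (ν + μ : ℝ)‖ = arcDist (ν + μ) μ ν z.re z.im := by
    intro h
    rw [hw, norm_mk_sub, sourceMap_of_nonpos h, arcDist]
  have d1 : z.im ≤ 0 → (‖w - (0 : ℝ)‖ ∈ snailRadii n ↔ ‖z‖ ∈ snailRadii n) := by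
    intro h
    rcases le_or_gt z.re ν with h1 | h1
    · have : w = z := by rw [hw, sourceMap_of_nonpos h, lowMap_of_le hμ0 h1]
      rw [this, Complex.ofReal_zero, sub_zero]
    · have h2 : ν < w.re := by
        have := strictMono_arcMap hν0 (ν + μ) μ z.im h1
        simp only [lowMap_of_le hμ0 le_rfl] at this
        rwa [hw, sourceMap_of_nonpos h]
      have h3 : ∀ u : ℂ, ν < u.re → ‖u‖ ∉ snailRadii n := by
        intro u hu hm
        have := (le_of_mem_snailRadii hm).2
        have := Complex.re_le_norm u
        linarith
      rw [Complex.ofReal_zero, sub_zero]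
      exact iff_of_false (h3 _ h2) (h3 _ h1)
  simp only [snail, Set.mem_union, Set.mem_ofPred_eq, c1, c2, c3, him, OnSource]
  rw [or_assoc]
  refine or_congr (and_congr_right d1) (or_congr (and_congr_right fun h => ?_)
    (and_congr_right fun h => ?_))
  · rw [d3 h]
  · rw [d2 h]

theorem mk_mem_snail_iff_onTarget (hν : 2 * ν = n) (hμ : 2 * μ = p) (hn : 0 < n) (z : ℂ) :
    (⟨targetMap ν μ z.re z.im, z.im⟩ : ℂ) + (-ν : ℝ) ∈ snail (n + p) p ↔
      OnTarget n p ν μ ‖z‖ z.re z.im := by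
  have hn' : (1 : ℝ) ≤ n := by exact_mod_cast hn
  have hν0 : 0 ≤ ν := by linarith
  have hμ0 : 0 ≤ μ := by have : (0 : ℝ) ≤ p := p.cast_nonneg
                         linarith
  set w : ℂ := ⟨targetMap ν μ z.re z.im, z.im⟩ with hw
  have c1 : w + (-ν : ℝ) - snailCenter₁ (n + p) p = w - (-μ : ℝ) := by
    rw [snailCenter₁, Nat.cast_add, ← Complex.ofReal_natCast, ← Complex.ofReal_natCast, ← hν, ← hμ]
    push_cast; ring
  have c2 : w + (-ν : ℝ) - snailCenter₂ (n + p) p = w := by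
    rw [snailCenter₂, Nat.cast_add, ← Complex.ofReal_natCast, ← Complex.ofReal_natCast, ← hν, ← hμ]
    push_cast; ring
  have c3 : w + (-ν : ℝ) - snailCenter₃ (n + p) p = w - (ν + μ : ℝ) := by
    rw [snailCenter₃, ← Complex.ofReal_natCast, ← hμ]; push_cast; ring
  have him : (w + (-ν : ℝ)).im = z.im := by simp [hw]
  have hmono := strictMono_targetMap hν0 hμ0 z.im
  have hfix : z.im ≤ 0 → targetMap ν μ ν z.im = ν := by
    intro h
    rw [targetMap_of_ge hν0 hμ0 le_rfl h, lowMap_of_le hμ0 le_rfl]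
  have d1 : z.im ≤ 0 → (‖w - (-μ : ℝ)‖ ∈ snailRadii (n + p) ↔
      arcDist μ (ν + μ) ν (-z.re) (-z.im) ∈ snailRadii (n + p)) := by
    intro h
    rcases le_or_gt z.re ν with h1 | h1
    · rw [hw, norm_mk_sub, targetMap_of_le hμ0 h1 h, arcDist]
      have : (-arcMap μ (ν + μ) ν (-z.re) (-z.im) - -μ) ^ 2 + z.im ^ 2 =
        (arcMap μ (ν + μ) ν (-z.re) (-z.im) - μ) ^ 2 + (-z.im) ^ 2 := by ring
      rw [this]
    · refine iff_of_false (fun hm => ?_) (top_far hν hμ hn (by linarith) _)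
      have h2 : ν < w.re := by
        have := hmono h1
        simp only [hfix h] at this
        exact this
      have h3 := (le_of_mem_snailRadii hm).2
      have h4 := Complex.re_le_norm (w - (-μ : ℝ))
      rw [Complex.sub_re, Complex.ofReal_re] at h4
      rw [Nat.cast_add] at h3
      linarith
  have d3 : z.im ≤ 0 → (‖w - (ν + μ : ℝ)‖ ∈ snailRadii p ↔
      arcDist (ν + μ) μ ν z.re z.im ∈ snailRadii p) := by
    intro h
    rcases le_or_gt ν z.re with h1 | h1
    · rw [hw, norm_mk_sub, targetMap_of_ge hν0 hμ0 h1 h, arcDist]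
    · refine iff_of_false (fun hm => ?_) (low_far hν hμ hn (by linarith) _)
      have h2 : w.re < ν := by
        have := hmono h1
        simp only [hfix h] at this
        exact this
      have h3 := (le_of_mem_snailRadii hm).2
      have h4 := (abs_le.1 (Complex.abs_re_le_norm (w - (ν + μ : ℝ)))).1
      rw [Complex.sub_re, Complex.ofReal_re] at h4
      linarith
  have d2 : 0 ≤ z.im → w = z := by
    intro h
    rw [hw, targetMap, if_pos h]
  simp only [snail, Set.mem_union, Set.mem_ofPred_eq, c1, c2, c3, him, OnTarget]
  rw [or_assoc]
  refine or_congr (and_congr_right d1) (or_congr (and_congr_right d3)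
    (and_congr_right fun h => ?_))
  rw [d2 h]

theorem twistAngle_of_pos {r : ℝ} (hr : 0 < r) (ν μ : ℝ) :
    twistAngle ν μ (r : ℂ) = Real.pi * twistFun ν μ r (Real.pi / 2) := by
  have h : Complex.arg (Complex.I * r) = Real.pi / 2 := by
    rw [mul_comm, Complex.arg_real_mul _ hr, Complex.arg_I]
  rw [twistAngle, h, Complex.norm_real, Real.norm_of_nonneg hr.le]

/-- A half-twist about the left center carries `SN(n;p)` to `SN(n+p;p)`. -/
theorem hasLeftStep {n p : ℕ} (hn : 0 < n) (hp : 0 < p) : HasLeftStep n p := by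
  obtain ⟨ν, hν⟩ : ∃ ν : ℝ, 2 * ν = n := ⟨n / 2, by ring⟩
  obtain ⟨μ, hμ⟩ : ∃ μ : ℝ, 2 * μ = p := ⟨p / 2, by ring⟩
  have hn' : (1 : ℝ) ≤ n := by exact_mod_cast hn
  have hp' : (1 : ℝ) ≤ p := by exact_mod_cast hp
  obtain ⟨S, hS, hS'⟩ := exists_sourceIsotopy (ν := ν) (by linarith) μ
  obtain ⟨T, hT, hT'⟩ := exists_targetIsotopy (ν := ν) (μ := μ) (by linarith) (by linarith)
  obtain ⟨Q, hQ, hQ'⟩ := exists_halfTwist (ν := ν) (μ := μ) (by linarith)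
  have aμ : twistAngle ν μ (μ : ℂ) = Real.pi := by
    rw [twistAngle_of_pos (by linarith), twistFun_of_rise, mul_one]
    rw [twistRise, sub_self, mul_zero, zero_add, add_sub_cancel_right, div_self (by linarith),
      unitClamp_of_ge le_rfl, unitClamp_of_ge le_rfl]
  have aν : twistAngle ν μ ((ν + μ : ℝ) : ℂ) = 0 := by
    rw [twistAngle_of_pos (by linarith), twistFun_eq_drop,
      twistDrop_eq_zero (by linarith) (abscissaAngle_le _ _), mul_zero]
    · rw [twistRise, sub_self, mul_zero, zero_add, sub_self, zero_div, unitClamp_of_le le_rfl,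
        unitClamp_of_le le_rfl]
    · exact twistCore_eq_zero (by linarith)
  have Sfix : ∀ x : ℝ, S 1 x = x := fun x => by
    rw [hS']; simp [Complex.ext_iff, sourceMap, arcMap_zero]
  have Tfix : ∀ x : ℝ, T 1 x = x := fun x => by
    rw [hT']; simp [Complex.ext_iff, targetMap]
  have Q0 : ∀ t, Q t ((0 : ℝ) : ℂ) = (0 : ℝ) := fun t => by rw [hQ']; simp
  have Qν : ∀ t, Q t ((ν + μ : ℝ) : ℂ) = (ν + μ : ℝ) := fun t => by rw [hQ', aν]; simp
  have Qμ : Q 1 (μ : ℂ) = (-μ : ℝ) := by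
    rw [hQ', aμ]; simp
  have mS : IsTopMove ((0 : ℝ) : ℂ) (μ : ℝ) (ν + μ : ℝ) (S 1).symm := by
    have := (isTopMove_horizontal hS hS' 0 μ (ν + μ)).symm
    rwa [Sfix, Sfix, Sfix] at this
  have mQ : IsTopMove ((0 : ℝ) : ℂ) (μ : ℝ) (ν + μ : ℝ) (Q 1) := by
    refine ⟨Q, hQ, rfl, fun t => ⟨by rw [Q0]; simp, by rw [Qν, Complex.ofReal_im], ?_⟩⟩
    rw [hQ', aμ, Complex.im_ofReal_mul, Complex.exp_ofReal_mul_I_im]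
    refine mul_nonneg (by linarith) (Real.sin_nonneg_of_nonneg_of_le_pi ?_ ?_)
    · exact mul_nonneg t.2.1 Real.pi_pos.le
    · exact mul_le_of_le_one_left Real.pi_pos.le t.2.2
  have mT := isTopMove_horizontal hT hT' 0 (-μ) (ν + μ)
  have Ssymm : ∀ x : ℝ, (S 1).symm x = x := fun x => (S 1).symm_apply_eq.2 (Sfix x).symm
  have m1 : IsTopMove ((0 : ℝ) : ℂ) (μ : ℝ) (ν + μ : ℝ) ((S 1).symm.trans ((Q 1).trans (T 1))) := by
    refine mS.trans ?_
    rw [Ssymm, Ssymm, Ssymm]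
    refine mQ.trans ?_
    rwa [Q0, Qμ, Qν]
  set g := (S 1).symm.trans ((Q 1).trans (T 1)) with hg
  have g0 : g (0 : ℝ) = (0 : ℝ) := by
    simp only [hg, Homeomorph.trans_apply]; rw [Ssymm, Q0, Tfix]
  have gμ : g (μ : ℝ) = (-μ : ℝ) := by
    simp only [hg, Homeomorph.trans_apply]; rw [Ssymm, Qμ, Tfix]
  have gν : g (ν + μ : ℝ) = (ν + μ : ℝ) := by
    simp only [hg, Homeomorph.trans_apply]; rw [Ssymm, Qν, Tfix]
  have gS : ∀ z, g (S 1 z) = T 1 (Q 1 z) := fun z => by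
    simp [hg]
  set e : ℂ ≃ₜ ℂ := Homeomorph.addRight ((-ν : ℝ) : ℂ) with he
  have he' : ∀ z, e z = z + (-ν : ℝ) := fun z => rfl
  have c1 : snailCenter₁ n p = e (0 : ℝ) := by
    rw [he', snailCenter₁, ← Complex.ofReal_natCast, ← hν]; push_cast; ring
  have c2 : snailCenter₂ n p = e (μ : ℝ) := by
    rw [he', snailCenter₂, ← Complex.ofReal_natCast, ← Complex.ofReal_natCast, ← hν, ← hμ]
    push_cast; ring
  have c3 : snailCenter₃ n p = e (ν + μ : ℝ) := by
    rw [he', snailCenter₃, ← Complex.ofReal_natCast, ← hμ]; push_cast; ring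
  have c1' : snailCenter₁ (n + p) p = e (-μ : ℝ) := by
    rw [he', snailCenter₁, Nat.cast_add, ← Complex.ofReal_natCast, ← Complex.ofReal_natCast, ← hν,
      ← hμ]
    push_cast; ring
  have c2' : snailCenter₂ (n + p) p = e (0 : ℝ) := by
    rw [he', snailCenter₂, Nat.cast_add, ← Complex.ofReal_natCast, ← Complex.ofReal_natCast, ← hν,
      ← hμ]
    push_cast; ring
  have m2 := m1.conj e (fun z => by simp [he'])
  rw [← c1, ← c2, ← c3] at m2
  refine ⟨_, m2, ?_, ?_, ?_, ?_⟩
  · rw [c1, c2']; simp only [Homeomorph.trans_apply, Homeomorph.symm_apply_apply, g0]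
  · rw [c2, c1']; simp only [Homeomorph.trans_apply, Homeomorph.symm_apply_apply, gμ]
  · rw [show snailCenter₃ (n + p) p = snailCenter₃ n p from rfl, c3]
    simp only [Homeomorph.trans_apply, Homeomorph.symm_apply_apply, gν]
  · have key : ∀ z, ((e.symm.trans g).trans e) z ∈ snail (n + p) p ↔ z ∈ snail n p := by
      intro z
      obtain ⟨z, rfl⟩ := e.surjective z
      obtain ⟨z, rfl⟩ := (S 1).surjective z
      rw [Homeomorph.trans_apply, Homeomorph.trans_apply, e.symm_apply_apply, gS, he', he']
      have h1 := mk_mem_snail_iff_onSource hν hμ z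
      have h2 := mk_mem_snail_iff_onTarget hν hμ hn (Q 1 z)
      have h3 := onSource_iff_onTarget hν hμ hn hp (z := z) (w := Q 1 z) (by rw [hQ']; simp)
      have h4 : ‖Q 1 z‖ = ‖z‖ := by
        rw [hQ', norm_mul, Complex.norm_exp_ofReal_mul_I, mul_one]
      rw [hS', hT']
      simp only [Set.Icc.coe_one, sub_self, zero_mul, one_mul, zero_add]
      rw [h1, h2, h3, h4]
    ext z
    rw [← Homeomorph.coe_toEquiv, Equiv.image_eq_preimage_symm, Set.mem_preimage, ← key]
    simp

end Step
end

noncomputable section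

/-! ### A line meeting the snail in few points -/

theorem mem_perpBisector_iff_re {a b : ℂ} (ha : a.im = 0) (hb : b.im = 0) (hab : a.re < b.re)
    {z : ℂ} : z ∈ (AffineSubspace.perpBisector a b : Set ℂ) ↔ 2 * z.re = a.re + b.re := by
  rw [SetLike.mem_coe, AffineSubspace.mem_perpBisector_iff_dist_eq, Complex.dist_eq_re_im,
    Complex.dist_eq_re_im, Real.sqrt_inj (by positivity) (by positivity), ha, hb]
  constructor
  · intro h
    have : (b.re - a.re) * (2 * z.re - (a.re + b.re)) = 0 := by linarith
    rcases mul_eq_zero.1 this with h | h <;> linarith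
  · intro h
    linear_combination (b.re - a.re) * h

theorem IsotopicRel.symm {X H K : Set ℂ} (h : IsotopicRel X H K) : IsotopicRel X K H := by
  obtain ⟨φ, h1, h2, rfl⟩ := h
  refine ⟨_, h1.reverse, fun t x hx => ?_, ?_⟩
  · rw [Homeomorph.trans_apply, (φ 1).symm_apply_eq.2 (h2 1 x hx).symm, h2 _ x hx]
  · rw [Set.image_image]
    simp [h1.zero_apply]

theorem IsotopicRel.trans {X H K L : Set ℂ} (h : IsotopicRel X H K) (h' : IsotopicRel X K L) :
    IsotopicRel X H L := by
  obtain ⟨φ, h1, h2, rfl⟩ := h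
  obtain ⟨ψ, k1, k2, rfl⟩ := h'
  obtain ⟨χ, x1, x2, x3⟩ := h1.exists_trans k1
  refine ⟨χ, x1, fun t x hx => ?_, ?_⟩
  · rcases x3 t with ⟨s, hs⟩ | ⟨s, hs⟩
    · rw [hs, h2 s x hx]
    · rw [hs, h2 1 x hx, k2 s x hx]
  · rw [Set.image_image]
    exact Set.image_congr fun z _ => x2 z

theorem IsotopicRel.image {X H K : Set ℂ} (h : IsotopicRel X H K) (e : ℂ ≃ₜ ℂ) :
    IsotopicRel (e '' X) (e '' H) (e '' K) := by
  obtain ⟨φ, h1, h2, rfl⟩ := h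
  refine ⟨_, h1.conj e, ?_, ?_⟩
  · rintro t _ ⟨x, hx, rfl⟩
    simp [h2 t x hx]
  · rw [Set.image_image, Set.image_image]
    simp

theorem intersectionNumbers_subset_image (X L S : Set ℂ) (e : ℂ ≃ₜ ℂ) :
    intersectionNumbers X L S ⊆ intersectionNumbers (e '' X) (e '' L) (e '' S) := by
  rintro k ⟨K, h1, rfl⟩
  refine ⟨e '' K, h1.image e, ?_⟩
  rw [← Set.image_inter e.injective, e.injective.encard_image]

theorem intersectionNumbers_subset_of_isotopicRel {X L S T : Set ℂ} (h : IsotopicRel X S T) :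
    intersectionNumbers X L S ⊆ intersectionNumbers X L T := by
  obtain ⟨φ, h1, h2, rfl⟩ := h
  rintro k ⟨K, h3, rfl⟩
  refine ⟨φ 1 '' K, h3.trans ⟨φ, h1, h2, rfl⟩, ?_⟩
  rw [← Set.image_inter (φ 1).injective, (φ 1).injective.encard_image]

theorem intersectionNumbers_congr {X L S T : Set ℂ} (h : IsotopicRel X S T) :
    intersectionNumbers X L S = intersectionNumbers X L T :=
  (intersectionNumbers_subset_of_isotopicRel h).antisymm
    (intersectionNumbers_subset_of_isotopicRel h.symm)

/-- A horizontal shear moves the bisector of the first two centers, relatively to the centers, to a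
vertical line so close to the first center that it meets the snail in at most `n` points. -/
theorem exists_isotopicRel_encard_le {n p : ℕ} (hn : 0 < n) (hp : 0 < p) :
    ∃ K, IsotopicRel (snailCenters n p)
      (AffineSubspace.perpBisector (snailCenter₁ n p) (snailCenter₂ n p) : Set ℂ) K ∧
      (snail n p ∩ K).encard ≤ n := by
  have hn' : (1 : ℝ) ≤ n := by exact_mod_cast hn
  have hp' : (1 : ℝ) ≤ p := by exact_mod_cast hp
  set c : ℝ := (p - 1) / p with hc
  have hc0 : 0 ≤ c := div_nonneg (by linarith) (by linarith)
  have hc1 : c < 1 := (div_lt_one (by linarith)).2 (by linarith)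
  have hcp : c * p = p - 1 := div_mul_cancel₀ _ (by linarith)
  set a : ℝ := -(n : ℝ) / 2 with ha
  set b : ℝ := (-(n : ℝ) + p) / 2 with hb
  set τ : ℝ → ℝ := fun x => max 0 (min (x - a) (b - x)) with hτ
  have hlip : ∀ x x', x ≤ x' → τ x' - τ x ≤ x' - x ∧ τ x - τ x' ≤ x' - x := by
    intro x x' h
    simp only [hτ]
    constructor
    · rw [sub_le_iff_le_add]
      refine max_le (by have := le_max_left 0 (min (x - a) (b - x)); linarith) ?_
      have := le_max_right 0 (min (x - a) (b - x))
      rcases min_choice (x - a) (b - x) with h1 | h1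
      · linarith [min_le_left (x' - a) (b - x')]
      · linarith [min_le_right (x' - a) (b - x')]
    · rw [sub_le_iff_le_add]
      refine max_le (by have := le_max_left 0 (min (x' - a) (b - x')); linarith) ?_
      have := le_max_right 0 (min (x' - a) (b - x'))
      rcases min_choice (x' - a) (b - x') with h1 | h1
      · linarith [min_le_left (x - a) (b - x)]
      · linarith [min_le_right (x - a) (b - x)]
  have hτ0 : ∀ x, 0 ≤ τ x := fun x => le_max_left _ _
  have hτ1 : ∀ x, τ x ≤ b - a := by
    intro x
    refine max_le (by rw [ha, hb]; linarith) ?_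
    rcases le_total x a with h | h
    · exact (min_le_left _ _).trans (by linarith)
    · exact (min_le_right _ _).trans (by linarith)
  have hm : StrictMono fun x => x - c * τ x := by
    intro x x' h
    have := (hlip x x' h.le).1
    simp only
    nlinarith
  obtain ⟨φ, h1, h2⟩ := exists_isotopy_horizontal (fun x _ => x - c * τ x)
    (by simp only [hτ]; fun_prop) (fun _ => hm) (C := b - a) (by
      intro x _
      rw [abs_le]
      have := hτ0 x
      have := hτ1 x
      constructor <;> nlinarith)
  have hfix : ∀ t, ∀ z : ℂ, τ z.re = 0 → φ t z = z := by
    intro t z hz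
    rw [h2, hz]
    apply Complex.ext <;> simp
    ring
  refine ⟨_, ⟨φ, h1, ?_, rfl⟩, ?_⟩
  · rintro t z (rfl | rfl | rfl) <;> refine hfix _ _ (max_eq_left ?_)
    · rw [snailCenter₁_re]
      exact (min_le_left _ _).trans (by rw [ha]; linarith)
    · rw [snailCenter₂_re]
      exact (min_le_right _ _).trans (by rw [hb]; linarith)
    · rw [snailCenter₃_re]
      exact (min_le_right _ _).trans (by rw [hb]; linarith)
  · -- the two kinds of points on the line, distinguished by the parity of the index
    set f : ℕ → ℂ := fun k => if Odd (k + n) then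
      ⟨a + 1 / 4, √(((k + p : ℝ) / 2) ^ 2 - (p / 2 - 1 / 4) ^ 2)⟩
      else ⟨a + 1 / 4, -√(((k + 1 : ℝ) / 2) ^ 2 - (1 / 4) ^ 2)⟩ with hf
    have hsub : snail n p ∩ (φ 1 '' (AffineSubspace.perpBisector (snailCenter₁ n p)
        (snailCenter₂ n p) : Set ℂ)) ⊆ f '' (Finset.range n : Set ℕ) := by
      rintro _ ⟨hz, w, hw, rfl⟩
      rw [mem_perpBisector_iff_re (snailCenter₁_im _ _) (snailCenter₂_im _ _)
        (snailCenter₁_lt n hp), snailCenter₁_re, snailCenter₂_re] at hw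
      have hτw : τ w.re = p / 4 := by
        simp only [hτ]
        rw [min_eq_left (by rw [ha, hb]; linarith), max_eq_right (by rw [ha]; linarith), ha]
        linarith
      have hre : (φ 1 w).re = a + 1 / 4 := by
        rw [h2, hτw]
        simp only [Set.Icc.coe_one]
        rw [ha]
        linarith
      generalize φ 1 w = z at hz hre
      rcases hz with (⟨hy, hr⟩ | ⟨hy, hr⟩) | ⟨hy, hr⟩
      · obtain ⟨j, j1, j2, j3⟩ := mem_snailRadii.1 hr
        have hsq := Complex.sq_norm (z - snailCenter₁ n p)
        rw [Complex.normSq_apply, Complex.sub_re, Complex.sub_im, snailCenter₁_re, snailCenter₁_im,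
          hre, ← ha, sub_zero, show a + 1 / 4 - a = 1 / 4 by ring] at hsq
        have hj : j ≠ 0 := by
          rintro rfl
          have : ‖z - snailCenter₁ n p‖ = 0 := by
            rw [Nat.cast_zero] at j3; linarith
          rw [this] at hsq
          nlinarith
        obtain ⟨i, rfl⟩ := Nat.exists_eq_succ_of_ne_zero hj
        refine ⟨i, by simp; omega, ?_⟩
        have : ¬ Odd (i + n) := by
          intro h
          obtain ⟨s, hs⟩ := h
          obtain ⟨s', hs'⟩ := j2
          omega
        simp only [hf, this, if_false]
        apply Complex.ext
        · exact hre.symm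
        · simp only
          have e : ((i + 1 : ℝ) / 2) ^ 2 - (1 / 4) ^ 2 = (-z.im) ^ 2 := by
            have : ‖z - snailCenter₁ n p‖ = (i + 1 : ℝ) / 2 := by
              push_cast at j3; linarith
            rw [this] at hsq
            linarith
          rw [e, Real.sqrt_sq (by linarith), neg_neg]
      · exfalso
        have h3 := (le_of_mem_snailRadii hr).2
        have h4 := (abs_le.1 (Complex.abs_re_le_norm (z - snailCenter₃ n p))).1
        rw [Complex.sub_re, hre, snailCenter₃_re, ha] at h4
        linarith
      · obtain ⟨j, j1, j2, j3⟩ := mem_snailRadii.1 hr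
        have hsq := Complex.sq_norm (z - snailCenter₂ n p)
        rw [Complex.normSq_apply, Complex.sub_re, Complex.sub_im, snailCenter₂_re, snailCenter₂_im,
          hre, sub_zero, show a + 1 / 4 - (-(n : ℝ) + p) / 2 = -(p / 2 - 1 / 4) by rw [ha]; ring]
          at hsq
        have hj : p ≤ j := by
          have h4 := (abs_le.1 (Complex.abs_re_le_norm (z - snailCenter₂ n p))).1
          rw [Complex.sub_re, hre, snailCenter₂_re, ha] at h4
          have : (p : ℝ) < j + 1 := by linarith
          have : p < j + 1 := by exact_mod_cast this
          omega
        obtain ⟨i, rfl⟩ := Nat.exists_eq_add_of_le' hj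
        refine ⟨i, by simp; omega, ?_⟩
        have : Odd (i + n) := by
          obtain ⟨s', hs'⟩ := j2
          exact ⟨s' - p, by omega⟩
        simp only [hf, this, if_true]
        apply Complex.ext
        · exact hre.symm
        · simp only
          have e : ((i + p : ℝ) / 2) ^ 2 - (p / 2 - 1 / 4) ^ 2 = z.im ^ 2 := by
            have : ‖z - snailCenter₂ n p‖ = (i + p : ℝ) / 2 := by
              push_cast at j3; linarith
            rw [this] at hsq
            linarith
          rw [e, Real.sqrt_sq hy]
    refine (Set.encard_le_encard hsub).trans ((Set.encard_image_le _ _).trans ?_)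
    rw [Set.encard_coe_eq_coe_finsetCard, Finset.card_range]

end

noncomputable section

/-! ### Lifting through the cosine -/

/-- Lifting of homotopies through the exponential. -/
theorem exists_exp_lift {A : Type*} [TopologicalSpace A] {H : unitInterval × A → ℂ}
    (hH : Continuous H) (h0 : ∀ q, H q ≠ 0) {w : A → ℂ} (hw : Continuous w)
    (hwH : ∀ a, Complex.exp (w a) = H (0, a)) :
    ∃ W : unitInterval × A → ℂ, Continuous W ∧ (∀ q, Complex.exp (W q) = H q) ∧
      ∀ a, W (0, a) = w a := by
  let H' : C(unitInterval × A, {z : ℂ // z ≠ 0}) := ⟨fun q => ⟨H q, h0 q⟩, by fun_prop⟩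
  have e : ∀ a, H' (0, a) = (⟨_, (w a).exp_ne_zero⟩ : {z : ℂ // z ≠ 0}) :=
    fun a => Subtype.ext (hwH a).symm
  refine ⟨Complex.isCoveringMap_exp.liftHomotopy H' ⟨w, hw⟩ e, ContinuousMap.continuous _,
    fun q => ?_, fun a => Complex.isCoveringMap_exp.liftHomotopy_zero H' ⟨w, hw⟩ e a⟩
  exact congrArg Subtype.val
    (congrFun (Complex.isCoveringMap_exp.liftHomotopy_lifts H' ⟨w, hw⟩ e) q)

/-- Lifting of homotopies through the cosine, away from its critical values `1` and `-1`. -/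
theorem exists_cos_lift {A : Type*} [TopologicalSpace A] {H : unitInterval × A → ℂ}
    (hH : Continuous H) (h0 : ∀ q, H q ^ 2 ≠ 1) {w : A → ℂ} (hw : Continuous w)
    (hwH : ∀ a, Complex.cos (w a) = H (0, a)) :
    ∃ W : unitInterval × A → ℂ, Continuous W ∧ (∀ q, Complex.cos (W q) = H q) ∧
      ∀ a, W (0, a) = w a := by
  have h1 : ∀ q, H q ^ 2 - 1 ≠ 0 := fun q => sub_ne_zero.2 (h0 q)
  have hs : ∀ a, (Complex.I * Complex.sin (w a)) ^ 2 = H (0, a) ^ 2 - 1 := by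
    intro a
    rw [← hwH, mul_pow, Complex.I_sq, Complex.sin_sq]
    ring
  -- a square root of `H ^ 2 - 1`, which at time zero is `I * sin w`
  obtain ⟨L, L1, L2, L3⟩ := exists_exp_lift (H := fun q => (H q ^ 2 - 1) / (H (0, q.2) ^ 2 - 1))
    (Continuous.div (by fun_prop) (by fun_prop) fun q => h1 _)
    (fun q => div_ne_zero (h1 _) (h1 _)) (w := fun _ => 0) continuous_const
    (fun a => by rw [Complex.exp_zero, div_self (h1 _)])
  have hsq : ∀ q, (Complex.I * Complex.sin (w q.2) * Complex.exp (L q / 2)) ^ 2 = H q ^ 2 - 1 := by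
    intro q
    rw [mul_pow, hs, ← Complex.exp_nat_mul]
    push_cast
    rw [mul_div_cancel₀ _ two_ne_zero, L2, mul_div_cancel₀ _ (h1 _)]
  have hprod : ∀ q, (H q + Complex.I * Complex.sin (w q.2) * Complex.exp (L q / 2)) *
      (H q - Complex.I * Complex.sin (w q.2) * Complex.exp (L q / 2)) = 1 := by
    intro q
    linear_combination -hsq q
  obtain ⟨V, V1, V2, V3⟩ := exists_exp_lift
    (H := fun q => H q + Complex.I * Complex.sin (w q.2) * Complex.exp (L q / 2))
    (by fun_prop) (fun q => left_ne_zero_of_mul_eq_one (hprod q)) (w := fun a => w a * Complex.I)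
    (by fun_prop) (fun a => by rw [L3, zero_div, Complex.exp_zero, Complex.exp_mul_I, hwH]; ring)
  refine ⟨fun q => -(V q * Complex.I), by fun_prop, fun q => ?_, fun a => ?_⟩
  · have e1 : -(V q * Complex.I) * Complex.I = V q := by
      linear_combination -V q * Complex.I_sq
    rw [Complex.cos, neg_mul (-(V q * Complex.I)), e1, Complex.exp_neg, V2,
      inv_eq_of_mul_eq_one_right (hprod q)]
    ring
  · simp only
    rw [V3]
    linear_combination -w a * Complex.I_sq

theorem cos_re (w : ℂ) : (Complex.cos w).re = Real.cos w.re * Real.cosh w.im := by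
  conv_lhs => rw [← Complex.re_add_im w, Complex.cos_add_mul_I]
  simp [← Complex.ofReal_cos, ← Complex.ofReal_cosh, ← Complex.ofReal_sin, ← Complex.ofReal_sinh]

theorem re_cos_eq_zero {w : ℂ} : (Complex.cos w).re = 0 ↔ Real.cos w.re = 0 := by
  rw [cos_re, mul_eq_zero, or_iff_left (Real.cosh_pos _).ne']

/-! ### Crossings of a curve between two fixed points -/

/-- Near an end of the curve, the abscissa of the lifted curve stays at all times in the strip
around its value at the end. -/
theorem eventually_abs_lift_sub_lt {Φ : ℂ → ℂ} (hΦ : Continuous Φ) {φ : unitInterval → (ℂ ≃ₜ ℂ)}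
    (hφ : IsIsotopyFromId φ) {s : ℝ → ℂ} (hs : Continuous s) {w : ℝ → ℂ} (hw : Continuous w)
    {e : ℝ} {k : ℤ} (hfix : ∀ t, φ t (s e) = s e) (hwe : w e = k * Real.pi)
    (hcos : Complex.cos (w e) = Φ (s e)) :
    ∀ᶠ τ in nhds e, ∀ u : unitInterval → ℝ, Continuous u → u 0 = (w τ).re →
      (∀ t, Real.cos (u t) = 0 → (Φ ((φ t).symm (s τ))).re = 0) →
      |u 1 - k * Real.pi| < Real.pi / 2 := by
  have hpi := Real.pi_pos
  have hre : (w e).re = k * Real.pi := by simp [hwe]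
  have hne : (Φ (s e)).re ≠ 0 := by
    rw [← hcos, Ne, re_cos_eq_zero, hre]
    intro h
    have h1 := Real.sin_sq_add_cos_sq (k * Real.pi)
    rw [Real.sin_int_mul_pi, h] at h1
    norm_num at h1
  have ev1 : ∀ᶠ τ in nhds e, ∀ t ∈ (Set.univ : Set unitInterval),
      (Φ ((φ t).symm (s τ))).re ≠ 0 := by
    refine isCompact_univ.eventually_forall_of_forall_eventually fun t _ => ?_
    have hc : Continuous fun q : ℝ × unitInterval => (Φ ((φ q.2).symm (s q.1))).re :=
      Complex.continuous_re.comp (hΦ.comp (hφ.2.2.comp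
        (continuous_snd.prodMk (hs.comp continuous_fst))))
    refine hc.continuousAt.eventually_ne ?_
    simpa only [(φ t).symm_apply_eq.2 (hfix t).symm] using hne
  have ev2 : ∀ᶠ τ in nhds e, |(w τ).re - k * Real.pi| < Real.pi / 2 := by
    have hc : Continuous fun τ => |(w τ).re - k * Real.pi| := by fun_prop
    refine hc.continuousAt.eventually_lt continuousAt_const ?_
    rw [hre, sub_self, abs_zero]
    positivity
  filter_upwards [ev1, ev2] with τ h1 h2 u hu hu0 hzero
  by_contra! h3
  obtain ⟨t, ht⟩ := mem_range_of_exists_le_of_exists_ge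
    (f := fun t => |u t - k * Real.pi|) (by fun_prop) ⟨0, by rw [hu0]; exact h2.le⟩ ⟨1, h3⟩
  refine h1 t trivial (hzero t ?_)
  simp only at ht
  rcases (abs_eq (by positivity)).1 ht with h | h
  · rw [sub_eq_iff_eq_add.1 h, Real.cos_add_int_mul_pi, Real.cos_pi_div_two, mul_zero]
  · rw [sub_eq_iff_eq_add.1 h, Real.cos_add_int_mul_pi, Real.cos_neg, Real.cos_pi_div_two, mul_zero]

/-- A curve `s` joins two points of `X` and its image under `Φ` lifts through the cosine to a curve
from `k π` to `(k + n) π`. After an isotopy relatively to `X`, the curve still crosses at least `n`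
times the locus where the real part of `Φ` vanishes. -/
theorem le_encard_crossings {Φ : ℂ → ℂ} (hΦ : Continuous Φ) {X : Set ℂ}
    (hX : ∀ z, Φ z ^ 2 = 1 → z ∈ X) {φ : unitInterval → (ℂ ≃ₜ ℂ)} (hφ : IsIsotopyFromId φ)
    (hfix : ∀ t, ∀ x ∈ X, φ t x = x) {s : ℝ → ℂ} (hs : Continuous s) {w : ℝ → ℂ}
    (hw : Continuous w) {M : ℝ} (hM : 0 < M)
    (hcos : ∀ τ ∈ Set.Icc 0 M, Complex.cos (w τ) = Φ (s τ)) (hs0 : s 0 ∈ X) (hsM : s M ∈ X)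
    (hsX : ∀ τ ∈ Set.Ioo 0 M, s τ ∉ X) (hinj : Set.InjOn s (Set.Ioo 0 M)) {k : ℤ} {n : ℕ}
    (hw0 : w 0 = k * Real.pi) (hwM : w M = ((k + n : ℤ) : ℂ) * Real.pi) :
    (n : ℕ∞) ≤ {z | z ∈ s '' Set.Ioo 0 M ∧ (Φ ((φ 1).symm z)).re = 0}.encard := by
  have hpi := Real.pi_pos
  obtain ⟨W, W1, W2, W3⟩ := exists_cos_lift (A := Set.Ioo 0 M)
    (H := fun q => Φ ((φ q.1).symm (s q.2)))
    (hΦ.comp (hφ.2.2.comp (continuous_fst.prodMk (by fun_prop))))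
    (fun q h => by
      have h1 := hX _ h
      have h2 := hfix q.1 _ h1
      rw [Homeomorph.apply_symm_apply] at h2
      rw [← h2] at h1
      exact hsX _ q.2.2 h1)
    (w := fun a => w a) (by fun_prop) (fun a => by
      rw [hcos _ ⟨a.2.1.le, a.2.2.le⟩, hφ.1]
      rfl)
  -- the lifted abscissa vanishes in cosine exactly on the crossings
  have hcross : ∀ q, Real.cos (W q).re = 0 → (Φ ((φ q.1).symm (s q.2))).re = 0 := fun q h => by
    rw [← W2 q]
    exact re_cos_eq_zero.2 h
  have hend : ∀ a : Set.Ioo 0 M, ∀ j : ℤ,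
      (∀ u : unitInterval → ℝ, Continuous u → u 0 = (w a).re →
        (∀ t, Real.cos (u t) = 0 → (Φ ((φ t).symm (s a))).re = 0) →
        |u 1 - j * Real.pi| < Real.pi / 2) → |(W (1, a)).re - j * Real.pi| < Real.pi / 2 :=
    fun a j h => h (fun t => (W (t, a)).re) (by fun_prop) (by simp only [W3])
      (fun t => hcross (t, a))
  obtain ⟨a, ha, ha'⟩ : ∃ a, _ ∧ a ∈ Set.Ioo 0 M :=
    (((eventually_abs_lift_sub_lt hΦ hφ hs hw (fun t => hfix t _ hs0) hw0
      (hcos 0 ⟨le_rfl, hM.le⟩)).filter_mono nhdsWithin_le_nhds).and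
      (Ioo_mem_nhdsGT hM)).exists
  obtain ⟨b, hb, hb'⟩ : ∃ b, _ ∧ b ∈ Set.Ioo 0 M :=
    (((eventually_abs_lift_sub_lt hΦ hφ hs hw (fun t => hfix t _ hsM) hwM
      (hcos M ⟨hM.le, le_rfl⟩)).filter_mono nhdsWithin_le_nhds).and
      (Ioo_mem_nhdsLT hM)).exists
  have h1 := (abs_lt.1 (hend ⟨a, ha'⟩ k ha)).2
  have h2 := (abs_lt.1 (hend ⟨b, hb'⟩ (k + n) hb)).1
  have : PreconnectedSpace (Set.Ioo 0 M) := Subtype.preconnectedSpace isPreconnected_Ioo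
  have hex : ∀ j : Fin n, ∃ c : Set.Ioo 0 M,
      (W (1, c)).re = Real.pi / 2 + ((k + (j : ℕ) : ℤ) : ℝ) * Real.pi := by
    intro j
    have hj : (((j : ℕ) : ℝ) + 1) * Real.pi ≤ n * Real.pi :=
      mul_le_mul_of_nonneg_right (by exact_mod_cast j.2) hpi.le
    have hj0 : 0 ≤ ((j : ℕ) : ℝ) * Real.pi := by positivity
    push_cast at h1 h2 ⊢
    obtain ⟨c, hc⟩ := mem_range_of_exists_le_of_exists_ge
      (f := fun c : Set.Ioo 0 M => (W (1, c)).re)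
      (c := Real.pi / 2 + ((k : ℝ) + ((j : ℕ) : ℝ)) * Real.pi) (by fun_prop)
      ⟨⟨a, ha'⟩, by linarith⟩ ⟨⟨b, hb'⟩, by linarith⟩
    exact ⟨c, hc⟩
  choose c hc using hex
  have hcinj : Function.Injective fun j => s (c j) := by
    intro i j hij
    have h3 := hc i
    rw [Subtype.ext (hinj (c i).2 (c j).2 hij), hc j] at h3
    have h4 := mul_right_cancel₀ hpi.ne' (add_left_cancel h3)
    have h5 : k + (j : ℕ) = k + ((i : ℕ) : ℤ) := by exact_mod_cast h4
    exact Fin.ext (by omega)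
  have hsub : Set.range (fun j => s (c j)) ⊆
      {z | z ∈ s '' Set.Ioo 0 M ∧ (Φ ((φ 1).symm z)).re = 0} := by
    rintro _ ⟨j, rfl⟩
    refine ⟨⟨c j, (c j).2, rfl⟩, hcross (1, c j) ?_⟩
    rw [hc, Real.cos_add_int_mul_pi, Real.cos_pi_div_two, mul_zero]
  refine le_trans ?_ (Set.encard_le_encard hsub)
  refine le_trans ?_ hcinj.encard_range
  simp

end

noncomputable section

/-! ### A map of the plane branched at the centers -/

section Branched

variable {a b c : ℝ}

/-- The abscissa, between `0` and `π`, of the point of the upper half-strip over the vertical line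
of abscissa `x`: `0` to the left of `a`, `π` between `b` and `c`, and different from `π / 2` except
at the midpoint of `a` and `b`. -/
def stripAbscissa (a b c x : ℝ) : ℝ :=
  Real.pi * (unitClamp ((x - a) / (b - a)) - unitClamp (x - c) / 4)

/-- The height above the base of the half-strip of the points of the axis. It is positive on the
two intervals that are sent to the vertical sides. -/
def wallHeight (a b c x : ℝ) : ℝ := max 0 (a - x) + max 0 (min (x - b) (c - x))

/-- The cosine of the half-strip coordinate of a point of the upper half-plane, extended by
conjugation. The images of `a` and of `b`, `c` are the critical values `1` and `-1`. -/
def branchedMap (a b c : ℝ) (z : ℂ) : ℂ :=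
  if 0 ≤ z.im then
    Complex.cos (stripAbscissa a b c z.re + (|z.im| + wallHeight a b c z.re : ℝ) * Complex.I)
  else Complex.cos (stripAbscissa a b c z.re - (|z.im| + wallHeight a b c z.re : ℝ) * Complex.I)

theorem wallHeight_nonneg (a b c x : ℝ) : 0 ≤ wallHeight a b c x :=
  add_nonneg (le_max_left _ _) (le_max_left _ _)

theorem stripAbscissa_of_le (hab : a < b) (hbc : b < c) {x : ℝ} (h : x ≤ a) :
    stripAbscissa a b c x = 0 := by
  rw [stripAbscissa, unitClamp_of_le (div_nonpos_of_nonpos_of_nonneg (by linarith) (by linarith)),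
    unitClamp_of_le (by linarith)]
  ring

theorem stripAbscissa_of_mem (hab : a < b) {x : ℝ} (h1 : b ≤ x) (h2 : x ≤ c) :
    stripAbscissa a b c x = Real.pi := by
  rw [stripAbscissa, unitClamp_of_ge ((one_le_div (by linarith)).2 (by linarith)),
    unitClamp_of_le (by linarith)]
  ring

theorem stripAbscissa_of_mid (hab : a < b) (hbc : b < c) {x : ℝ} (h1 : a ≤ x) (h2 : x ≤ b) :
    stripAbscissa a b c x = Real.pi * ((x - a) / (b - a)) := by
  rw [stripAbscissa, unitClamp_of_mem (div_nonneg (by linarith) (by linarith))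
    ((div_le_one (by linarith)).2 (by linarith)), unitClamp_of_le (by linarith)]
  ring

theorem stripAbscissa_of_ge (hab : a < b) (hbc : b < c) {x : ℝ} (h : c < x) :
    3 * Real.pi / 4 ≤ stripAbscissa a b c x ∧ stripAbscissa a b c x < Real.pi := by
  have hpi := Real.pi_pos
  have h1 : 0 < unitClamp (x - c) := by
    unfold unitClamp
    exact lt_max_of_lt_right (lt_min one_pos (by linarith))
  have h2 := unitClamp_le_one (x - c)
  rw [stripAbscissa, unitClamp_of_ge ((one_le_div (by linarith)).2 (by linarith))]
  constructor <;> nlinarith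

theorem wallHeight_of_mid {x : ℝ} (h1 : a ≤ x) (h2 : x ≤ b) :
    wallHeight a b c x = 0 := by
  rw [wallHeight, max_eq_left (by linarith),
    max_eq_left ((min_le_left _ _).trans (by linarith)), add_zero]

theorem wallHeight_of_ge (hab : a < b) (hbc : b < c) {x : ℝ} (h : c ≤ x) :
    wallHeight a b c x = 0 := by
  rw [wallHeight, max_eq_left (by linarith),
    max_eq_left ((min_le_right _ _).trans (by linarith)), add_zero]

theorem wallHeight_pos_of_lt {x : ℝ} (h : x < a) : 0 < wallHeight a b c x :=
  add_pos_of_pos_of_nonneg (lt_max_of_lt_right (by linarith)) (le_max_left _ _)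

theorem wallHeight_pos_of_mem {x : ℝ} (h1 : b < x) (h2 : x < c) : 0 < wallHeight a b c x :=
  add_pos_of_nonneg_of_pos (le_max_left _ _)
    (lt_max_of_lt_right (lt_min (by linarith) (by linarith)))

theorem cos_pi_add_mul_I (v : ℂ) :
    Complex.cos (Real.pi + v * Complex.I) = Complex.cos (Real.pi - v * Complex.I) := by
  rw [add_comm, Complex.cos_add_pi, Complex.cos_pi_sub]

theorem branchedMap_of_nonneg {z : ℂ} (h : 0 ≤ z.im) : branchedMap a b c z =
    Complex.cos (stripAbscissa a b c z.re + (|z.im| + wallHeight a b c z.re : ℝ) * Complex.I) :=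
  if_pos h

theorem cos_strip_conj (hab : a < b) (hbc : b < c) (x : ℝ) :
    Complex.cos (stripAbscissa a b c x + (|0| + wallHeight a b c x : ℝ) * Complex.I) =
      Complex.cos (stripAbscissa a b c x - (|0| + wallHeight a b c x : ℝ) * Complex.I) := by
  rw [abs_zero, zero_add]
  rcases le_total x a with h1 | h1
  · rw [stripAbscissa_of_le hab hbc h1, Complex.ofReal_zero, zero_add, zero_sub, Complex.cos_neg]
  rcases le_total x b with h2 | h2
  · rw [wallHeight_of_mid h1 h2]; simp
  rcases le_total x c with h3 | h3
  · rw [stripAbscissa_of_mem hab h2 h3, cos_pi_add_mul_I]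
  · rw [wallHeight_of_ge hab hbc h3]; simp

theorem branchedMap_of_nonpos (hab : a < b) (hbc : b < c) {z : ℂ} (h : z.im ≤ 0) :
    branchedMap a b c z =
    Complex.cos (stripAbscissa a b c z.re - (|z.im| + wallHeight a b c z.re : ℝ) * Complex.I) := by
  unfold branchedMap
  split_ifs with h1
  · rw [le_antisymm h h1]; exact cos_strip_conj hab hbc _
  · rfl

theorem continuous_stripAbscissa (a b c : ℝ) : Continuous (stripAbscissa a b c) := by
  unfold stripAbscissa unitClamp
  fun_prop

theorem continuous_wallHeight (a b c : ℝ) : Continuous (wallHeight a b c) := by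
  unfold wallHeight
  fun_prop

theorem continuous_branchedMap (hab : a < b) (hbc : b < c) : Continuous (branchedMap a b c) := by
  have h1 := continuous_stripAbscissa a b c
  have h2 := continuous_wallHeight a b c
  refine Continuous.if_le ?_ ?_ continuous_const Complex.continuous_im ?_
  · fun_prop
  · fun_prop
  · intro z hz
    rw [← hz]
    exact cos_strip_conj hab hbc _

theorem branchedMap_cases (a b c : ℝ) (z : ℂ) : ∃ w : ℂ, branchedMap a b c z = Complex.cos w ∧
    w.re = stripAbscissa a b c z.re ∧ |w.im| = |z.im| + wallHeight a b c z.re := by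
  have h0 : 0 ≤ |z.im| + wallHeight a b c z.re :=
    add_nonneg (abs_nonneg _) (wallHeight_nonneg _ _ _ _)
  unfold branchedMap
  split_ifs
  · exact ⟨_, rfl, by simp, by
      rw [Complex.add_im, Complex.ofReal_im, Complex.im_ofReal_mul, Complex.I_im, mul_one, zero_add,
        abs_of_nonneg h0]⟩
  · exact ⟨_, rfl, by simp, by
      rw [Complex.sub_im, Complex.ofReal_im, Complex.im_ofReal_mul, Complex.I_im, mul_one, zero_sub,
        abs_neg, abs_of_nonneg h0]⟩

theorem stripAbscissa_eq (hab : a < b) (hbc : b < c) {x : ℝ} {θ : ℝ}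
    (h : stripAbscissa a b c x = θ) (h0 : 0 < θ) (h1 : θ < 3 * Real.pi / 4) :
    x - a = (b - a) * (θ / Real.pi) := by
  have hpi := Real.pi_pos
  rcases le_total x a with k1 | k1
  · rw [stripAbscissa_of_le hab hbc k1] at h; linarith
  rcases le_total x b with k2 | k2
  · rw [stripAbscissa_of_mid hab hbc k1 k2] at h
    have : b - a ≠ 0 := by linarith
    rw [← h]
    field_simp
  rcases le_or_gt x c with k3 | k3
  · rw [stripAbscissa_of_mem hab k2 k3] at h; linarith
  · have := (stripAbscissa_of_ge hab hbc k3).1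
    linarith

theorem two_mul_re_of_branchedMap_re_eq_zero (hab : a < b) (hbc : b < c) {z : ℂ}
    (h : (branchedMap a b c z).re = 0) : 2 * z.re = a + b := by
  have hpi := Real.pi_pos
  obtain ⟨w, h1, h2, -⟩ := branchedMap_cases a b c z
  rw [h1, re_cos_eq_zero, h2] at h
  have hU : 0 ≤ stripAbscissa a b c z.re ∧ stripAbscissa a b c z.re ≤ Real.pi := by
    rcases le_total z.re a with k1 | k1
    · rw [stripAbscissa_of_le hab hbc k1]; exact ⟨le_rfl, hpi.le⟩
    rcases le_total z.re b with k2 | k2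
    · rw [stripAbscissa_of_mid hab hbc k1 k2]
      have h3 : 0 ≤ (z.re - a) / (b - a) := div_nonneg (by linarith) (by linarith)
      have h4 : (z.re - a) / (b - a) ≤ 1 := (div_le_one (by linarith)).2 (by linarith)
      constructor <;> nlinarith
    rcases le_or_gt z.re c with k3 | k3
    · rw [stripAbscissa_of_mem hab k2 k3]; exact ⟨hpi.le, le_rfl⟩
    · have := stripAbscissa_of_ge hab hbc k3
      constructor <;> linarith
  have h3 : stripAbscissa a b c z.re = Real.pi / 2 :=
    Real.injOn_cos hU ⟨by linarith, by linarith⟩ (by rw [h, Real.cos_pi_div_two])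
  have := stripAbscissa_eq hab hbc h3 (by linarith) (by linarith)
  rw [div_div, mul_comm 2, ← div_div, div_self hpi.ne'] at this
  linarith

theorem mem_of_branchedMap_sq_eq_one (hab : a < b) (hbc : b < c) {z : ℂ}
    (h : branchedMap a b c z ^ 2 = 1) : z = a ∨ z = b ∨ z = c := by
  have hpi := Real.pi_pos
  obtain ⟨w, h1, h2, h3⟩ := branchedMap_cases a b c z
  have h4 : Complex.sin w = 0 := by
    have := Complex.sin_sq_add_cos_sq w
    rw [← h1, h] at this
    exact pow_eq_zero_iff two_ne_zero |>.1 (by linear_combination this)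
  obtain ⟨k, rfl⟩ := Complex.sin_eq_zero_iff.1 h4
  have h5 : ((k : ℂ) * Real.pi).im = 0 := by simp
  have h6 : ((k : ℂ) * Real.pi).re = k * Real.pi := by simp
  have hw0 := wallHeight_nonneg a b c z.re
  rw [h5, abs_zero] at h3
  have him : z.im = 0 := by
    rw [← abs_eq_zero]
    linarith [abs_nonneg z.im]
  have hwall : wallHeight a b c z.re = 0 := by linarith [abs_nonneg z.im]
  rw [h6] at h2
  have fin : ∀ x : ℝ, z.re = x → z = x := fun x hx => Complex.ext (by simp [hx]) (by simp [him])
  rcases le_or_gt z.re a with k1 | k1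
  · rcases k1.eq_or_lt with k1 | k1
    · exact Or.inl (fin _ k1)
    · exact absurd hwall (wallHeight_pos_of_lt k1).ne'
  rcases lt_or_ge z.re b with k2 | k2
  · exfalso
    rw [stripAbscissa_of_mid hab hbc k1.le k2.le, mul_comm] at h2
    have h7 := mul_left_cancel₀ hpi.ne' h2
    have h8 : 0 < (z.re - a) / (b - a) := div_pos (by linarith) (by linarith)
    have h9 : (z.re - a) / (b - a) < 1 := (div_lt_one (by linarith)).2 (by linarith)
    rw [← h7] at h8 h9
    have : 0 < k := by exact_mod_cast h8
    have : k < 1 := by exact_mod_cast h9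
    omega
  rcases le_or_gt z.re c with k3 | k3
  · rcases k2.eq_or_lt with k2 | k2
    · exact Or.inr (Or.inl (fin _ k2.symm))
    · rcases k3.eq_or_lt with k3 | k3
      · exact Or.inr (Or.inr (fin _ k3))
      · exact absurd hwall (wallHeight_pos_of_mem k2 k3).ne'
  · exfalso
    obtain ⟨h7, h8⟩ := stripAbscissa_of_ge hab hbc k3
    rw [← h2] at h7 h8
    have h9 : (k : ℝ) < 1 := by nlinarith
    have h10 : (0 : ℝ) < k := by nlinarith
    have : k < 1 := by exact_mod_cast h9
    have : 0 < k := by exact_mod_cast h10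
    omega

end Branched
end

noncomputable section

/-! ### The order of the ends of the half-circles along the snail -/

/-- The two reflections that pair the ends of the half-circles of the snail, in terms of the
indices `0, …, n+p-1` of these ends from the left to the right: the reflection of the emerging
half-circles for even `i`, those of the sustaining half-circles for odd `i`. -/
def flipIndex (n p : ℕ) (i : ℕ) (j : ℤ) : ℤ :=
  if Even i then n + p - 1 - j else if j < n then n - 1 - j else 2 * n + p - 1 - j

/-- The indices of the successive points of the axis on the snail, starting from the left center if
`n` is odd and from the right center otherwise. -/
def snailIndex (n p : ℕ) : ℕ → ℤ
  | 0 => if Odd n then (n - 1) / 2 else n + (p - 1) / 2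
  | i + 1 => flipIndex n p i (snailIndex n p i)

/-- The direction, in the half-strip coordinate, of the `i`-th half-circle of the snail. -/
def snailSign (n p : ℕ) (i : ℕ) : ℤ :=
  if Even i then (if 2 * snailIndex n p i < n + p - 1 then 1 else -1)
  else if snailIndex n p i < n then (if 2 * snailIndex n p i < n - 1 then 1 else -1)
  else (if 2 * n + p - 1 < 2 * snailIndex n p i then 1 else -1)

/-- The point of index `j` lies strictly between the middle center and the right center. -/
def IsRightWall (n p : ℕ) (j : ℤ) : Prop := n + p - 1 < 2 * j ∧ 2 * j < 2 * n + p - 1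

instance (n p : ℕ) : DecidablePred (IsRightWall n p) := fun _ => instDecidableAnd

/-- Twice the number of right walls among the first `i + 1` points of the axis on the snail. -/
def snailShift (n p : ℕ) (i : ℕ) : ℤ :=
  2 * ((Finset.range (i + 1)).filter fun l => IsRightWall n p (snailIndex n p l)).card

section Order

variable {n p : ℕ}

theorem snailIndex_zero_range (hnp : Nat.Coprime n p) :
    (Odd n ∧ 2 * snailIndex n p 0 = n - 1) ∨
      (Even n ∧ Odd p ∧ 2 * snailIndex n p 0 = 2 * n + p - 1) := by
  rcases Nat.even_or_odd n with h | h
  · right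
    have hp2 : Odd p := by
      rw [← Nat.not_even_iff_odd]
      intro h2
      have := Nat.dvd_gcd h.two_dvd h2.two_dvd
      rw [hnp] at this
      omega
    refine ⟨h, hp2, ?_⟩
    rw [snailIndex, if_neg (Nat.not_odd_iff_even.2 h)]
    obtain ⟨k, hk⟩ := hp2
    omega
  · left
    refine ⟨h, ?_⟩
    rw [snailIndex, if_pos h]
    obtain ⟨k, hk⟩ := h
    omega

theorem snailIndex_mem (hn : 0 < n) (hp : 0 < p) (hnp : Nat.Coprime n p) (i : ℕ) :
    0 ≤ snailIndex n p i ∧ snailIndex n p i < n + p := by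
  induction i with
  | zero => rcases snailIndex_zero_range hnp with h | h <;> omega
  | succ i ih =>
    rw [snailIndex, flipIndex]
    split_ifs <;> omega

theorem flipIndex_snailIndex_succ (hn : 0 < n) (hp : 0 < p) (hnp : Nat.Coprime n p) (i : ℕ) :
    flipIndex n p i (snailIndex n p (i + 1)) = snailIndex n p i := by
  have := snailIndex_mem hn hp hnp i
  rw [snailIndex, flipIndex, flipIndex]
  split_ifs <;> omega

/-- Modulo `n + p`, two consecutive reflections translate the indices by `n`. -/
theorem snailIndex_two_mul (hnp : Nat.Coprime n p) (h : ℕ) :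
    (∃ k : ℤ, snailIndex n p (2 * h) = snailIndex n p 0 + n * h + (n + p) * k) ∧
      ∃ k : ℤ, snailIndex n p (2 * h + 1) = snailIndex n p 0 - n * (h + 1) + (n + p) * k := by
  obtain ⟨e, he⟩ : ∃ e : ℤ, 2 * snailIndex n p 0 = n - 1 + (n + p) * e := by
    rcases snailIndex_zero_range hnp with h | h
    · exact ⟨0, by linarith⟩
    · exact ⟨1, by linarith⟩
  have hodd : ∀ h : ℕ, (∃ k : ℤ, snailIndex n p (2 * h) = snailIndex n p 0 + n * h + (n + p) * k) →
      ∃ k : ℤ, snailIndex n p (2 * h + 1) = snailIndex n p 0 - n * (h + 1) + (n + p) * k := by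
    rintro h ⟨k, hk⟩
    refine ⟨1 - e - k, ?_⟩
    change flipIndex n p (2 * h) (snailIndex n p (2 * h)) = _
    rw [flipIndex, if_pos (even_two_mul h), hk]
    linear_combination -he
  suffices heven : ∃ k : ℤ, snailIndex n p (2 * h) = snailIndex n p 0 + n * h + (n + p) * k from
    ⟨heven, hodd h heven⟩
  induction h with
  | zero => exact ⟨0, by simp⟩
  | succ h ih =>
    obtain ⟨k, hk⟩ := hodd h ih
    have hne : ¬ Even (2 * h + 1) := Nat.not_even_iff_odd.2 (odd_two_mul_add_one h)
    change ∃ k : ℤ, flipIndex n p (2 * h + 1) (snailIndex n p (2 * h + 1)) = _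
    rw [flipIndex, if_neg hne, hk]
    split_ifs
    · refine ⟨-e - k, ?_⟩
      push_cast
      linear_combination -he
    · refine ⟨1 - e - k, ?_⟩
      push_cast
      linear_combination -he

/-- The snail passes only once through each end of a half-circle. -/
theorem snailIndex_injOn (hnp : Nat.Coprime n p) {i i' : ℕ}
    (hi : i < n + p) (hi' : i' < n + p) (h : snailIndex n p i = snailIndex n p i') : i = i' := by
  have key : ∀ i, ∃ q k : ℤ, snailIndex n p i = snailIndex n p 0 + n * q + (n + p) * k ∧
      ((2 * q = i) ∨ (2 * q = -i - 1)) := by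
    intro i
    rcases Nat.even_or_odd' i with ⟨h, rfl | rfl⟩
    · obtain ⟨k, hk⟩ := (snailIndex_two_mul hnp h).1
      exact ⟨h, k, hk, by left; push_cast; ring⟩
    · obtain ⟨k, hk⟩ := (snailIndex_two_mul hnp h).2
      exact ⟨-(h + 1), k, by rw [hk]; ring, by right; push_cast; ring⟩
  obtain ⟨q, k, h1, h2⟩ := key i
  obtain ⟨q', k', h1', h2'⟩ := key i'
  have hdvd : ((n + p : ℕ) : ℤ) ∣ n * (q - q') :=
    ⟨k' - k, by push_cast; linear_combination h1' - h1 + h⟩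
  have hcop : IsCoprime ((n + p : ℕ) : ℤ) n := by
    rw [Nat.isCoprime_iff_coprime]
    simpa [Nat.coprime_comm] using hnp
  obtain ⟨d, hd⟩ := hcop.dvd_of_dvd_mul_left hdvd
  have hlt : |q - q'| < ((n + p : ℕ) : ℤ) := by
    rw [abs_lt]
    omega
  have : q - q' = 0 := Int.eq_zero_of_abs_lt_dvd ⟨d, hd⟩ hlt
  omega

theorem snailIndex_succ_ne (hnp : Nat.Coprime n p) {i : ℕ}
    (hi : i + 1 < n + p) : snailIndex n p (i + 1) ≠ snailIndex n p i := fun h => by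
  have := snailIndex_injOn hnp hi (by omega) h
  omega

/-- Between its ends the snail does not pass through the centers. -/
theorem snailIndex_ne_center (hn : 0 < n) (hp : 0 < p) (hnp : Nat.Coprime n p) {i : ℕ}
    (hi : i + 2 < n + p) : 2 * snailIndex n p (i + 1) ≠ n - 1 ∧
      2 * snailIndex n p (i + 1) ≠ n + p - 1 ∧ 2 * snailIndex n p (i + 1) ≠ 2 * n + p - 1 := by
  have h1 := snailIndex_succ_ne hnp (i := i) (by omega)
  have h2 := snailIndex_succ_ne hnp (i := i + 1) (by omega)
  have h3 := flipIndex_snailIndex_succ hn hp hnp i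
  have h4 : snailIndex n p (i + 1 + 1) = flipIndex n p (i + 1) (snailIndex n p (i + 1)) := rfl
  rw [flipIndex] at h3 h4
  have hpar := Nat.even_add_one (n := i)
  split_ifs at h3 h4 <;> first | omega | tauto

/-- The snail ends at the middle center or at the right center. -/
theorem snailIndex_last (hn : 0 < n) (hp : 0 < p) (hnp : Nat.Coprime n p) :
    2 * snailIndex n p (n + p - 1) = n + p - 1 ∨
      2 * snailIndex n p (n + p - 1) = 2 * n + p - 1 := by
  have hm := snailIndex_mem hn hp hnp (n + p - 1)
  have hz := snailIndex_zero_range hnp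
  obtain ⟨e, he⟩ : ∃ e : ℤ, 2 * snailIndex n p 0 = n - 1 + (n + p) * e := by
    rcases hz with h | h
    · exact ⟨0, by linarith⟩
    · exact ⟨1, by linarith⟩
  have hcast : ((n + p : ℕ) : ℤ) = n + p := by push_cast; ring
  have hub : ∀ x : ℤ, (n + p : ℤ) * x = 0 * (n + p) ∨ (n + p : ℤ) * x = 1 * (n + p) ∨
      (n + p : ℤ) * x ≤ - (n + p) ∨ 2 * (n + p) ≤ (n + p : ℤ) * x := by
    intro x
    rcases lt_trichotomy x 0 with h | rfl | h
    · right; right; left; nlinarith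
    · left; ring
    · rcases (Int.add_one_le_iff.2 h).eq_or_lt with h | h
      · right; left; rw [← h]; ring
      · right; right; right; nlinarith
  rcases Nat.even_or_odd' (n + p - 1) with ⟨h, hh | hh⟩
  · left
    obtain ⟨k, hk⟩ := (snailIndex_two_mul hnp h).1
    rw [hh]
    rw [hh] at hm
    have h2 : (2 * h : ℤ) = n + p - 1 := by omega
    have h3 : 2 * snailIndex n p (2 * h) + 1 = (n + p) * (e + n + 2 * k) := by
      linear_combination 2 * hk + he + n * h2
    have := hub (e + n + 2 * k)
    omega
  · right
    obtain ⟨k, hk⟩ := (snailIndex_two_mul hnp h).2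
    have hne : snailIndex n p (n + p - 1) ≠ snailIndex n p 0 := fun h' => by
      have := snailIndex_injOn hnp (by omega) (by omega) h'
      omega
    rw [hh] at hne ⊢
    rw [hh] at hm
    have h2 : (2 * (h + 1) : ℤ) = n + p := by omega
    have h3 : 2 * snailIndex n p (2 * h + 1) - (n - 1) = (n + p) * (e - n + 2 * k) := by
      linear_combination 2 * hk + he - n * h2
    have := hub (e - n + 2 * k)
    rcases hz with hz | ⟨hz1, hz2, hz3⟩
    · omega
    · exfalso
      obtain ⟨r, hr⟩ := hz1
      obtain ⟨r', hr'⟩ := hz2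
      omega

/-- The direction changes exactly at the walls: from negative to positive at the left ones, from
positive to negative at the right ones. -/
theorem snailSign_succ (hn : 0 < n) (hp : 0 < p) (hnp : Nat.Coprime n p) {i : ℕ}
    (hi : i + 2 < n + p) :
    (2 * snailIndex n p (i + 1) < n - 1 ∧ snailSign n p i = -1 ∧ snailSign n p (i + 1) = 1) ∨
    (n - 1 < 2 * snailIndex n p (i + 1) ∧ 2 * snailIndex n p (i + 1) < n + p - 1 ∧
      snailSign n p (i + 1) = snailSign n p i) ∨
    (n + p - 1 < 2 * snailIndex n p (i + 1) ∧ 2 * snailIndex n p (i + 1) < 2 * n + p - 1 ∧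
      snailSign n p i = 1 ∧ snailSign n p (i + 1) = -1) ∨
    (2 * n + p - 1 < 2 * snailIndex n p (i + 1) ∧ snailSign n p (i + 1) = snailSign n p i) := by
  obtain ⟨c1, c2, c3⟩ := snailIndex_ne_center hn hp hnp hi
  have h3 := flipIndex_snailIndex_succ hn hp hnp i
  have hm := snailIndex_mem hn hp hnp i
  have hm' := snailIndex_mem hn hp hnp (i + 1)
  have hpar := Nat.even_add_one (n := i)
  rw [flipIndex] at h3
  unfold snailSign
  by_cases he : Even i
  · have he' : ¬ Even (i + 1) := fun h => (hpar.1 h) he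
    simp only [he, he', if_true, if_false] at h3 ⊢
    split_ifs <;> omega
  · have he' : Even (i + 1) := hpar.2 he
    simp only [he, he', if_true, if_false] at h3 ⊢
    split_ifs at h3 ⊢ <;> omega

theorem snailSign_last (hn : 0 < n) (hp : 0 < p) (hnp : Nat.Coprime n p) :
    snailSign n p (n + p - 2) = 1 := by
  obtain ⟨i, hi⟩ : ∃ i, n + p - 2 = i := ⟨_, rfl⟩
  have hlast := snailIndex_last hn hp hnp
  rw [show n + p - 1 = i + 1 by omega] at hlast
  have hne := snailIndex_succ_ne hnp (i := i) (by omega)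
  have h3 := flipIndex_snailIndex_succ hn hp hnp i
  have hm := snailIndex_mem hn hp hnp i
  rw [flipIndex] at h3
  rw [hi, snailSign]
  by_cases he : Even i
  · simp only [he, if_true] at h3 ⊢
    split_ifs <;> omega
  · simp only [he, if_false] at h3 ⊢
    split_ifs at h3 ⊢ <;> omega

theorem snailSign_eq (n p i : ℕ) : snailSign n p i = 1 ∨ snailSign n p i = -1 := by
  unfold snailSign
  split_ifs <;> simp

theorem snailShift_succ (i : ℕ) : snailShift n p (i + 1) =
    snailShift n p i + if IsRightWall n p (snailIndex n p (i + 1)) then 2 else 0 := by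
  unfold snailShift
  rw [Finset.range_add_one, Finset.filter_insert]
  split_ifs
  · rw [Finset.card_insert_of_notMem (by simp)]
    push_cast
    ring
  · rw [add_zero]

theorem snailShift_zero (hp : 0 < p) (hnp : Nat.Coprime n p) :
    snailShift n p 0 = 0 := by
  have : ¬ IsRightWall n p (snailIndex n p 0) := by
    unfold IsRightWall
    have := snailIndex_zero_range hnp
    omega
  simp [snailShift, Finset.filter_singleton, this]

/-- The number of right walls, counted along the snail, is the number of ends of half-circles
between the middle center and the right center. -/
theorem snailShift_last (hn : 0 < n) (hp : 0 < p) (hnp : Nat.Coprime n p) :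
    snailShift n p (n + p - 2) = 2 * ((n - 1 : ℤ) / 2) := by
  have hlast : ¬ IsRightWall n p (snailIndex n p (n + p - 1)) := by
    unfold IsRightWall
    have := snailIndex_last hn hp hnp
    omega
  have hz := snailIndex_zero_range hnp
  have h1 : snailShift n p (n + p - 1) = snailShift n p (n + p - 2) := by
    have := snailShift_succ (n := n) (p := p) (n + p - 2)
    rw [show n + p - 2 + 1 = n + p - 1 by omega, if_neg hlast, add_zero] at this
    exact this
  have hinj : Set.InjOn (snailIndex n p) (Finset.range (n + p) : Set ℕ) := by
    intro i hi i' hi' h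
    simp only [Finset.coe_range, Set.mem_Iio] at hi hi'
    exact snailIndex_injOn hnp hi hi' h
  have himg : (Finset.range (n + p)).image (snailIndex n p) = Finset.Ico 0 ((n + p : ℕ) : ℤ) := by
    refine Finset.eq_of_subset_of_card_le (fun j hj => ?_) ?_
    · obtain ⟨i, -, rfl⟩ := Finset.mem_image.1 hj
      have := snailIndex_mem hn hp hnp i
      rw [Finset.mem_Ico]
      push_cast
      exact this
    · rw [Finset.card_image_of_injOn hinj]
      simp
  rw [← h1, snailShift, show n + p - 1 + 1 = n + p by omega,
    ← Finset.card_image_of_injOn (hinj.mono (Finset.coe_subset.2 (Finset.filter_subset _ _))),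
    ← Finset.filter_image, himg]
  have hfil : (Finset.Ico 0 ((n + p : ℕ) : ℤ)).filter (IsRightWall n p) =
      Finset.Ico ((n + p - 1 : ℤ) / 2 + 1) ((2 * n + p - 2 : ℤ) / 2 + 1) := by
    ext j
    simp only [Finset.mem_filter, Finset.mem_Ico, IsRightWall]
    omega
  rw [hfil, Int.card_Ico]
  rcases hz with ⟨⟨r, hr⟩, -⟩ | ⟨⟨r, hr⟩, ⟨r', hr'⟩, -⟩ <;> omega

end Order
end

noncomputable section

/-! ### The snail as a curve -/

/-- Continuous maps that agree at the integers `1, …, m` glue to a continuous map on the line. -/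
theorem exists_continuous_glue {E : Type*} [TopologicalSpace E] (g : ℕ → ℝ → E)
    (hg : ∀ i, Continuous (g i)) (m : ℕ)
    (h : ∀ i < m, g i ((i + 1 : ℕ) : ℝ) = g (i + 1) ((i + 1 : ℕ) : ℝ)) :
    ∃ G : ℝ → E, Continuous G ∧
      ∀ i ≤ m, ∀ τ : ℝ, (i : ℝ) ≤ τ → τ ≤ ((i + 1 : ℕ) : ℝ) → G τ = g i τ := by
  induction m with
  | zero =>
    refine ⟨g 0, hg 0, fun i hi τ _ _ => ?_⟩
    rw [Nat.le_zero.1 hi]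
  | succ m ih =>
    obtain ⟨G, h1, h2⟩ := ih fun i hi => h i (by omega)
    have hm : G ((m + 1 : ℕ) : ℝ) = g (m + 1) ((m + 1 : ℕ) : ℝ) := by
      rw [h2 m le_rfl _ (by push_cast; linarith) le_rfl, h m (by omega)]
    refine ⟨fun τ => if τ ≤ ((m + 1 : ℕ) : ℝ) then G τ else g (m + 1) τ,
      Continuous.if_le h1 (hg _) continuous_id continuous_const ?_, fun i hi τ hτ1 hτ2 => ?_⟩
    · rintro τ rfl
      exact hm
    · simp only
      rcases hi.eq_or_lt with rfl | hi
      · split_ifs with h3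
        · rw [le_antisymm h3 hτ1, hm]
        · rfl
      · have : ((i + 1 : ℕ) : ℝ) ≤ ((m + 1 : ℕ) : ℝ) := by exact_mod_cast hi
        rw [if_pos (hτ2.trans this), h2 i (by omega) τ hτ1 hτ2]

/-- The abscissa of the point of the axis of index `j`. -/
def endAbscissa (n : ℕ) (j : ℤ) : ℝ := j + 1 / 2 - n

/-- The abscissa of the center of the `i`-th half-circle along the snail. -/
def arcCenter (n p i : ℕ) : ℝ :=
  if Even i then (-(n : ℝ) + p) / 2 else if snailIndex n p i < n then -(n : ℝ) / 2 else p / 2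

/-- The sign of the imaginary part on the `i`-th half-circle along the snail. -/
def arcSide (i : ℕ) : ℝ := if Even i then 1 else -1

/-- The signed radius of the `i`-th half-circle along the snail. -/
def arcRadius (n p i : ℕ) : ℝ := endAbscissa n (snailIndex n p i) - arcCenter n p i

/-- The `i`-th half-circle along the snail, travelled between the times `i` and `i + 1`. -/
def snailArc (n p i : ℕ) (τ : ℝ) : ℂ :=
  ⟨arcCenter n p i + arcRadius n p i * Real.cos (Real.pi * (τ - i)),
    arcSide i * (|arcRadius n p i| * Real.sin (Real.pi * (τ - i)))⟩

section Curve

variable {n p : ℕ}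

theorem arcSide_eq (i : ℕ) : arcSide i = 1 ∨ arcSide i = -1 := by
  unfold arcSide; split_ifs <;> simp

theorem arcSide_succ (i : ℕ) : arcSide (i + 1) = -arcSide i := by
  unfold arcSide
  have := Nat.even_add_one (n := i)
  split_ifs <;> first | tauto | norm_num

theorem endAbscissa_succ (n p i : ℕ) :
    endAbscissa n (snailIndex n p (i + 1)) = arcCenter n p i - arcRadius n p i := by
  have h : snailIndex n p (i + 1) = flipIndex n p i (snailIndex n p i) := rfl
  rw [h, flipIndex, arcRadius, arcCenter, endAbscissa, endAbscissa]
  split_ifs <;> push_cast <;> ring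

theorem snailArc_left (n p i : ℕ) :
    snailArc n p i i = (endAbscissa n (snailIndex n p i) : ℂ) := by
  apply Complex.ext <;> simp [snailArc, arcRadius]

theorem snailArc_right (n p i : ℕ) :
    snailArc n p i ((i + 1 : ℕ) : ℝ) = (endAbscissa n (snailIndex n p (i + 1)) : ℂ) := by
  rw [endAbscissa_succ]
  apply Complex.ext <;> simp [snailArc]
  ring

theorem continuous_snailArc (n p i : ℕ) : Continuous (snailArc n p i) :=
  Continuous.complexMk (by fun_prop) (by fun_prop)

theorem arcRadius_ne_zero (hnp : Nat.Coprime n p) {i : ℕ}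
    (hi : i + 1 < n + p) : arcRadius n p i ≠ 0 := fun h => by
  have h1 := endAbscissa_succ n p i
  have h2 : endAbscissa n (snailIndex n p i) = arcCenter n p i := by
    rw [arcRadius] at h; linarith
  rw [h, sub_zero, ← h2, endAbscissa, endAbscissa] at h1
  exact snailIndex_succ_ne hnp hi (by exact_mod_cast (by linarith :
    (snailIndex n p (i + 1) : ℝ) = snailIndex n p i))

theorem norm_snailArc_sub (n p i : ℕ) (τ : ℝ) :
    ‖snailArc n p i τ - (arcCenter n p i : ℂ)‖ = |arcRadius n p i| := by
  rw [snailArc, norm_mk_sub, ← Real.sqrt_sq_eq_abs (arcRadius n p i)]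
  congr 1
  have h1 : arcSide i ^ 2 = 1 := by rcases arcSide_eq i with h | h <;> rw [h] <;> norm_num
  rw [mul_pow, mul_pow, Real.sqrt_sq_eq_abs, sq_abs, h1, add_sub_cancel_left]
  linear_combination arcRadius n p i ^ 2 * Real.sin_sq_add_cos_sq (Real.pi * (τ - i))

theorem sin_pi_mul_nonneg {i : ℕ} {τ : ℝ} (h1 : (i : ℝ) ≤ τ) (h2 : τ ≤ ((i + 1 : ℕ) : ℝ)) :
    0 ≤ Real.sin (Real.pi * (τ - i)) := by
  have := Real.pi_pos
  push_cast at h2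
  exact Real.sin_nonneg_of_nonneg_of_le_pi (mul_nonneg this.le (by linarith)) (by nlinarith)

theorem sin_pi_mul_pos {i : ℕ} {τ : ℝ} (h1 : (i : ℝ) < τ) (h2 : τ < ((i + 1 : ℕ) : ℝ)) :
    0 < Real.sin (Real.pi * (τ - i)) := by
  have := Real.pi_pos
  push_cast at h2
  exact Real.sin_pos_of_pos_of_lt_pi (mul_pos this (by linarith)) (by nlinarith)

theorem abs_arcRadius_mem (hn : 0 < n) (hp : 0 < p) (hnp : Nat.Coprime n p) (i : ℕ) :
    (Even i → |arcRadius n p i| ∈ snailRadii (n + p)) ∧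
    (¬ Even i → snailIndex n p i < n → |arcRadius n p i| ∈ snailRadii n) ∧
    (¬ Even i → ¬ snailIndex n p i < n → |arcRadius n p i| ∈ snailRadii p) := by
  have hm := snailIndex_mem hn hp hnp i
  refine ⟨fun h => ?_, fun h h' => ?_, fun h h' => ?_⟩ <;> rw [abs_mem_snailRadii]
  · refine ⟨2 * snailIndex n p i + 1 - n - p, ?_, ⟨snailIndex n p i, by push_cast; ring⟩, ?_⟩
    · rw [abs_lt]; push_cast; omega
    · rw [arcRadius, arcCenter, if_pos h, endAbscissa]; push_cast; ring
  · refine ⟨2 * snailIndex n p i + 1 - n, ?_, ⟨snailIndex n p i, by ring⟩, ?_⟩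
    · rw [abs_lt]; omega
    · rw [arcRadius, arcCenter, if_neg h, if_pos h', endAbscissa]; push_cast; ring
  · refine ⟨2 * snailIndex n p i + 1 - 2 * n - p, ?_, ⟨snailIndex n p i - n, by ring⟩, ?_⟩
    · rw [abs_lt]; omega
    · rw [arcRadius, arcCenter, if_neg h, if_neg h', endAbscissa]; push_cast; ring

theorem snailArc_mem (hn : 0 < n) (hp : 0 < p) (hnp : Nat.Coprime n p) {i : ℕ} {τ : ℝ}
    (h1 : (i : ℝ) ≤ τ) (h2 : τ ≤ ((i + 1 : ℕ) : ℝ)) : snailArc n p i τ ∈ snail n p := by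
  have hs := mul_nonneg (abs_nonneg (arcRadius n p i)) (sin_pi_mul_nonneg h1 h2)
  have hnorm := norm_snailArc_sub n p i τ
  obtain ⟨r1, r2, r3⟩ := abs_arcRadius_mem hn hp hnp i
  have him : (snailArc n p i τ).im = arcSide i * (|arcRadius n p i| *
    Real.sin (Real.pi * (τ - i))) := rfl
  by_cases h : Even i
  · right
    refine ⟨?_, ?_⟩
    · rw [him, arcSide, if_pos h, one_mul]; exact hs
    · rw [arcCenter, if_pos h] at hnorm
      have e : snailCenter₂ n p = (((-(n : ℝ) + p) / 2 : ℝ) : ℂ) := by simp [snailCenter₂]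
      rw [e, hnorm]
      exact r1 h
  · left
    have hneg : (snailArc n p i τ).im ≤ 0 := by
      rw [him, arcSide, if_neg h]; linarith
    by_cases h' : snailIndex n p i < n
    · left
      refine ⟨hneg, ?_⟩
      rw [arcCenter, if_neg h, if_pos h'] at hnorm
      have e : snailCenter₁ n p = ((-(n : ℝ) / 2 : ℝ) : ℂ) := by simp [snailCenter₁]
      rw [e, hnorm]
      exact r2 h h'
    · right
      refine ⟨hneg, ?_⟩
      rw [arcCenter, if_neg h, if_neg h'] at hnorm
      have e : snailCenter₃ n p = ((p / 2 : ℝ) : ℂ) := by simp [snailCenter₃]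
      rw [e, hnorm]
      exact r3 h h'

/-- The snail, as a curve, has no double point. -/
theorem snailArc_inj (hn : 0 < n) (hp : 0 < p) (hnp : Nat.Coprime n p) {i i' : ℕ}
    (hi : i + 1 < n + p) (hi' : i' + 1 < n + p) {τ τ' : ℝ} (h1 : (i : ℝ) ≤ τ)
    (h2 : τ < ((i + 1 : ℕ) : ℝ)) (h1' : (i' : ℝ) ≤ τ') (h2' : τ' < ((i' + 1 : ℕ) : ℝ))
    (h : snailArc n p i τ = snailArc n p i' τ') : τ = τ' := by
  have hpi := Real.pi_pos
  have hr := arcRadius_ne_zero hnp hi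
  have hr' := arcRadius_ne_zero hnp hi'
  -- the abscissa determines the position on a half-circle
  have same : i = i' → τ = τ' := by
    rintro rfl
    have h3 : arcCenter n p i + arcRadius n p i * Real.cos (Real.pi * (τ - i)) =
        arcCenter n p i + arcRadius n p i * Real.cos (Real.pi * (τ' - i)) := congrArg Complex.re h
    have h4 := mul_left_cancel₀ hr (add_left_cancel h3)
    push_cast at h2 h2'
    have h5 := Real.injOn_cos ⟨mul_nonneg hpi.le (by linarith), by nlinarith⟩
      ⟨mul_nonneg hpi.le (by linarith), by nlinarith⟩ h4
    have := mul_left_cancel₀ hpi.ne' h5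
    linarith
  -- two half-circles with the same center and the same radius on the same side are equal
  have radii : (Even i ↔ Even i') → arcCenter n p i = arcCenter n p i' → i = i' := by
    intro hpar hc
    have h3 : |arcRadius n p i| = |arcRadius n p i'| := by
      rw [← norm_snailArc_sub n p i τ, ← norm_snailArc_sub n p i' τ', h, hc]
    rcases abs_eq_abs.1 h3 with h4 | h4
    · rw [arcRadius, arcRadius, hc, endAbscissa, endAbscissa] at h4
      refine snailIndex_injOn hnp (by omega) (by omega) ?_
      exact_mod_cast (by linarith : (snailIndex n p i : ℝ) = snailIndex n p i')
    · exfalso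
      have h5 := endAbscissa_succ n p i'
      rw [← hc] at h5
      rw [arcRadius] at h4
      have h6 : endAbscissa n (snailIndex n p i) = endAbscissa n (snailIndex n p (i' + 1)) := by
        linarith
      rw [endAbscissa, endAbscissa] at h6
      have h7 := snailIndex_injOn hnp (i := i) (i' := i' + 1) (by omega) (by omega)
        (by exact_mod_cast (by linarith : (snailIndex n p i : ℝ) = snailIndex n p (i' + 1)))
      rw [h7, Nat.even_add_one] at hpar
      tauto
  have hz := mul_nonneg (abs_nonneg (arcRadius n p i)) (sin_pi_mul_nonneg h1 h2.le)
  have hz' := mul_nonneg (abs_nonneg (arcRadius n p i')) (sin_pi_mul_nonneg h1' h2'.le)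
  have him : arcSide i * (|arcRadius n p i| * Real.sin (Real.pi * (τ - i))) =
      arcSide i' * (|arcRadius n p i'| * Real.sin (Real.pi * (τ' - i'))) := congrArg Complex.im h
  -- points of the axis are reached at integer times only
  have axis : ∀ {i : ℕ} {τ : ℝ}, arcRadius n p i ≠ 0 → (i : ℝ) ≤ τ → τ < ((i + 1 : ℕ) : ℝ) →
      |arcRadius n p i| * Real.sin (Real.pi * (τ - i)) = 0 → τ = i := by
    intro i τ hr h1 h2 h0
    by_contra h3
    have := mul_pos (abs_pos.2 hr) (sin_pi_mul_pos (lt_of_le_of_ne h1 (Ne.symm h3)) h2)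
    linarith
  have opposite : |arcRadius n p i| * Real.sin (Real.pi * (τ - i)) = 0 →
      |arcRadius n p i'| * Real.sin (Real.pi * (τ' - i')) = 0 → τ = τ' := by
    intro h3 h4
    apply same
    rw [axis hr h1 h2 h3, axis hr' h1' h2' h4, snailArc_left, snailArc_left,
      Complex.ofReal_inj, endAbscissa, endAbscissa] at h
    refine snailIndex_injOn hnp (by omega) (by omega) ?_
    exact_mod_cast (by linarith : (snailIndex n p i : ℝ) = snailIndex n p i')
  by_cases e : Even i <;> by_cases e' : Even i'
  · exact same (radii (by tauto) (by rw [arcCenter, arcCenter, if_pos e, if_pos e']))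
  · rw [arcSide, arcSide, if_pos e, if_neg e'] at him
    exact opposite (by linarith) (by linarith)
  · rw [arcSide, arcSide, if_neg e, if_pos e'] at him
    exact opposite (by linarith) (by linarith)
  · refine same (radii (by tauto) ?_)
    -- the left and the right bottom half-circles are separated by the imaginary axis
    have left : ∀ {i : ℕ} (τ : ℝ), ¬ Even i → snailIndex n p i < n → (snailArc n p i τ).re < 0 := by
      intro i τ e hl
      have h3 := (le_of_mem_snailRadii ((abs_arcRadius_mem hn hp hnp i).2.1 e hl)).2
      have h4 := Complex.re_le_norm (snailArc n p i τ - (arcCenter n p i : ℂ))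
      rw [norm_snailArc_sub, Complex.sub_re, Complex.ofReal_re, arcCenter, if_neg e,
        if_pos hl] at h4
      linarith
    have right : ∀ {i : ℕ} (τ : ℝ), ¬ Even i → ¬ snailIndex n p i < n →
        0 < (snailArc n p i τ).re := by
      intro i τ e hl
      have h3 := (le_of_mem_snailRadii ((abs_arcRadius_mem hn hp hnp i).2.2 e hl)).2
      have h4 := (abs_le.1 (Complex.abs_re_le_norm (snailArc n p i τ - (arcCenter n p i : ℂ)))).1
      rw [norm_snailArc_sub, Complex.sub_re, Complex.ofReal_re, arcCenter, if_neg e,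
        if_neg hl] at h4
      linarith
    rw [arcCenter, arcCenter, if_neg e, if_neg e']
    by_cases l : snailIndex n p i < n <;> by_cases l' : snailIndex n p i' < n
    · rw [if_pos l, if_pos l']
    · have := left τ e l
      rw [h] at this
      linarith [right τ' e' l']
    · have := right τ e l
      rw [h] at this
      linarith [left τ' e' l']
    · rw [if_neg l, if_neg l']

end Curve
end

noncomputable section

/-! ### The number of intersection points -/

section Count

variable {n p : ℕ}

/-- The lift through the cosine of the image of the `i`-th half-circle under the branched map. -/
def arcLift (n p i : ℕ) (τ : ℝ) : ℂ :=
  snailShift n p i * Real.pi + snailSign n p i *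
    (stripAbscissa (-(n : ℝ) / 2) ((-(n : ℝ) + p) / 2) (p / 2) (snailArc n p i τ).re +
      arcSide i * (|(snailArc n p i τ).im| +
        wallHeight (-(n : ℝ) / 2) ((-(n : ℝ) + p) / 2) (p / 2) (snailArc n p i τ).re : ℝ) *
          Complex.I)

theorem continuous_arcLift (n p i : ℕ) : Continuous (arcLift n p i) := by
  have h1 := continuous_stripAbscissa (-(n : ℝ) / 2) ((-(n : ℝ) + p) / 2) (p / 2)
  have h2 := continuous_wallHeight (-(n : ℝ) / 2) ((-(n : ℝ) + p) / 2) (p / 2)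
  have h3 := continuous_snailArc n p i
  unfold arcLift
  fun_prop

theorem cos_arcLift (hn : 0 < n) (hp : 0 < p) {i : ℕ} {τ : ℝ} (h1 : (i : ℝ) ≤ τ)
    (h2 : τ ≤ ((i + 1 : ℕ) : ℝ)) : Complex.cos (arcLift n p i τ) =
      branchedMap (-(n : ℝ) / 2) ((-(n : ℝ) + p) / 2) (p / 2) (snailArc n p i τ) := by
  have hn' : (1 : ℝ) ≤ n := by exact_mod_cast hn
  have hp' : (1 : ℝ) ≤ p := by exact_mod_cast hp
  have hs := mul_nonneg (abs_nonneg (arcRadius n p i)) (sin_pi_mul_nonneg h1 h2)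
  have him : (snailArc n p i τ).im = arcSide i * (|arcRadius n p i| *
    Real.sin (Real.pi * (τ - i))) := rfl
  have hper : ∀ x : ℂ, Complex.cos (snailShift n p i * Real.pi + snailSign n p i * x) =
      Complex.cos x := by
    intro x
    have e : (snailShift n p i : ℂ) * Real.pi + snailSign n p i * x = snailSign n p i * x +
        (((Finset.range (i + 1)).filter fun l => IsRightWall n p (snailIndex n p l)).card : ℕ) *
          (2 * Real.pi) := by
      rw [snailShift]; push_cast; ring
    rw [e, Complex.cos_add_nat_mul_two_pi]
    rcases snailSign_eq n p i with h | h <;> rw [h] <;> simp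
  rw [arcLift, hper]
  by_cases h : Even i
  · rw [arcSide, if_pos h, one_mul] at him
    rw [branchedMap_of_nonneg (by rw [him]; exact hs), arcSide, if_pos h]
    push_cast
    rw [one_mul]
  · rw [arcSide, if_neg h] at him
    rw [branchedMap_of_nonpos (by linarith) (by linarith) (by rw [him]; linarith), arcSide,
      if_neg h]
    push_cast
    congr 1
    ring

/-- The lifts on two consecutive half-circles agree at their common end: if it is on a wall, the
sign changes and the abscissa is the wall; otherwise the lift is real there. -/
theorem arcLift_glue (hn : 0 < n) (hp : 0 < p) (hnp : Nat.Coprime n p) {i : ℕ}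
    (hi : i + 2 < n + p) :
    arcLift n p i ((i + 1 : ℕ) : ℝ) = arcLift n p (i + 1) ((i + 1 : ℕ) : ℝ) := by
  have hn' : (1 : ℝ) ≤ n := by exact_mod_cast hn
  have hp' : (1 : ℝ) ≤ p := by exact_mod_cast hp
  have hab : -(n : ℝ) / 2 < (-(n : ℝ) + p) / 2 := by linarith
  have hbc : (-(n : ℝ) + p) / 2 < (p : ℝ) / 2 := by linarith
  unfold arcLift
  rw [snailArc_right, snailArc_left, snailShift_succ, arcSide_succ, Complex.ofReal_re,
    Complex.ofReal_im, abs_zero, zero_add, endAbscissa]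
  rcases snailSign_succ hn hp hnp hi with ⟨h1, h2, h3⟩ | ⟨h1, h2, h3⟩ | ⟨h1, h2, h3, h4⟩ | ⟨h1, h3⟩
  · rw [if_neg (by unfold IsRightWall; omega), h2, h3]
    have h1' : (2 : ℝ) * snailIndex n p (i + 1) < n - 1 := by exact_mod_cast h1
    rw [stripAbscissa_of_le hab hbc (by linarith)]
    push_cast
    ring
  · rw [if_neg (by unfold IsRightWall; omega), h3]
    have h1' : (n - 1 : ℝ) < 2 * snailIndex n p (i + 1) := by exact_mod_cast h1
    have h2' : (2 : ℝ) * snailIndex n p (i + 1) < n + p - 1 := by exact_mod_cast h2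
    rw [wallHeight_of_mid (by linarith) (by linarith)]
    push_cast
    ring
  · rw [if_pos ⟨h1, h2⟩, h3, h4]
    have h1' : (n + p - 1 : ℝ) < 2 * snailIndex n p (i + 1) := by exact_mod_cast h1
    have h2' : (2 : ℝ) * snailIndex n p (i + 1) < 2 * n + p - 1 := by exact_mod_cast h2
    rw [stripAbscissa_of_mem hab (by linarith) (by linarith)]
    push_cast
    ring
  · rw [if_neg (by unfold IsRightWall; omega), h3]
    have h1' : (2 * n + p - 1 : ℝ) < 2 * snailIndex n p (i + 1) := by exact_mod_cast h1
    rw [wallHeight_of_ge hab hbc (by linarith)]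
    push_cast
    ring

/-- The lifted curve starts at `0` if `n` is odd and at `-π` if `n` is even. -/
theorem arcLift_start (hn : 0 < n) (hp : 0 < p) (hnp : Nat.Coprime n p) :
    arcLift n p 0 ((0 : ℕ) : ℝ) = (2 * ((n - 1 : ℤ) / 2) + 1 - n : ℤ) * Real.pi := by
  have hn' : (1 : ℝ) ≤ n := by exact_mod_cast hn
  have hp' : (1 : ℝ) ≤ p := by exact_mod_cast hp
  have hab : -(n : ℝ) / 2 < (-(n : ℝ) + p) / 2 := by linarith
  have hbc : (-(n : ℝ) + p) / 2 < (p : ℝ) / 2 := by linarith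
  unfold arcLift
  rw [snailArc_left, snailShift_zero hp hnp, Complex.ofReal_re, Complex.ofReal_im, abs_zero,
    zero_add, endAbscissa]
  rcases snailIndex_zero_range hnp with ⟨⟨r, hr⟩, h⟩ | ⟨⟨r, hr⟩, -, h⟩
  · have h' : (2 : ℝ) * snailIndex n p 0 = n - 1 := by exact_mod_cast h
    rw [stripAbscissa_of_le hab hbc (by linarith), wallHeight_of_mid (by linarith) (by linarith),
      show (2 * ((n - 1 : ℤ) / 2) + 1 - n : ℤ) = 0 by omega]
    simp
  · have h' : (2 : ℝ) * snailIndex n p 0 = 2 * n + p - 1 := by exact_mod_cast h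
    have hs : snailSign n p 0 = -1 := by
      rw [snailSign, if_pos Even.zero, if_neg (by omega)]
    rw [stripAbscissa_of_mem hab (by linarith) (by linarith),
      wallHeight_of_ge hab hbc (by linarith),
      hs, show (2 * ((n - 1 : ℤ) / 2) + 1 - n : ℤ) = -1 by omega]
    simp

theorem arcLift_end (hn : 0 < n) (hp : 0 < p) (hnp : Nat.Coprime n p) :
    arcLift n p (n + p - 2) ((n + p - 2 + 1 : ℕ) : ℝ) =
      (2 * ((n - 1 : ℤ) / 2) + 1 : ℤ) * Real.pi := by
  have hn' : (1 : ℝ) ≤ n := by exact_mod_cast hn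
  have hp' : (1 : ℝ) ≤ p := by exact_mod_cast hp
  have hab : -(n : ℝ) / 2 < (-(n : ℝ) + p) / 2 := by linarith
  have hbc : (-(n : ℝ) + p) / 2 < (p : ℝ) / 2 := by linarith
  unfold arcLift
  rw [snailArc_right, snailShift_last hn hp hnp, snailSign_last hn hp hnp, Complex.ofReal_re,
    Complex.ofReal_im, abs_zero, zero_add, endAbscissa, show n + p - 2 + 1 = n + p - 1 by omega]
  rcases snailIndex_last hn hp hnp with h | h
  · have h' : (2 : ℝ) * snailIndex n p (n + p - 1) = n + p - 1 := by exact_mod_cast h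
    rw [stripAbscissa_of_mem hab (by linarith) (by linarith),
      wallHeight_of_mid (by linarith) (by linarith)]
    push_cast
    ring
  · have h' : (2 : ℝ) * snailIndex n p (n + p - 1) = 2 * n + p - 1 := by exact_mod_cast h
    rw [stripAbscissa_of_mem hab (by linarith) (by linarith),
      wallHeight_of_ge hab hbc (by linarith)]
    push_cast
    ring

theorem ofReal_mem_snailCenters_iff (n p : ℕ) (j : ℤ) :
    (endAbscissa n j : ℂ) ∈ snailCenters n p ↔
      2 * j = n - 1 ∨ 2 * j = n + p - 1 ∨ 2 * j = 2 * n + p - 1 := by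
  have e1 : snailCenter₁ n p = ((-(n : ℝ) / 2 : ℝ) : ℂ) := by simp [snailCenter₁]
  have e2 : snailCenter₂ n p = (((-(n : ℝ) + p) / 2 : ℝ) : ℂ) := by simp [snailCenter₂]
  have e3 : snailCenter₃ n p = ((p / 2 : ℝ) : ℂ) := by simp [snailCenter₃]
  simp only [snailCenters, Set.mem_insert_iff, Set.mem_singleton_iff, e1, e2, e3,
    Complex.ofReal_inj, endAbscissa]
  refine or_congr ?_ (or_congr ?_ ?_) <;> rw [← @Int.cast_inj ℝ] <;> push_cast <;>
    constructor <;> intro h <;> linarith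

/-- Every set isotopic to the bisector of the first two centers meets the snail in at least `n`
points. -/
theorem le_encard_snail_inter (hn : 0 < n) (hp : 0 < p) (hnp : Nat.Coprime n p) {K : Set ℂ}
    (hK : IsotopicRel (snailCenters n p)
      (AffineSubspace.perpBisector (snailCenter₁ n p) (snailCenter₂ n p) : Set ℂ) K) :
    (n : ℕ∞) ≤ (snail n p ∩ K).encard := by
  have hn' : (1 : ℝ) ≤ n := by exact_mod_cast hn
  have hp' : (1 : ℝ) ≤ p := by exact_mod_cast hp
  have hab : -(n : ℝ) / 2 < (-(n : ℝ) + p) / 2 := by linarith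
  have hbc : (-(n : ℝ) + p) / 2 < (p : ℝ) / 2 := by linarith
  obtain ⟨φ, hφ, hfix, rfl⟩ := hK
  obtain ⟨s, s1, s2⟩ := exists_continuous_glue (snailArc n p) (continuous_snailArc n p)
    (n + p - 2) (fun i _ => by rw [snailArc_right, snailArc_left])
  obtain ⟨w, w1, w2⟩ := exists_continuous_glue (arcLift n p) (continuous_arcLift n p)
    (n + p - 2) (fun i hi => arcLift_glue hn hp hnp (by omega))
  have hM : ((n + p - 2 + 1 : ℕ) : ℝ) = n + p - 1 := by
    rw [show n + p - 2 + 1 = n + p - 1 by omega, Nat.cast_sub (by omega)]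
    push_cast
    ring
  -- the half-circle travelled at a given time
  have hpiece : ∀ τ : ℝ, 0 ≤ τ → τ < ((n + p - 2 + 1 : ℕ) : ℝ) →
      ∃ i ≤ n + p - 2, (i : ℝ) ≤ τ ∧ τ < ((i + 1 : ℕ) : ℝ) := by
    intro τ h0 h1
    refine ⟨⌊τ⌋₊, ?_, Nat.floor_le h0, by push_cast; exact Nat.lt_floor_add_one τ⟩
    have := (Nat.floor_lt h0).2 h1
    omega
  have hs0 : s 0 = (endAbscissa n (snailIndex n p 0) : ℂ) := by
    rw [← Nat.cast_zero, s2 0 (by omega) _ le_rfl (by norm_num), snailArc_left]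
  have hsM : s ((n + p - 2 + 1 : ℕ) : ℝ) = (endAbscissa n (snailIndex n p (n + p - 1)) : ℂ) := by
    rw [s2 _ le_rfl _ (by push_cast; linarith) le_rfl, snailArc_right,
      show n + p - 2 + 1 = n + p - 1 by omega]
  have key := le_encard_crossings (continuous_branchedMap hab hbc) (X := snailCenters n p)
    (fun z hz => by
      rcases mem_of_branchedMap_sq_eq_one hab hbc hz with rfl | rfl | rfl
      · left; simp [snailCenter₁]
      · right; left; simp [snailCenter₂]
      · right; right; simp [snailCenter₃])
    hφ hfix s1 w1 (M := ((n + p - 2 + 1 : ℕ) : ℝ)) (by positivity) ?_ ?_ ?_ ?_ ?_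
    (k := 2 * ((n - 1 : ℤ) / 2) + 1 - n) (n := n) ?_ ?_
  · refine key.trans (Set.encard_le_encard ?_)
    rintro _ ⟨⟨τ, hτ, rfl⟩, hz⟩
    obtain ⟨i, hi, h1, h2⟩ := hpiece τ hτ.1.le hτ.2
    refine ⟨?_, (φ 1).symm (s τ), ?_, (φ 1).apply_symm_apply _⟩
    · rw [s2 i hi τ h1 h2.le]
      exact snailArc_mem hn hp hnp h1 h2.le
    · rw [mem_perpBisector_iff_re (snailCenter₁_im _ _) (snailCenter₂_im _ _)
        (snailCenter₁_lt n hp), snailCenter₁_re, snailCenter₂_re]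
      exact two_mul_re_of_branchedMap_re_eq_zero hab hbc hz
  · rintro τ ⟨h0, h1⟩
    rcases h1.lt_or_eq with h1 | rfl
    · obtain ⟨i, hi, h2, h3⟩ := hpiece τ h0 h1
      rw [s2 i hi τ h2 h3.le, w2 i hi τ h2 h3.le]
      exact cos_arcLift hn hp h2 h3.le
    · have h2 : ((n + p - 2 : ℕ) : ℝ) ≤ ((n + p - 2 + 1 : ℕ) : ℝ) := by push_cast; linarith
      rw [s2 _ le_rfl _ h2 le_rfl, w2 _ le_rfl _ h2 le_rfl]
      exact cos_arcLift hn hp h2 le_rfl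
  · rw [hs0, ofReal_mem_snailCenters_iff]
    have := snailIndex_zero_range hnp
    tauto
  · rw [hsM, ofReal_mem_snailCenters_iff]
    exact Or.inr (snailIndex_last hn hp hnp)
  · rintro τ ⟨h0, h1⟩ hmem
    obtain ⟨i, hi, h2, h3⟩ := hpiece τ h0.le h1
    have him : (s τ).im = 0 := by
      rcases hmem with h | h | h <;> rw [h]
      exacts [snailCenter₁_im _ _, snailCenter₂_im _ _, snailCenter₃_im _ _]
    rw [s2 i hi τ h2 h3.le] at hmem him
    have hτ : τ = i := by
      by_contra hne
      have h4 := mul_pos (abs_pos.2 (arcRadius_ne_zero hnp (i := i) (by omega)))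
        (sin_pi_mul_pos (lt_of_le_of_ne h2 (Ne.symm hne)) h3)
      have h5 : arcSide i * (|arcRadius n p i| * Real.sin (Real.pi * (τ - i))) = 0 := him
      rcases arcSide_eq i with h | h <;> rw [h] at h5 <;> linarith
    rw [hτ, snailArc_left, ofReal_mem_snailCenters_iff] at hmem
    obtain ⟨l, rfl⟩ : ∃ l, i = l + 1 := Nat.exists_eq_succ_of_ne_zero (by
      rintro rfl
      rw [hτ] at h0
      simp at h0)
    have := snailIndex_ne_center hn hp hnp (i := l) (by omega)
    tauto
  · rintro τ ⟨h0, h1⟩ τ' ⟨h0', h1'⟩ h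
    obtain ⟨i, hi, h2, h3⟩ := hpiece τ h0.le h1
    obtain ⟨i', hi', h2', h3'⟩ := hpiece τ' h0'.le h1'
    rw [s2 i hi τ h2 h3.le, s2 i' hi' τ' h2' h3'.le] at h
    exact snailArc_inj hn hp hnp (by omega) (by omega) h2 h3 h2' h3' h
  · rw [← arcLift_start hn hp hnp, ← Nat.cast_zero, w2 0 (by omega) _ le_rfl (by norm_num)]
  · rw [w2 _ le_rfl _ (by push_cast; linarith) le_rfl, arcLift_end hn hp hnp]
    congr 2
    ring

/-- `n` is the minimal number of intersection points of the snail with the bisector of the first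
two centers, up to isotopy. -/
theorem isLeast_intersectionNumbers (hn : 0 < n) (hp : 0 < p) (hnp : Nat.Coprime n p) {S : Set ℂ}
    (hS : IsotopicRel (snailCenters n p) (snail n p) S) :
    IsLeast (intersectionNumbers (snailCenters n p)
      (AffineSubspace.perpBisector (snailCenter₁ n p) (snailCenter₂ n p) : Set ℂ) S) (n : ℕ∞) := by
  rw [← intersectionNumbers_congr hS]
  obtain ⟨K, h1, h2⟩ := exists_isotopicRel_encard_le hn hp
  refine ⟨⟨K, h1, le_antisymm h2 (le_encard_snail_inter hn hp hnp h1)⟩, ?_⟩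
  rintro _ ⟨K, h1, rfl⟩
  exact le_encard_snail_inter hn hp hnp h1

theorem reflection_image_snailCenters (n p : ℕ) :
    reflection '' snailCenters n p = snailCenters p n := by
  rw [snailCenters, Set.image_insert_eq, Set.image_insert_eq, Set.image_singleton,
    reflection_snailCenter₁, reflection_snailCenter₂, reflection_snailCenter₃, snailCenters]
  ext z
  simp only [Set.mem_insert_iff, Set.mem_singleton_iff]
  tauto

theorem reflection_image_perpBisector (hn : 0 < n) :
    reflection '' (AffineSubspace.perpBisector (snailCenter₂ n p) (snailCenter₃ n p) : Set ℂ) =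
      (AffineSubspace.perpBisector (snailCenter₁ p n) (snailCenter₂ p n) : Set ℂ) := by
  ext z
  rw [← Homeomorph.coe_toEquiv, Equiv.image_eq_preimage_symm, Set.mem_preimage]
  change reflection.symm z ∈ _ ↔ _
  rw [reflection_symm, mem_perpBisector_iff_re (snailCenter₂_im _ _) (snailCenter₃_im _ _)
    (snailCenter₂_lt hn p), mem_perpBisector_iff_re (snailCenter₁_im _ _) (snailCenter₂_im _ _)
    (snailCenter₁_lt p hn), reflection_re, snailCenter₁_re, snailCenter₂_re, snailCenter₂_re,
    snailCenter₃_re]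
  constructor <;> intro h <;> linarith

/-- `p` is the minimal number of intersection points of the snail with the bisector of the last
two centers, up to isotopy. -/
theorem isLeast_intersectionNumbers_right (hn : 0 < n) (hp : 0 < p) (hnp : Nat.Coprime n p)
    {S : Set ℂ} (hS : IsotopicRel (snailCenters n p) (snail n p) S) :
    IsLeast (intersectionNumbers (snailCenters n p)
      (AffineSubspace.perpBisector (snailCenter₂ n p) (snailCenter₃ n p) : Set ℂ) S) (p : ℕ∞) := by
  have h := hS.image reflection
  rw [reflection_image_snailCenters, reflection_image_snail] at h
  have key := isLeast_intersectionNumbers hp hn hnp.symm h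
  have e : ∀ A : Set ℂ, reflection '' (reflection '' A) = A := fun A => by
    rw [Set.image_image]
    simp [reflection_reflection]
  have h1 := intersectionNumbers_subset_image (snailCenters n p)
    (AffineSubspace.perpBisector (snailCenter₂ n p) (snailCenter₃ n p) : Set ℂ) S reflection
  have h2 := intersectionNumbers_subset_image (reflection '' snailCenters n p)
    (reflection '' (AffineSubspace.perpBisector (snailCenter₂ n p) (snailCenter₃ n p) : Set ℂ))
    (reflection '' S) reflection
  rw [e, e, e] at h2
  rw [h1.antisymm h2, reflection_image_snailCenters, reflection_image_perpBisector hn]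
  exact key

end Count

end

theorem mainTheorem3 (n p : ℕ) (hn : 0 < n) (hp : 0 < p) (hnp : Nat.Coprime n p)
    (N : ℕ) (α β : ℕ → ℕ) (hαβ : IsCharacteristic n p N α β)
    (fA fB : ℂ ≃ₜ ℂ)
    (hA : IsTypeA (snailCenter₁ n p) (snailCenter₂ n p) (snailCenter₃ n p) fA)
    (hB : IsTypeB (snailCenter₁ n p) (snailCenter₂ n p) (snailCenter₃ n p) fB) :
    (fun Γ : Set ℂ => alternatingProduct fA fB α β N '' Γ) '' snailClass (snailCenters n p) 1 1
        = snailClass (snailCenters n p) n p ∧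
    (∀ Γ ∈ snailClass (snailCenters n p) 1 1,
      IsotopicRel (snailCenters n p) (snail n p) (alternatingProduct fA fB α β N '' Γ)) ∧
    (∀ S ∈ snailClass (snailCenters n p) n p,
      IsLeast (intersectionNumbers (snailCenters n p)
        (AffineSubspace.perpBisector (snailCenter₁ n p) (snailCenter₂ n p) : Set ℂ) S) (n : ℕ∞) ∧
      IsLeast (intersectionNumbers (snailCenters n p)
        (AffineSubspace.perpBisector (snailCenter₂ n p) (snailCenter₃ n p) : Set ℂ) S) (p : ℕ∞)) := by
  have hclass : ∀ H, alternatingProduct fA fB α β N '' H ∈ snailClass (snailCenters n p) n p ↔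
      H ∈ snailClass (snailCenters n p) 1 1 := fun H =>
    (alternatingProduct_image_mem_snailClass_iff (fun _ _ => hasLeftStep)
      (isOrderedTriple_snailCenter hn hp) hA hB α β H N (n, p) hαβ.2.2.2.symm).2
  refine ⟨?_, fun Γ hΓ => isotopicRel_of_mem_snailClass hn hp ((hclass Γ).2 hΓ), fun S hS => ?_⟩
  · ext H
    constructor
    · rintro ⟨Γ, hΓ, rfl⟩
      exact (hclass Γ).2 hΓ
    · intro hH
      have hsurj := alternatingProduct_surjective fA.surjective fB.surjective α β N
      refine ⟨alternatingProduct fA fB α β N ⁻¹' H, ?_, Set.image_preimage_eq H hsurj⟩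
      rw [← hclass, Set.image_preimage_eq H hsurj]
      exact hH
  · have h := isotopicRel_of_mem_snailClass hn hp hS
    exact ⟨isLeast_intersectionNumbers hn hp hnp h, isLeast_intersectionNumbers_right hn hp hnp h⟩
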